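/- Let $\mathfrak t$ be a finite-dimensional complex vector space, $W\subset GL(\mathfrak t)$ a finite group generated by complex reflections (automorphisms of finite order whose fixed locus is a hyperplane), $\mathcal A$ the arrangement of the fixed hyperplanes of the reflections in $W$, and $L(\mathcal A)$ the set of all intersections of members of $\mathcal A$ (including $\mathfrak t$). For $X\in L(\mathcal A)$ let $\mathcal A_X=\{a\in\mathcal A: X\subset a\}$, let $\operatorname{irr}\mathcal A_X$ be the set of irreducible components of $\mathcal A_X$ (the nonempty irreducible essential summands in the decomposition of $\mathcal A_X$ as a direct sum of an empty arrangement and irreducible essential ones), let $W_X\subset W$ be the subgroup fixing $X$ pointwise, and $\mathrm{stab}(X)=\{w\in W: wX=X\}$. A $(W,\mathfrak t)$-cameral cover of $\operatorname{Spec}\mathbb C$ is a $\mathbb C$-scheme $C$ with a left $W$-action such that, for some étale cover $U\to\operatorname{Spec}\mathbb C$ and some map $U\to\mathfrak t/W$ over $\mathbb C$, there is a $W$-equivariant isomorphism $U\times_{\mathfrak t/W}\mathfrak t\cong U\times C$ over $U$. (Such a $C$ is affine.) Let $X\in L(\mathcal A)$ and let $(C_X,\sigma)$ be a cameral cover of $\operatorname{Spec}\mathbb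 C$ with a $\mathbb C$-point $\sigma$ such that $\mathrm{stab}_W(\sigma)=W_X$. Let $\bar Q_X$ be the group scheme of $W$-equivariant automorphisms of $C_X$, let $Q_X\subset\bar Q_X$ be the subgroup scheme of those fixing $\sigma$, and let $\operatorname{Aut}T_\sigma C_X$ be the group scheme of automorphisms of the tangent space $T_\sigma C_X$ as a $W_X$-representation. Then, as group schemes over $\mathbb C$: 1. $\operatorname{Aut}T_\sigma C_X\cong\mathbb G_m^{\#\operatorname{irr}\mathcal A_X}$. 2. The homomorphism $Q_X\to\operatorname{Aut}T_\sigma C_X$ given by the action on the tangent space is split, and its kernel $U$ is a connected unipotent group; thus $Q_X=U\rtimes\operatorname{Aut}T_\sigma C_X$. 3. $\bar Q_X=Q_X\rtimes\big(\mathrm{stab}(X)/W_X\big)$, where $\mathrm{stab}(X)/W_X$ is regarded as a constant group scheme. More precisely, there is an embedding $\rho:\mathrm{stab}(X)/W_X\to\bar Q_X$ onto a complement of the normal subgroup $Q_X$, inducing the natural action of $\mathrm{stab}(X)$ on $Q_X$ in the following sense. Let $Co(W_X,\mathfrak t)$ be the fibre of $\mathfrak t\to\mathfrak t/W_X$ over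 the origin, on which $\mathrm{stab}(X)$ acts through its linear action on $\mathfrak t$. There is an isomorphism of the connected component of $\sigma$ in $C_X$ with $Co(W_X,\mathfrak t)$ under which, for every $n\in\mathrm{stab}(X)$, the automorphism $c\mapsto n\cdot\rho(n)(c)$ of the scheme $C_X$, which preserves this component, acts on it as $n$ acts on $Co(W_X,\mathfrak t)$. -/

import Mathlib

open CategoryTheory TensorProduct
open scoped Pointwise

noncomputable section

namespace Cameral

/-! ### Hyperplane arrangements -/

section Arrangements

variable {V : Type} [AddCommGroup V] [Module ℂ V]

/-- The central arrangement `A` (a set of hyperplanes through the origin of `V`) is the direct sum of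
its sub-arrangements `B` and `C`: there is a decomposition `V = V₁ ⊕ V₂` such that the members
of `B` are pulled back from `V₁` along the projection (i.e. contain `V₂`) and the members of
`C` are pulled back from `V₂` (i.e. contain `V₁`). -/
def IsDirectSum (A B C : Set (Submodule ℂ V)) : Prop :=
  A = B ∪ C ∧ ∃ V₁ V₂ : Submodule ℂ V, IsCompl V₁ V₂ ∧
    (∀ H ∈ B, V₂ ≤ H) ∧ (∀ H ∈ C, V₁ ≤ H)

/-- An arrangement is irreducible if it is not a direct sum of two nonempty arrangements. -/
def IsIrreducibleArr (A : Set (Submodule ℂ V)) : Prop :=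
  ¬ ∃ B C : Set (Submodule ℂ V), B.Nonempty ∧ C.Nonempty ∧ IsDirectSum A B C

/-- The irreducible components of an arrangement `A`: writing `A = E ⊕ B₁ ⊕ ⋯ ⊕ Bₙ` with `E`
empty and the `Bᵢ` irreducible, essential and nonempty, the component `Bᵢ` is
recorded by the set of hyperplanes of `A` pulled back from it. These sets are exactly the nonempty
irreducible sub-arrangements of `A` that are direct summands of `A`. -/
def irrComponents (A : Set (Submodule ℂ V)) : Set (Set (Submodule ℂ V)) :=
  {B | B ⊆ A ∧ B.Nonempty ∧ IsIrreducibleArr B ∧ IsDirectSum A B (A \ B)}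

/-- The intersection poset: all intersections of members of `A` (the empty intersection is `V`). -/
def intersections (A : Set (Submodule ℂ V)) : Set (Submodule ℂ V) :=
  {X | ∃ S ⊆ A, X = sInf S}

/-- The sub-arrangement of the members of `A` that contain `X`. -/
def containing (A : Set (Submodule ℂ V)) (X : Submodule ℂ V) : Set (Submodule ℂ V) :=
  {H ∈ A | X ≤ H}

/-! ### Complex reflection groups -/

/-- The fixed locus of a linear automorphism. -/
def fixedLocus (w : V ≃ₗ[ℂ] V) : Submodule ℂ V :=
  LinearMap.eqLocus (w : V →ₗ[ℂ] V) LinearMap.id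

/-- A complex reflection: an automorphism of finite order whose fixed locus is a hyperplane. -/
def IsReflection (w : V ≃ₗ[ℂ] V) : Prop :=
  IsOfFinOrder w ∧ IsCoatom (fixedLocus w)

/-- A complex reflection group: a finite group generated by complex reflections. -/
structure IsReflectionGroup (W : Subgroup (V ≃ₗ[ℂ] V)) : Prop where
  finite : Finite W
  closure_eq : Subgroup.closure {w | w ∈ W ∧ IsReflection w} = W

/-- The arrangement of mirrors of `W`. -/
def mirrors (W : Subgroup (V ≃ₗ[ℂ] V)) : Set (Submodule ℂ V) :=
  {H | ∃ w ∈ W, IsReflection w ∧ fixedLocus w = H}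

variable (W : Subgroup (V ≃ₗ[ℂ] V)) (X : Submodule ℂ V)

/-- `W_X`, the subgroup of `W` fixing all points of `X`. -/
def pointwiseStab : Subgroup W := fixingSubgroup W (X : Set V)

/-- `stab(X)`, the subgroup of the `w ∈ W` with `w X = X`. -/
def setStab : Subgroup W := MulAction.stabilizer W (X : Set V)

instance pointwiseStab_normal : ((pointwiseStab W X).subgroupOf (setStab W X)).Normal := by
  refine ⟨fun n hn g => ?_⟩
  rw [Subgroup.mem_subgroupOf, pointwiseStab, mem_fixingSubgroup_iff] at hn ⊢
  intro x hx
  have hg : ((g⁻¹ : setStab W X) : W) • (X : Set V) = (X : Set V) := (g⁻¹).2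
  have hx' : ((g⁻¹ : setStab W X) : W) • x ∈ (X : Set V) := by
    rw [← hg]; exact Set.smul_mem_smul_set hx
  have := hn _ hx'
  simp only [Subgroup.coe_mul, mul_smul, this]
  simp

/-- `stab(X) / W_X`. -/
abbrev StabQuotient : Type := setStab W X ⧸ (pointwiseStab W X).subgroupOf (setStab W X)

/-! ### The quotient map of a linear group, and coinvariants -/

/-- The coordinate ring `Sym(V^∨)` of the affine space `V`. -/
abbrev Coord (V : Type) [AddCommGroup V] [Module ℂ V] : Type :=
  SymmetricAlgebra ℂ (Module.Dual ℂ V)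

/-- The left action of a linear automorphism `w` of `V` on functions, `f ↦ f ∘ w⁻¹`. -/
def coordAct (w : V ≃ₗ[ℂ] V) : Coord V →ₐ[ℂ] Coord V :=
  SymmetricAlgebra.lift
    (SymmetricAlgebra.ι ℂ (Module.Dual ℂ V) ∘ₗ (w.symm : V →ₗ[ℂ] V).dualMap)

/-- The coordinate ring `Sym(V^∨)^W` of the quotient `V / W`. -/
def invariants (W : Subgroup (V ≃ₗ[ℂ] V)) : Subalgebra ℂ (Coord V) :=
  ⨅ w ∈ W, AlgHom.equalizer (coordAct w) (AlgHom.id ℂ (Coord V))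

/-- The action of `w ∈ W` on `Sym(V^∨)`, as a map of algebras over the invariants. -/
def coordActInv (W : Subgroup (V ≃ₗ[ℂ] V)) (w : W) : Coord V →ₐ[invariants W] Coord V :=
  { (coordAct (w : V ≃ₗ[ℂ] V)).toRingHom with
    commutes' := fun r => by
      have h := r.2
      simp only [invariants, Algebra.mem_iInf] at h
      exact h w w.2 }

/-- The ideal generated by the polynomials invariant under the subgroup `H` of `W` and vanishing at the
origin. The quotient of `Coord V` by it is the coordinate ring of `Co(H, V)`, the
fibre of `V → V / H` over the origin. -/
def coinvariantIdeal {W : Subgroup (V ≃ₗ[ℂ] V)} (H : Subgroup W) : Ideal (Coord V) :=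
  Ideal.span {p | p ∈ invariants (H.map W.subtype) ∧ SymmetricAlgebra.algebraMapInv p = 0}

end Arrangements

/-! ### Cameral covers of a point

A cameral cover is affine over its base, so a cameral cover of `Spec ℂ` is given by its coordinate
ring `R`. The left action of `W` on `Spec R` is encoded by the left action
`w • r = r ∘ w⁻¹` on functions. -/

section Cover

variable {V : Type} [AddCommGroup V] [Module ℂ V] (W : Subgroup (V ≃ₗ[ℂ] V))
variable (R : Type) [CommRing R] [Algebra ℂ R] [MulSemiringAction W R] [SMulCommClass W ℂ R]

/-- The action of `w ∈ W` on `R` by `ℂ`-algebra endomorphisms. -/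
def actAlgHom (w : W) : R →ₐ[ℂ] R := MulSemiringAction.toAlgHom ℂ R w

/-- `Spec R` is a `(W, V)`-cameral cover of `Spec ℂ`: there are an étale cover
`Spec B → Spec ℂ`, a map `Spec B → V / W` over `ℂ` and a `W`-equivariant isomorphism
`Spec B ×_{V/W} V ≅ Spec B × Spec R` over `Spec B`. -/
def IsCameralCover : Prop :=
  ∃ (B : Type) (_ : CommRing B) (_ : Algebra ℂ B) (_ : Algebra (invariants W) B)
    (_ : IsScalarTower ℂ (invariants W) B),
    Algebra.Etale ℂ B ∧ Function.Surjective (PrimeSpectrum.comap (algebraMap ℂ B)) ∧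
    ∃ e : B ⊗[invariants W] Coord V ≃ₐ[B] B ⊗[ℂ] R,
      ∀ (w : W) (x : B ⊗[invariants W] Coord V),
        e (Algebra.TensorProduct.map (AlgHom.id B B) (coordActInv W w) x) =
          Algebra.TensorProduct.map (AlgHom.id B B) (actAlgHom W R w) (e x)

variable {W R} (σ : R →ₐ[ℂ] ℂ)

/-- The stabilizer in `W` of a point `σ : Spec ℂ → Spec R`. -/
def pointStab : Subgroup W where
  carrier := {w | ∀ r : R, σ (w • r) = σ r}
  mul_mem' := fun {a b} ha hb r => by rw [mul_smul, ha, hb]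
  one_mem' := fun r => by rw [one_smul]
  inv_mem' := fun {a} ha r => by rw [← ha (a⁻¹ • r), smul_inv_smul]

/-- The tangent space at the point `σ`: linear maps `D : R → ℂ` satisfying the Leibniz rule
`D (r s) = σ(r) D(s) + σ(s) D(r)`. -/
def tangentSpace : Submodule ℂ (Module.Dual ℂ R) where
  carrier := {D | ∀ r s : R, D (r * s) = σ r * D s + σ s * D r}
  add_mem' := fun {a b} ha hb r s => by
    simp only [LinearMap.add_apply, ha r s, hb r s]; ring
  zero_mem' := fun r s => by simp
  smul_mem' := fun c a ha r s => by
    simp only [LinearMap.smul_apply, ha r s, smul_eq_mul]; ring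

/-- The action of the stabilizer of `σ` on the tangent space at `σ`, `(w D)(r) = D(w⁻¹ r)`. -/
def tangentAct (w : pointStab (W := W) σ) : tangentSpace σ →ₗ[ℂ] tangentSpace σ :=
  LinearMap.restrict (actAlgHom W R (w⁻¹ : pointStab (W := W) σ)).toLinearMap.dualMap
    (fun D hD r s => by
      have h := (w⁻¹).2
      change D (((w⁻¹ : pointStab (W := W) σ) : W) • (r * s)) = _
      rw [smul_mul', hD, h r, h s]
      rfl)

end Cover

/-! ### Group functors on `ℂ`-algebras

Affine group schemes over `ℂ` are treated through their functors of points. -/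

/-- Group-valued functors on commutative `ℂ`-algebras. -/
abbrev GroupFunctor := CommAlgCat.{0} ℂ ⥤ GrpCat.{0}

/-- A subgroup functor of a group functor. -/
structure Subfunctor (G : GroupFunctor) where
  pts : ∀ A : CommAlgCat.{0} ℂ, Subgroup (G.obj A)
  map_mem : ∀ {A B : CommAlgCat.{0} ℂ} (f : A ⟶ B) (g : G.obj A),
    g ∈ pts A → G.map f g ∈ pts B

/-- The group functor underlying a subgroup functor. -/
def Subfunctor.toFunctor {G : GroupFunctor} (S : Subfunctor G) : GroupFunctor where
  obj A := GrpCat.of (S.pts A)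
  map {A B} f := GrpCat.ofHom
    (((G.map f).hom.comp (S.pts A).subtype).codRestrict (S.pts B)
      (fun g => S.map_mem f g g.2))
  map_id A := by
    refine GrpCat.hom_ext (MonoidHom.ext fun g => Subtype.ext ?_)
    exact ConcreteCategory.congr_hom (G.map_id A) g.1
  map_comp f h := by
    refine GrpCat.hom_ext (MonoidHom.ext fun g => Subtype.ext ?_)
    exact ConcreteCategory.congr_hom (G.map_comp f h) g.1

/-- The kernel of a homomorphism of group functors. -/
def kernel {G H : GroupFunctor} (d : G ⟶ H) : Subfunctor G where
  pts A := (d.app A).hom.ker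
  map_mem {A B} f g hg := by
    rw [MonoidHom.mem_ker] at hg ⊢
    have h := ConcreteCategory.congr_hom (d.naturality f) g
    simp only [ConcreteCategory.comp_apply] at h
    change (d.app B) (G.map f g) = 1
    rw [h]
    change (H.map f) ((d.app A).hom g) = 1
    rw [hg, map_one]

/-- The map `f ⊗ M : A ⊗ M → B ⊗ M`. -/
def baseMap (M : Type) [AddCommGroup M] [Module ℂ M] {A B : CommAlgCat.{0} ℂ} (f : A ⟶ B) :
    A ⊗[ℂ] M →ₗ[ℂ] B ⊗[ℂ] M :=
  f.hom.toLinearMap.rTensor M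

@[simp] theorem baseMap_tmul (M : Type) [AddCommGroup M] [Module ℂ M] {A B : CommAlgCat.{0} ℂ}
    (f : A ⟶ B) (a : A) (m : M) : baseMap M f (a ⊗ₜ m) = f.hom a ⊗ₜ m := rfl

theorem baseMap_smul (M : Type) [AddCommGroup M] [Module ℂ M] {A B : CommAlgCat.{0} ℂ}
    (f : A ⟶ B) (a : A) (x : A ⊗[ℂ] M) :
    baseMap M f (a • x) = f.hom a • baseMap M f x := by
  induction x with
  | zero => simp only [smul_zero, map_zero]
  | add x y hx hy => simp only [smul_add, map_add, hx, hy]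
  | tmul b n => simp [TensorProduct.smul_tmul']

/-- Base change along `f : A → B` of an endomorphism `g`: the `B`-linear map
`B ⊗ M → B ⊗ M` with `1 ⊗ m ↦ (f ⊗ M)(g (1 ⊗ m))`. -/
def endMapFun (M : Type) [AddCommGroup M] [Module ℂ M] {A B : CommAlgCat.{0} ℂ} (f : A ⟶ B)
    (g : Module.End A (A ⊗[ℂ] M)) : Module.End B (B ⊗[ℂ] M) :=
  LinearMap.liftBaseChange B
    (baseMap M f ∘ₗ g.restrictScalars ℂ ∘ₗ TensorProduct.mk ℂ A M 1)

theorem endMapFun_tmul (M : Type) [AddCommGroup M] [Module ℂ M] {A B : CommAlgCat.{0} ℂ}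
    (f : A ⟶ B) (g : Module.End A (A ⊗[ℂ] M)) (b : B) (m : M) :
    endMapFun M f g (b ⊗ₜ m) = b • baseMap M f (g (1 ⊗ₜ m)) := rfl

theorem endMapFun_baseMap (M : Type) [AddCommGroup M] [Module ℂ M] {A B : CommAlgCat.{0} ℂ}
    (f : A ⟶ B) (g : Module.End A (A ⊗[ℂ] M)) (x : A ⊗[ℂ] M) :
    endMapFun M f g (baseMap M f x) = baseMap M f (g x) := by
  induction x with
  | zero => simp only [map_zero]
  | add x y hx hy => simp only [map_add, hx, hy]
  | tmul a m =>
    have h1 : a ⊗ₜ[ℂ] m = a • ((1 : A) ⊗ₜ[ℂ] m) := by simp [TensorProduct.smul_tmul']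
    rw [baseMap_tmul, endMapFun_tmul, h1, map_smul, baseMap_smul]

theorem end_ext {M : Type} [AddCommGroup M] [Module ℂ M] {A : CommAlgCat.{0} ℂ}
    {g h : Module.End A (A ⊗[ℂ] M)} (H : ∀ m : M, g (1 ⊗ₜ m) = h (1 ⊗ₜ m)) : g = h := by
  apply TensorProduct.AlgebraTensorModule.curry_injective
  ext m
  exact H m

/-- `endMapFun` as a homomorphism of monoids. -/
def endMap (M : Type) [AddCommGroup M] [Module ℂ M] {A B : CommAlgCat.{0} ℂ} (f : A ⟶ B) :
    Module.End A (A ⊗[ℂ] M) →* Module.End B (B ⊗[ℂ] M) where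
  toFun := endMapFun M f
  map_one' := end_ext fun m => by
    rw [endMapFun_tmul, one_smul, Module.End.one_apply, Module.End.one_apply, baseMap_tmul,
      map_one]
  map_mul' g h := end_ext fun m => by
    rw [endMapFun_tmul, one_smul, Module.End.mul_apply, Module.End.mul_apply, endMapFun_tmul,
      one_smul, endMapFun_baseMap]

/-- The group functor `A ↦ GL_A(A ⊗ M)`. -/
def glFunctor (M : Type) [AddCommGroup M] [Module ℂ M] : GroupFunctor where
  obj A := GrpCat.of (Module.End A (A ⊗[ℂ] M))ˣ
  map f := GrpCat.ofHom (Units.map (endMap M f))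
  map_id A := by
    refine GrpCat.hom_ext (MonoidHom.ext fun g => Units.ext (end_ext fun m => ?_))
    change endMapFun M (𝟙 A) g.1 (1 ⊗ₜ m) = g.1 (1 ⊗ₜ m)
    rw [endMapFun_tmul, one_smul]
    exact LinearMap.congr_fun (LinearMap.rTensor_id M A) _
  map_comp {A B C} f h := by
    refine GrpCat.hom_ext (MonoidHom.ext fun g => Units.ext (end_ext fun m => ?_))
    change endMapFun M (f ≫ h) g.1 (1 ⊗ₜ m) = endMapFun M h (endMapFun M f g.1) (1 ⊗ₜ m)
    rw [endMapFun_tmul, endMapFun_tmul, endMapFun_tmul, one_smul, one_smul, one_smul]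
    exact LinearMap.rTensor_comp_apply M h.hom.toLinearMap f.hom.toLinearMap _

/-- The split torus `𝔾_m^n`. -/
def torus (n : ℕ) : GroupFunctor where
  obj A := GrpCat.of (Fin n → Aˣ)
  map f := GrpCat.ofHom
    (MonoidHom.compLeft (Units.map (f.hom : _ →* _)) (Fin n))
  map_id A := by
    ext g
    rfl
  map_comp f h := by
    ext g
    rfl

/-- The constant group scheme attached to an abstract group `Γ`: its `A`-points are the locally
constant functions `Spec A → Γ`. -/
def constantGroup (Γ : Type) [Group Γ] : GroupFunctor where
  obj A := GrpCat.of (LocallyConstant (PrimeSpectrum A) Γ)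
  map f := GrpCat.ofHom (LocallyConstant.comapMonoidHom
    ⟨PrimeSpectrum.comap f.hom.toRingHom, PrimeSpectrum.continuous_comap _⟩)
  map_id A := by
    ext g
    rfl
  map_comp f h := by
    ext g
    rfl

/-- The general linear group scheme `GL_n`. -/
def glMatrix (n : ℕ) : GroupFunctor where
  obj A := GrpCat.of (GL (Fin n) A)
  map f := GrpCat.ofHom (Matrix.GeneralLinearGroup.map f.hom.toRingHom)
  map_id A := by
    ext g
    rfl
  map_comp f h := by
    ext g
    rfl

/-- `G` is the (internal) semidirect product `N ⋊ H` of its normal subgroup functor `N` and the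
group functor `H`, embedded in `G` through `s`. -/
def IsSemidirectProduct {G H : GroupFunctor} (N : Subfunctor G) (s : H ⟶ G) : Prop :=
  ∀ A : CommAlgCat.{0} ℂ, (N.pts A).Normal ∧ Function.Injective (s.app A) ∧
    Subgroup.IsComplement' (N.pts A) (s.app A).hom.range

/-- `U` is a connected unipotent algebraic group: it is isomorphic to a connected closed subgroup
scheme, cut out by an ideal `I`, of the group of upper unitriangular matrices of some size `n`. -/
def IsConnectedUnipotent (U : GroupFunctor) : Prop :=
  ∃ (n : ℕ) (I : Ideal (MvPolynomial (Fin n × Fin n) ℂ)),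
    (∀ i j, j < i → MvPolynomial.X (i, j) ∈ I) ∧
    (∀ i, MvPolynomial.X (i, i) - 1 ∈ I) ∧
    ConnectedSpace (PrimeSpectrum (MvPolynomial (Fin n × Fin n) ℂ ⧸ I)) ∧
    ∃ i : U ⟶ glMatrix n, ∀ A : CommAlgCat.{0} ℂ, Function.Injective (i.app A) ∧
      ∀ g : GL (Fin n) A, (∃ u : U.obj A, i.app A u = g) ↔
        ∀ p ∈ I, MvPolynomial.aeval (fun ij : Fin n × Fin n => g.1 ij.1 ij.2) p = 0

/-! ### Automorphism group schemes -/

section Automorphisms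

variable {V : Type} [AddCommGroup V] [Module ℂ V] (W : Subgroup (V ≃ₗ[ℂ] V))
variable (R : Type) [CommRing R] [Algebra ℂ R] [MulSemiringAction W R] [SMulCommClass W ℂ R]

variable {W R} in
theorem baseMap_mul {A B : CommAlgCat.{0} ℂ} (f : A ⟶ B) (x y : A ⊗[ℂ] R) :
    baseMap R f (x * y) = baseMap R f x * baseMap R f y :=
  map_mul (Algebra.TensorProduct.map f.hom (AlgHom.id ℂ R)) x y

/-- The linear automorphisms of `A ⊗ M` that commute with the base change of `c`. -/
def commuting {M : Type} [AddCommGroup M] [Module ℂ M] (c : M →ₗ[ℂ] M) :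
    Subfunctor (glFunctor M) where
  pts A :=
    { carrier := {g : (Module.End A (A ⊗[ℂ] M))ˣ |
        ∀ x, g.1 (c.baseChange A x) = c.baseChange A (g.1 x)}
      mul_mem' := fun {a b} ha hb x => by
        change a.1 (b.1 _) = _
        rw [hb, ha]
        rfl
      one_mem' := fun x => rfl
      inv_mem' := fun {a} ha x => by
        have h1 : ∀ y, a.1 (a⁻¹.1 y) = y := fun y => LinearMap.congr_fun a.mul_inv y
        have h2 : ∀ y, a⁻¹.1 (a.1 y) = y := fun y => LinearMap.congr_fun a.inv_mul y
        rw [← h2 (c.baseChange A (a⁻¹.1 x)), ha, h1] }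
  map_mem {A B} f g hg := by
    have h0 : ∀ x : A ⊗[ℂ] M,
        baseMap M f (c.baseChange A x) = c.baseChange B (baseMap M f x) := by
      intro x
      induction x with
      | zero => simp only [map_zero]
      | add x y hx hy => simp only [map_add, hx, hy]
      | tmul a m => rfl
    intro x
    change endMapFun M f g.1 _ = c.baseChange B (endMapFun M f g.1 x)
    induction x with
    | zero => simp only [map_zero]
    | add x y hx hy => simp only [map_add, hx, hy]
    | tmul b m =>
      rw [LinearMap.baseChange_tmul, endMapFun_tmul, endMapFun_tmul, map_smul, ← h0, ← hg,
        LinearMap.baseChange_tmul]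

/-- `Q̄`, the automorphism group scheme of the cameral cover `Spec R`. An automorphism `φ` of
`Spec A × Spec R` over `Spec A` commuting with `W` is encoded by its action `r ↦ r ∘ φ⁻¹` on the
functions `A ⊗ R`, an `A`-algebra automorphism. -/
def autCover : Subfunctor (glFunctor R) where
  pts A :=
    { carrier := {g : (Module.End A (A ⊗[ℂ] R))ˣ | g.1 1 = 1 ∧
        (∀ x y, g.1 (x * y) = g.1 x * g.1 y) ∧
        ∀ (w : W) x, g.1 ((actAlgHom W R w).toLinearMap.baseChange A x) =
          (actAlgHom W R w).toLinearMap.baseChange A (g.1 x)}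
      mul_mem' := fun {a b} ha hb => by
        refine ⟨?_, fun x y => ?_, fun w => ((commuting _).pts A).mul_mem (ha.2.2 w) (hb.2.2 w)⟩
        · change a.1 (b.1 _) = _
          rw [hb.1, ha.1]
        · change a.1 (b.1 _) = a.1 (b.1 _) * a.1 (b.1 _)
          rw [hb.2.1, ha.2.1]
      one_mem' := ⟨rfl, fun _ _ => rfl, fun _ _ => rfl⟩
      inv_mem' := fun {a} ha => by
        have h1 : ∀ y, a.1 (a⁻¹.1 y) = y := fun y => LinearMap.congr_fun a.mul_inv y
        have h2 : ∀ y, a⁻¹.1 (a.1 y) = y := fun y => LinearMap.congr_fun a.inv_mul y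
        refine ⟨?_, fun x y => ?_, fun w => ((commuting _).pts A).inv_mem (ha.2.2 w)⟩
        · conv_lhs => rw [← ha.1]
          exact h2 1
        · rw [← h2 (a⁻¹.1 x * a⁻¹.1 y), ha.2.1, h1, h1] }
  map_mem {A B} f g hg := by
    refine ⟨?_, fun x y => ?_, fun w => (commuting _).map_mem f g (hg.2.2 w)⟩
    · change endMapFun R f g.1 ((1 : B) ⊗ₜ[ℂ] (1 : R)) = 1
      rw [endMapFun_tmul, one_smul]
      change baseMap R f (g.1 1) = 1
      rw [hg.1]
      exact map_one (Algebra.TensorProduct.map f.hom (AlgHom.id ℂ R))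
    · change endMapFun R f g.1 (x * y) = endMapFun R f g.1 x * endMapFun R f g.1 y
      induction x with
      | zero => simp only [map_zero, zero_mul]
      | add x x' hx hx' => simp only [map_add, add_mul, hx, hx']
      | tmul b r =>
        induction y with
        | zero => simp only [map_zero, mul_zero]
        | add y y' hy hy' => simp only [map_add, mul_add, hy, hy']
        | tmul b' r' =>
          have h : (1 : A) ⊗ₜ[ℂ] (r * r') = (1 ⊗ₜ r) * (1 ⊗ₜ r') := by
            rw [Algebra.TensorProduct.tmul_mul_tmul, one_mul]
          rw [Algebra.TensorProduct.tmul_mul_tmul, endMapFun_tmul, endMapFun_tmul,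
            endMapFun_tmul, h, hg.2.1, baseMap_mul, smul_mul_smul_comm]

variable {R} (σ : R →ₐ[ℂ] ℂ)

/-- The base change `A ⊗ R → A` of the point `σ`. -/
def pointMap (A : CommAlgCat.{0} ℂ) : A ⊗[ℂ] R →ₗ[A] A :=
  LinearMap.liftBaseChange A (Algebra.linearMap ℂ A ∘ₗ σ.toLinearMap)

/-- `Q`, the automorphism group scheme of the pointed cameral cover `(Spec R, σ)`, as a subgroup
functor of `Q̄`. -/
def autPointed : Subfunctor (autCover W R).toFunctor where
  pts A :=
    { carrier := {g : (autCover W R).pts A | ∀ x, pointMap σ A (g.1.1 x) = pointMap σ A x}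
      mul_mem' := fun {a b} ha hb x => by
        change pointMap σ A (a.1.1 (b.1.1 x)) = _
        rw [ha, hb]
      one_mem' := fun x => rfl
      inv_mem' := fun {a} ha x => by
        have h1 : ∀ y, a.1.1 (a⁻¹.1.1 y) = y := fun y => LinearMap.congr_fun a.1.mul_inv y
        rw [← ha, h1] }
  map_mem {A B} f g hg x := by
    have h0 : ∀ x : A ⊗[ℂ] R, pointMap σ B (baseMap R f x) = f.hom (pointMap σ A x) := by
      intro x
      induction x with
      | zero => simp only [map_zero]
      | add x y hx hy => simp only [map_add, hx, hy]
      | tmul a m => simp [pointMap]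
    change pointMap σ B (endMapFun R f g.1.1 x) = pointMap σ B x
    induction x with
    | zero => simp only [map_zero]
    | add x y hx hy => simp only [map_add, hx, hy]
    | tmul b m =>
      have h1 : b ⊗ₜ[ℂ] m = b • baseMap R f ((1 : A) ⊗ₜ[ℂ] m) := by
        simp [TensorProduct.smul_tmul']
      rw [endMapFun_tmul, map_smul, h0, hg, h1, map_smul, h0]

/-- `Aut T_σ`, the group scheme of automorphisms of the tangent space at `σ` as a representation
of the stabilizer of `σ` in `W`. -/
def autTangent : Subfunctor (glFunctor (tangentSpace σ)) where
  pts A :=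
    { carrier := {g : (Module.End A (A ⊗[ℂ] tangentSpace σ))ˣ |
        ∀ (w : pointStab (W := W) σ) x, g.1 ((tangentAct σ w).baseChange A x) =
          (tangentAct σ w).baseChange A (g.1 x)}
      mul_mem' := fun ha hb w => ((commuting _).pts A).mul_mem (ha w) (hb w)
      one_mem' := fun _ _ => rfl
      inv_mem' := fun ha w => ((commuting _).pts A).inv_mem (ha w) }
  map_mem f g hg w := (commuting _).map_mem f g (hg w)

/-- The pairing `(A ⊗ T_σ) × (A ⊗ R) → A` of tangent vectors and functions, the `A`-bilinear
extension of `(D, r) ↦ D r`. -/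
def tangentPairing (A : CommAlgCat.{0} ℂ) :
    A ⊗[ℂ] tangentSpace σ →ₗ[A] A ⊗[ℂ] R →ₗ[A] A :=
  LinearMap.liftBaseChange A
    ((LinearMap.liftBaseChangeEquiv (R := ℂ) (M := R) (N := A) A).toLinearMap.restrictScalars ℂ ∘ₗ
      (Algebra.linearMap ℂ A).compRight ℂ ∘ₗ (tangentSpace σ).subtype)

/-- `d : Q → Aut T_σ` is the action of pointed automorphisms on the tangent space, i.e. it sends
`φ` to its differential: `⟨dφ(τ), r ∘ φ⁻¹⟩ = ⟨τ, r⟩`. -/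
def IsTangentAction (d : (autPointed W σ).toFunctor ⟶ (autTangent W σ).toFunctor) : Prop :=
  ∀ (A : CommAlgCat.{0} ℂ) (g : (autPointed W σ).pts A) (h : (autTangent W σ).pts A),
    d.app A g = h → ∀ (τ : A ⊗[ℂ] tangentSpace σ) (x : A ⊗[ℂ] R),
      tangentPairing σ A (h.1.1 τ) (g.1.1.1 x) = tangentPairing σ A τ x

/-- The homomorphism `ρ` from `stab(X) / W_X` to `Q̄` induces the natural action of `stab(X)` on
`Q`. The component of `σ` in `Spec R` is identified, by `θ`, with
`Co(W_X, V)`, on which `stab(X)` acts through its linear action on `V`; for `n ∈ stab(X)` the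
automorphism `c ↦ n · ρ(n)(c)` of the scheme `Spec R` preserves this component and acts
on it as `n` does. -/
def InducesNaturalAction (X : Submodule ℂ V)
    (ρ : constantGroup (StabQuotient W X) ⟶ (autCover W R).toFunctor) : Prop :=
  ∃ θ : R →ₐ[ℂ] Coord V ⧸ coinvariantIdeal (pointwiseStab W X),
    Function.Surjective θ ∧ (∀ r, θ r = 0 ↔ ∃ s, σ s ≠ 0 ∧ s * r = 0) ∧
    ∀ (n : setStab W X) (A : CommAlgCat.{0} ℂ) (g : (autCover W R).pts A),
      ρ.app A (LocallyConstant.const (PrimeSpectrum A) (n : StabQuotient W X)) = g →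
      ∀ (r : R) (p : Coord V), θ r = Ideal.Quotient.mk _ p →
        θ.toLinearMap.baseChange A
          ((actAlgHom W R (n : W)).toLinearMap.baseChange A (g.1.1 (1 ⊗ₜ r))) =
          1 ⊗ₜ Ideal.Quotient.mk _ (coordAct ((n : W) : V ≃ₗ[ℂ] V) p)

end Automorphisms

end Cameral

end

/-! An étale cover of `Spec ℂ` has a complex point, so `Spec R` is a fibre of `V → V / W`
(`IsCameralCover.exists_isFibre`), and `σ` is a vector `v` whose stabilizer is `W_X`. The fibre is a
finite scheme on whose points `W` acts transitively. Translation by `-v` identifies the component of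
`σ` with `C = Co(W_X, V)`, and `R` is recovered from `C` by induction from `W_X` to `W`. This is
packaged in `ComponentModel`. A `W`-equivariant endomorphism of `A ⊗ R` is thus the same as a
`W_X`-equivariant map `A ⊗ R → A ⊗ C` (`resA_ind`, `eq_of_resA_comp`), and pointed automorphisms are
the `W_X`-equivariant automorphisms of `A ⊗ C` preserving the origin (`pointedEquiv`). One fact
about `C` is used throughout: its `W_X`-invariants are the scalars, and its `W_X`-invariant
functionals are the multiples of evaluation at the origin, also over any `A`.

Torus. A tangent automorphism commuting with a reflection of `W_X` preserves its root line, and the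
scalars on two roots agree when one reflection moves the root of the other. Conversely, independent
scalars on the classes of the relation so generated define an automorphism. These classes are the
irreducible components of the arrangement (`irrComponents_eq_range`). It is essential that `W_X` be
generated by reflections. This is Steinberg's theorem (`mem_reflectionStab`), proved here as
follows. Divided differences show that near the origin the algebra generated over `S = Sym(V^∨)` by
the functions `w ↦ w • s` on `W` is free over `S` on the orbit functions of finitely many
polynomials. The multiples `q` of the indicator function of `K`, the group generated by the
reflections fixing `v`, that lie in this free module are controlled by height-one primes, and along
such a prime through the point only reflections can act trivially. Hence some `q` is nonzero at the
point, and this separates `K` from the other elements of the stabilizer.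

Unipotent kernel and splitting. `C` is graded. An automorphism with trivial differential is one that
changes each homogeneous element only by terms of higher degree (`tanMap_eq_one_iff_entries`), so in
a basis of monomials ordered by decreasing degree these automorphisms form a closed group of
unitriangular matrices. Conjugation by the grading contracts this group to the identity, so it is
connected. Conversely, an automorphism of the tangent representation acts on the linear forms of `C`
and extends to polynomials. An invariant polynomial vanishing at the origin goes to an invariant of
`A ⊗ C` vanishing at the origin, that is, to zero, so the extension descends to `C` and splits the
differential (`torAlg`).

The quotient `stab(X) / W_X`. For an automorphism `g` over `A`, evaluation at `σ` after `g` of the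
idempotents of the components gives idempotents of `A`, hence a locally constant function on `Spec
A` with values in cosets of `W_X`. Equivariance forces these cosets into the normalizer of `W_X`,
which is `stab(X)` because `X` is the fixed space of `W_X`. The invariant functionals on `C` being
known, this function determines `σ ∘ g` completely (`pointA_autAlgHom`). In the other direction, `n
∈ stab(X)` gives the `W_X`-equivariant map `n ∘ res ∘ n⁻¹` from `R` to `C`, hence an automorphism of
the cover that depends only on the class of `n`. Gluing these along idempotents defines `ρ`. -/

open CategoryTheory TensorProduct
open scoped Pointwise

noncomputable section

namespace Cameral

set_option linter.unusedSectionVars false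

/-! ### The coordinate ring of a vector space -/

section Coordinates

variable {V : Type} [AddCommGroup V] [Module ℂ V]

/-- The coordinate function attached to a linear form. -/
abbrev lin (ℓ : Module.Dual ℂ V) : Coord V := SymmetricAlgebra.ι ℂ (Module.Dual ℂ V) ℓ

/-- Evaluation of polynomial functions at a point. -/
def evalAt (v : V) : Coord V →ₐ[ℂ] ℂ := SymmetricAlgebra.lift (Module.Dual.eval ℂ V v)

@[simp] theorem evalAt_lin (v : V) (ℓ : Module.Dual ℂ V) : evalAt v (lin ℓ) = ℓ v := by
  simp [evalAt]

theorem coord_algHom_ext {B : Type} [CommRing B] [Algebra ℂ B] {F G : Coord V →ₐ[ℂ] B}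
    (h : ∀ ℓ : Module.Dual ℂ V, F (lin ℓ) = G (lin ℓ)) : F = G :=
  SymmetricAlgebra.algHom_ext (LinearMap.ext h)

theorem algebraMapInv_eq_evalAt :
    (SymmetricAlgebra.algebraMapInv : Coord V →ₐ[ℂ] ℂ) = evalAt 0 :=
  coord_algHom_ext fun ℓ => by simp [SymmetricAlgebra.algebraMapInv_ι, lin]

@[simp] theorem coordAct_lin (w : V ≃ₗ[ℂ] V) (ℓ : Module.Dual ℂ V) :
    coordAct w (lin ℓ) = lin (ℓ ∘ₗ (w.symm : V →ₗ[ℂ] V)) := by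
  simp only [coordAct, SymmetricAlgebra.lift_ι_apply]
  rfl

/-- Linear automorphisms act on polynomial functions. -/
instance : MulSemiringAction (V ≃ₗ[ℂ] V) (Coord V) where
  smul w p := coordAct w p
  one_smul p := by
    change coordAct 1 p = AlgHom.id ℂ (Coord V) p
    congr 1
    exact coord_algHom_ext fun ℓ => by simp; rfl
  mul_smul a b p := by
    change coordAct (a * b) p = (coordAct a).comp (coordAct b) p
    congr 1
    exact coord_algHom_ext fun ℓ => by simp; rfl
  smul_zero w := map_zero (coordAct w)
  smul_add w := map_add (coordAct w)
  smul_one w := map_one (coordAct w)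
  smul_mul w := map_mul (coordAct w)

instance : SMulCommClass (V ≃ₗ[ℂ] V) ℂ (Coord V) where
  smul_comm w c p := map_smul (coordAct w) c p

theorem smul_lin (w : V ≃ₗ[ℂ] V) (ℓ : Module.Dual ℂ V) :
    w • lin ℓ = lin (ℓ ∘ₗ (w.symm : V →ₗ[ℂ] V)) := coordAct_lin w ℓ

@[simp] theorem smul_algebraMap_coord (w : V ≃ₗ[ℂ] V) (c : ℂ) :
    w • (algebraMap ℂ (Coord V) c) = algebraMap ℂ (Coord V) c := (coordAct w).commutes c

theorem evalAt_smul (w : V ≃ₗ[ℂ] V) (v : V) (p : Coord V) :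
    evalAt v (w • p) = evalAt (w⁻¹ • v) p := by
  change ((evalAt v).comp (coordAct w)) p = evalAt (w⁻¹ • v) p
  congr 1
  exact coord_algHom_ext fun ℓ => by rw [AlgHom.comp_apply, coordAct_lin, evalAt_lin, evalAt_lin]; rfl

theorem mem_invariants {W : Subgroup (V ≃ₗ[ℂ] V)} {p : Coord V} :
    p ∈ invariants W ↔ ∀ w ∈ W, w • p = p := by
  simp only [invariants, Algebra.mem_iInf]
  rfl

instance (W : Subgroup (V ≃ₗ[ℂ] V)) : SMulCommClass W (invariants W) (Coord V) where
  smul_comm w c p := by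
    change (w : V ≃ₗ[ℂ] V) • ((c : Coord V) * p) = (c : Coord V) * ((w : V ≃ₗ[ℂ] V) • p)
    rw [smul_mul', mem_invariants.1 c.2 _ w.2]

instance (W : Subgroup (V ≃ₗ[ℂ] V)) : Algebra.IsInvariant (invariants W) (Coord V) W where
  isInvariant b hb := ⟨⟨b, mem_invariants.2 fun w hw => hb ⟨w, hw⟩⟩, rfl⟩

theorem sum_smul_mem_invariants (W : Subgroup (V ≃ₗ[ℂ] V)) [Fintype W] (p : Coord V) :
    ∑ w : W, (w : V ≃ₗ[ℂ] V) • p ∈ invariants W := by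
  rw [mem_invariants]
  intro w hw
  rw [Finset.smul_sum]
  simp only [smul_smul]
  exact Fintype.sum_equiv (Equiv.mulLeft (⟨w, hw⟩ : W)) _ _ fun g => rfl

/-- Translation `p ↦ p(· + v)` of polynomial functions. -/
def translate (v : V) : Coord V →ₐ[ℂ] Coord V :=
  SymmetricAlgebra.lift (SymmetricAlgebra.ι ℂ (Module.Dual ℂ V) +
    Algebra.linearMap ℂ (Coord V) ∘ₗ Module.Dual.eval ℂ V v)

@[simp] theorem translate_lin (v : V) (ℓ : Module.Dual ℂ V) :
    translate v (lin ℓ) = lin ℓ + algebraMap ℂ (Coord V) (ℓ v) := by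
  simp [translate]

theorem evalAt_zero_translate (v : V) (p : Coord V) : evalAt 0 (translate v p) = evalAt v p := by
  change ((evalAt 0).comp (translate v)) p = evalAt v p
  congr 1
  exact coord_algHom_ext fun ℓ => by simp

theorem translate_translate_neg (v : V) (p : Coord V) : translate v (translate (-v) p) = p := by
  change ((translate v).comp (translate (-v))) p = AlgHom.id ℂ (Coord V) p
  congr 1
  exact coord_algHom_ext fun ℓ => by simp

/-- This is what makes the passage from the fibre through `v` to the fibre through the origin
compatible with the stabilizer of `v`. -/
theorem translate_smul (w : V ≃ₗ[ℂ] V) (v : V) (hw : w • v = v) (p : Coord V) :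
    translate v (w • p) = w • translate v p := by
  change ((translate v).comp (coordAct w)) p = ((coordAct w).comp (translate v)) p
  congr 1
  have h : w.symm v = v := by
    conv_lhs => rw [← hw]
    exact w.symm_apply_apply v
  exact coord_algHom_ext fun ℓ => by simp [h]

theorem prime_lin {ℓ : Module.Dual ℂ V} (h : ℓ ≠ 0) : Prime (lin ℓ) := by
  have hli : LinearIndepOn ℂ id ({ℓ} : Set (Module.Dual ℂ V)) :=
    by simpa using h
  let b := Module.Basis.extend hli
  let e := SymmetricAlgebra.equivMvPolynomial b
  let i : hli.extend (Set.subset_univ _) := ⟨ℓ, hli.subset_extend _ rfl⟩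
  have hi : b i = ℓ := Module.Basis.extend_apply_self hli i
  have : e (lin ℓ) = MvPolynomial.X i := by
    have := SymmetricAlgebra.equivMvPolynomial_ι_apply b i
    rwa [hi] at this
  refine (MulEquiv.prime_iff e.toMulEquiv).1 ?_
  change Prime (e (lin ℓ))
  rw [this]
  exact MvPolynomial.X_prime

/-- Two linear forms with a common non-unit divisor are proportional. -/
theorem ker_le_ker_of_dvd {ℓ m : Module.Dual ℂ V} {q : Coord V} (hq : ¬ IsUnit q)
    (hℓ : ℓ ≠ 0) (h1 : q ∣ lin ℓ) (h2 : q ∣ lin m) : LinearMap.ker ℓ ≤ LinearMap.ker m := by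
  intro u hu
  have h3 : lin ℓ ∣ q := ((prime_lin hℓ).irreducible.dvd_iff.1 h1).resolve_left hq |>.dvd
  obtain ⟨c, hc⟩ := h3.trans h2
  have := congrArg (evalAt u) hc
  rw [map_mul, evalAt_lin, evalAt_lin, LinearMap.mem_ker.1 hu, zero_mul] at this
  exact this

variable [Module.Finite ℂ V]

/-- Coordinates on the coordinate ring. -/
def coordEquiv : Coord V ≃ₐ[ℂ] MvPolynomial (Module.Free.ChooseBasisIndex ℂ (Module.Dual ℂ V)) ℂ :=
  SymmetricAlgebra.equivMvPolynomial (Module.Free.chooseBasis ℂ (Module.Dual ℂ V))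

instance : UniqueFactorizationMonoid (Coord V) :=
  MulEquiv.uniqueFactorizationMonoid (coordEquiv (V := V)).symm.toMulEquiv inferInstance

instance : Algebra.FiniteType ℂ (Coord V) :=
  Algebra.FiniteType.equiv inferInstance (coordEquiv (V := V)).symm

theorem algHom_eq_evalAt (f : Coord V →ₐ[ℂ] ℂ) : ∃ v : V, f = evalAt v := by
  refine ⟨(Module.evalEquiv ℂ V).symm (f.toLinearMap ∘ₗ SymmetricAlgebra.ι ℂ _), ?_⟩
  refine coord_algHom_ext fun ℓ => ?_
  rw [evalAt_lin, Module.apply_evalEquiv_symm_apply]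
  rfl

end Coordinates

/-! ### Reflections and divided differences -/

section Reflections

variable {V : Type} [AddCommGroup V] [Module ℂ V]

theorem mem_fixedLocus {w : V ≃ₗ[ℂ] V} {u : V} : u ∈ fixedLocus w ↔ w u = u := Iff.rfl

/-- The point is `L α ≠ 0`. Otherwise `w ^ n` is `u ↦ u + n L(u) α`; in characteristic zero finite
order then forces `α = 0`, so that `w` fixes everything. -/
theorem IsReflection.exists_form {w : V ≃ₗ[ℂ] V} (h : IsReflection w) :
    ∃ (L : Module.Dual ℂ V) (α : V), (∀ u, w u = u + L u • α) ∧ L α ≠ 0 ∧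
      LinearMap.ker L = fixedLocus w := by
  obtain ⟨hfin, hco⟩ := h
  obtain ⟨L, hL0, hL⟩ := Submodule.exists_le_ker_of_lt_top _ hco.lt_top
  have hker : LinearMap.ker L = fixedLocus w := by
    refine ((hco.le_iff.1 hL).resolve_left fun h => hL0 ?_)
    exact LinearMap.ker_eq_top.1 h
  obtain ⟨a, ha⟩ : ∃ a, L a ≠ 0 := by
    by_contra! h
    exact hL0 (LinearMap.ext h)
  have hform : ∀ u, w u = u + L u • ((L a)⁻¹ • (w a - a)) := by
    intro u
    have h1 : u - (L u * (L a)⁻¹) • a ∈ fixedLocus w := by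
      rw [← hker, LinearMap.mem_ker]
      simp [ha]
    rw [mem_fixedLocus, map_sub, map_smul] at h1
    rw [smul_smul, smul_sub]
    rw [sub_eq_iff_eq_add] at h1
    rw [h1]
    module
  refine ⟨L, (L a)⁻¹ • (w a - a), hform, fun h0 => ?_, hker⟩
  set α := (L a)⁻¹ • (w a - a)
  have hpow : ∀ n : ℕ, ∀ u, (w ^ n) u = u + (n * L u) • α := by
    intro n
    induction n with
    | zero => intro u; simp
    | succ n ih =>
      intro u
      rw [pow_succ, LinearEquiv.mul_apply, ih, hform u]
      simp only [map_add, map_smul, h0, smul_eq_mul, mul_zero, add_zero]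
      push_cast
      module
  obtain ⟨n, hn, hn1⟩ := isOfFinOrder_iff_pow_eq_one.1 hfin
  have h2 := hpow n a
  rw [hn1] at h2
  have h3 : ((n : ℂ) * L a) • α = 0 := by simpa using h2
  have hα : α = 0 := (smul_eq_zero.1 h3).resolve_left
    (mul_ne_zero (by exact_mod_cast hn.ne') ha)
  refine hco.1 (eq_top_iff.2 fun u _ => ?_)
  rw [mem_fixedLocus, hform, hα, smul_zero, add_zero]

theorem smul_lin_of_form {w : V ≃ₗ[ℂ] V} {L : Module.Dual ℂ V} {α : V}
    (h : ∀ u, w u = u + L u • α) (ℓ : Module.Dual ℂ V) :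
    lin ℓ - w • lin ℓ = ℓ (w.symm α) • lin L := by
  rw [smul_lin, ← map_sub, ← map_smul]
  congr 1
  ext u
  have h1 : w.symm u = u - L u • w.symm α := by
    have := congrArg w.symm (h u)
    rw [w.symm_apply_apply, map_add, map_smul] at this
    rw [eq_sub_iff_add_eq, ← this]
  simp [h1, mul_comm]

/-- Divisibility by `L` holds for linear forms by the shape of `w`, and passes to products by the
twisted Leibniz rule `Δ(ab) = Δ(a) b + (w • a) Δ(b)`. Cancelling `lin L` makes the quotient linear
in `p`. -/
theorem exists_dividedDifference {w : V ≃ₗ[ℂ] V} {L : Module.Dual ℂ V} {α : V} (hL : L ≠ 0)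
    (h : ∀ u, w u = u + L u • α) :
    ∃ Δ : Coord V →ₗ[ℂ] Coord V, ∀ p, p - w • p = lin L * Δ p := by
  have hL' : lin L ≠ 0 := (prime_lin hL).ne_zero
  have hex : ∀ p : Coord V, ∃ q, p - w • p = lin L * q := by
    intro p
    induction p using SymmetricAlgebra.induction with
    | algebraMap c => exact ⟨0, by simp⟩
    | ι ℓ =>
      refine ⟨algebraMap ℂ _ (ℓ (w.symm α)), ?_⟩
      rw [smul_lin_of_form h, Algebra.smul_def, mul_comm]
    | mul a b ha hb =>
      obtain ⟨x, hx⟩ := ha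
      obtain ⟨y, hy⟩ := hb
      refine ⟨x * b + (w • a) * y, ?_⟩
      rw [smul_mul']
      linear_combination b * hx + (w • a) * hy
    | add a b ha hb =>
      obtain ⟨x, hx⟩ := ha
      obtain ⟨y, hy⟩ := hb
      refine ⟨x + y, ?_⟩
      rw [smul_add]
      linear_combination hx + hy
  choose Δ hΔ using hex
  refine ⟨⟨⟨Δ, fun p q => mul_left_cancel₀ hL' ?_⟩, fun c p => mul_left_cancel₀ hL' ?_⟩, hΔ⟩
  · rw [mul_add, ← hΔ, ← hΔ, ← hΔ, smul_add]; ring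
  · rw [RingHom.id_apply, mul_smul_comm, ← hΔ, ← hΔ, smul_comm w c p, smul_sub]

/-- Polynomial functions of degree at most `n`. -/
def degLE (V : Type) [AddCommGroup V] [Module ℂ V] (n : ℕ) : Submodule ℂ (Coord V) :=
  (1 ⊔ LinearMap.range (SymmetricAlgebra.ι ℂ (Module.Dual ℂ V))) ^ n

theorem exists_mem_degLE (p : Coord V) : ∃ n, p ∈ degLE V n := by
  have hmono : ∀ {a b : ℕ}, a ≤ b → degLE V a ≤ degLE V b := fun h =>
    pow_le_pow_right' le_sup_left h
  induction p using SymmetricAlgebra.induction with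
  | algebraMap c => exact ⟨0, by simp [degLE, Submodule.mem_one]⟩
  | ι ℓ => exact ⟨1, by
      rw [degLE, pow_one]; exact Submodule.mem_sup_right ⟨ℓ, rfl⟩⟩
  | mul a b ha hb =>
    obtain ⟨m, hm⟩ := ha
    obtain ⟨n, hn⟩ := hb
    refine ⟨m + n, ?_⟩
    rw [degLE, pow_add]
    exact Submodule.mul_mem_mul hm hn
  | add a b ha hb =>
    obtain ⟨m, hm⟩ := ha
    obtain ⟨n, hn⟩ := hb
    exact ⟨max m n, add_mem (hmono (le_max_left _ _) hm) (hmono (le_max_right _ _) hn)⟩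

/-- Divided differences lower the degree, by the twisted Leibniz rule. This feeds the induction in
`mem_hilbertIdeal_of_operators`. -/
theorem dividedDifference_degLE {w : V ≃ₗ[ℂ] V} {L : Module.Dual ℂ V} {α : V}
    (hL : L ≠ 0) (h : ∀ u, w u = u + L u • α) {Δ : Coord V →ₗ[ℂ] Coord V}
    (hΔ : ∀ p, p - w • p = lin L * Δ p) (n : ℕ) :
    (∀ p ∈ degLE V 0, Δ p = 0) ∧ ∀ p ∈ degLE V (n + 1), Δ p ∈ degLE V n := by
  have hL' : lin L ≠ 0 := (prime_lin hL).ne_zero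
  have hΔc : ∀ c : ℂ, Δ (algebraMap ℂ _ c) = 0 := fun c => mul_left_cancel₀ hL' (by
    rw [← hΔ, mul_zero, smul_algebraMap_coord, sub_self])
  have hΔℓ : ∀ ℓ, Δ (lin ℓ) = algebraMap ℂ _ (ℓ (w.symm α)) := fun ℓ => mul_left_cancel₀ hL' (by
    rw [← hΔ, smul_lin_of_form h, Algebra.smul_def, mul_comm])
  have hΔm : ∀ p q, Δ (p * q) = Δ p * q + (w • p) * Δ q := fun p q => mul_left_cancel₀ hL' (by
    rw [← hΔ, smul_mul']
    linear_combination q * hΔ p + (w • p) * hΔ q)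
  have h0 : ∀ p ∈ degLE V 0, Δ p = 0 := by
    intro p hp
    rw [degLE, pow_zero, Submodule.mem_one] at hp
    obtain ⟨c, rfl⟩ := hp
    exact hΔc c
  refine ⟨h0, ?_⟩
  have hgen : ∀ x ∈ (1 ⊔ LinearMap.range (SymmetricAlgebra.ι ℂ (Module.Dual ℂ V))),
      Δ x ∈ degLE V 0 ∧ w • x ∈ (1 ⊔ LinearMap.range (SymmetricAlgebra.ι ℂ (Module.Dual ℂ V))) := by
    intro x hx
    obtain ⟨y, hy, z, ⟨ℓ, rfl⟩, rfl⟩ := Submodule.mem_sup.1 hx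
    obtain ⟨c, rfl⟩ := Submodule.mem_one.1 hy
    constructor
    · rw [map_add, hΔc, hΔℓ, zero_add, degLE, pow_zero]
      exact Submodule.mem_one.2 ⟨_, rfl⟩
    · rw [smul_add, smul_algebraMap_coord, smul_lin]
      exact Submodule.add_mem_sup (Submodule.mem_one.2 ⟨_, rfl⟩) ⟨_, rfl⟩
  have h00 : ∀ {n} {c q : Coord V}, c ∈ degLE V 0 → q ∈ degLE V n → c * q ∈ degLE V n := by
    intro n c q hc hq
    rw [degLE, pow_zero, Submodule.mem_one] at hc
    obtain ⟨c, rfl⟩ := hc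
    rw [← Algebra.smul_def]
    exact Submodule.smul_mem _ _ hq
  induction n with
  | zero =>
    intro p hp
    rw [degLE, zero_add, pow_one] at hp
    exact (hgen p hp).1
  | succ n ih =>
    intro p hp
    rw [degLE, pow_succ'] at hp
    induction hp using Submodule.mul_induction_on' with
    | mem_mul_mem x hx y hy =>
      rw [hΔm]
      refine add_mem (h00 (hgen x hx).1 hy) ?_
      rw [degLE, pow_succ']
      exact Submodule.mul_mem_mul (hgen x hx).2 (ih y hy)
    | add x _ y _ hx hy => rw [map_add]; exact add_mem hx hy

end Reflections

/-! ### Point stabilizers in reflection groups -/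

section Steinberg

variable {V : Type} [AddCommGroup V] [Module ℂ V]

/-- The ideal generated by the invariants of `W` that vanish at the origin. -/
def hilbertIdeal (W : Subgroup (V ≃ₗ[ℂ] V)) : Ideal (Coord V) :=
  Ideal.span {p | p ∈ invariants W ∧ evalAt 0 p = 0}

theorem smul_mem_hilbertIdeal {W : Subgroup (V ≃ₗ[ℂ] V)} {w : V ≃ₗ[ℂ] V} (hw : w ∈ W)
    {p : Coord V} (hp : p ∈ hilbertIdeal W) : w • p ∈ hilbertIdeal W := by
  have h : hilbertIdeal W ≤ Ideal.comap (coordAct w) (hilbertIdeal W) := by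
    refine Ideal.span_le.2 fun q hq => ?_
    change w • q ∈ hilbertIdeal W
    rw [mem_invariants.1 hq.1 w hw]
    exact Ideal.subset_span hq
  exact h hp

/-- The operators on polynomial functions that preserve, termwise, all relations that are satisfied by
the families of `W`-conjugates. -/
def relationOperators (W : Subgroup (V ≃ₗ[ℂ] V)) : Subalgebra ℂ (Module.End ℂ (Coord V)) where
  carrier := {X | ∀ (n : ℕ) (a b : Fin n → Coord V),
    (∀ w ∈ W, ∑ j, a j * w • b j = 0) → ∀ w ∈ W, ∑ j, a j * w • X (b j) = 0}
  mul_mem' := fun {X Y} hX hY n a b h => hX n a (fun j => Y (b j)) (hY n a b h)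
  add_mem' := fun {X Y} hX hY n a b h w hw => by
    simp only [LinearMap.add_apply, smul_add, mul_add, Finset.sum_add_distrib, hX n a b h w hw,
      hY n a b h w hw, add_zero]
  algebraMap_mem' := fun c n a b h w hw => by
    have : ∀ j, a j * w • (algebraMap ℂ (Module.End ℂ (Coord V)) c) (b j) =
        c • (a j * w • b j) := fun j => by
      rw [Module.algebraMap_end_apply, smul_comm w c, mul_smul_comm]
    simp only [this, ← Finset.smul_sum, h w hw, smul_zero]

/-- Multiplied by `w • lin L`, the relation for the `Δ (b j)` at `w` is the difference of the given
relations at `w` and at `w * r`; the factor cancels in a domain. -/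
theorem dividedDifference_mem {W : Subgroup (V ≃ₗ[ℂ] V)} {r : V ≃ₗ[ℂ] V} (hr : r ∈ W)
    {L : Module.Dual ℂ V} (hL : L ≠ 0) {Δ : Coord V →ₗ[ℂ] Coord V}
    (hΔ : ∀ p, p - r • p = lin L * Δ p) : Δ ∈ relationOperators W := by
  intro n a b h w hw
  have hwL : w • lin L ≠ 0 := by
    rw [Ne, smul_eq_zero_iff_eq]; exact (prime_lin hL).ne_zero
  refine mul_left_cancel₀ hwL ?_
  have : ∀ j, w • lin L * (a j * w • Δ (b j)) = a j * w • b j - a j * (w * r) • b j := fun j => by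
    rw [mul_left_comm, ← smul_mul', ← hΔ, smul_sub, mul_sub, mul_smul]
  rw [Finset.mul_sum, mul_zero]
  simp only [this, Finset.sum_sub_distrib, h w hw, h (w * r) (mul_mem hw hr), sub_zero]

/-- Relation operators followed by evaluation at the origin detect everything outside the Hilbert
ideal. By induction on the degree `Δ p` lies in the ideal for every reflection, so `p` is invariant
modulo the ideal, hence congruent to an average that lies in it. -/
theorem mem_hilbertIdeal_of_operators {W : Subgroup (V ≃ₗ[ℂ] V)} (hW : IsReflectionGroup W)
    (n : ℕ) : ∀ p ∈ degLE V n, (∀ X ∈ relationOperators W, evalAt 0 (X p) = 0) →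
      p ∈ hilbertIdeal W := by
  -- Invariance modulo the ideal passes from the reflections to all of `W`. The orbit sum is an
  -- invariant vanishing at the origin, and `|W| p` is congruent to it.
  have key : ∀ p : Coord V, evalAt 0 p = 0 →
      (∀ r ∈ W, IsReflection r → p - r • p ∈ hilbertIdeal W) → p ∈ hilbertIdeal W := by
    intro p hp0 hp
    have hall : ∀ w ∈ W, p - w • p ∈ hilbertIdeal W := by
      intro w hw
      have hw' := hw
      rw [← hW.closure_eq] at hw
      induction hw using Subgroup.closure_induction with
      | mem x hx => exact hp x hx.1 hx.2
      | one => simp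
      | mul x y hx hy ihx ihy =>
        rw [hW.closure_eq] at hx hy
        have := add_mem (ihx hx) (smul_mem_hilbertIdeal hx (ihy hy))
        rwa [smul_sub, sub_add_sub_cancel, ← mul_smul] at this
      | inv x hx ihx =>
        rw [hW.closure_eq] at hx
        have := neg_mem (smul_mem_hilbertIdeal (inv_mem hx) (ihx hx))
        rwa [smul_sub, inv_smul_smul, neg_sub] at this
    have := hW.finite
    have : Fintype W := Fintype.ofFinite W
    have h1 : ∑ w : W, (w : V ≃ₗ[ℂ] V) • p ∈ hilbertIdeal W := by
      refine Ideal.subset_span ⟨sum_smul_mem_invariants W p, ?_⟩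
      rw [map_sum]
      refine Finset.sum_eq_zero fun w _ => ?_
      rw [evalAt_smul, smul_zero, hp0]
    have h2 : ∑ w : W, (p - (w : V ≃ₗ[ℂ] V) • p) ∈ hilbertIdeal W :=
      sum_mem fun w _ => hall w w.2
    have h3 := add_mem h2 h1
    rw [Finset.sum_sub_distrib, sub_add_cancel, Finset.sum_const, Finset.card_univ,
      ← Nat.cast_smul_eq_nsmul ℂ] at h3
    have h4 := ((hilbertIdeal W).restrictScalars ℂ).smul_mem ((Fintype.card W : ℂ)⁻¹) h3
    rwa [smul_smul, inv_mul_cancel₀ (by exact_mod_cast Fintype.card_ne_zero), one_smul] at h4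
  induction n with
  | zero =>
    intro p hp hX
    refine key p (hX 1 (one_mem _)) fun r hr hrr => ?_
    obtain ⟨L, α, hform, hLα, -⟩ := hrr.exists_form
    have hL : L ≠ 0 := fun h => hLα (by simp [h])
    obtain ⟨Δ, hΔ⟩ := exists_dividedDifference hL hform
    rw [hΔ, (dividedDifference_degLE hL hform hΔ 0).1 p hp, mul_zero]
    exact zero_mem _
  | succ n ih =>
    intro p hp hX
    refine key p (hX 1 (one_mem _)) fun r hr hrr => ?_
    obtain ⟨L, α, hform, hLα, -⟩ := hrr.exists_form
    have hL : L ≠ 0 := fun h => hLα (by simp [h])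
    obtain ⟨Δ, hΔ⟩ := exists_dividedDifference hL hform
    rw [hΔ]
    refine Ideal.mul_mem_left _ _
      (ih _ ((dividedDifference_degLE hL hform hΔ n).2 p hp) fun X hX' => ?_)
    -- `X * Δ` is again a relation operator, so `Δ p` inherits the hypothesis on `p`.
    exact hX (X * Δ) (mul_mem hX' (dividedDifference_mem hr hL hΔ))

/-- The maximal ideal of the origin in the ring of invariants. -/
def invariantsMax (W : Subgroup (V ≃ₗ[ℂ] V)) : Ideal (invariants W) :=
  RingHom.ker ((evalAt (0 : V)).comp (invariants W).val)

theorem hilbertIdeal_eq_smul_top (W : Subgroup (V ≃ₗ[ℂ] V)) :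
    (hilbertIdeal W).restrictScalars (invariants W) =
      invariantsMax W • (⊤ : Submodule (invariants W) (Coord V)) := by
  rw [Ideal.smul_top_eq_map]
  congr 1
  rw [hilbertIdeal, Ideal.map]
  congr 1
  ext p
  constructor
  · rintro ⟨h1, h2⟩
    exact ⟨⟨p, h1⟩, h2, rfl⟩
  · rintro ⟨q, h1, rfl⟩
    exact ⟨q.2, h1⟩

theorem eq_top_of_dualCoannihilator_eq_bot {E : Type} [AddCommGroup E] [Module ℂ E]
    [Module.Finite ℂ E] (P : Submodule ℂ (Module.Dual ℂ E)) (h : P.dualCoannihilator = ⊥) :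
    P = ⊤ := by
  rw [← Subspace.dualCoannihilator_dualAnnihilator_eq (W := P), h, Submodule.dualAnnihilator_bot]

variable [Module.Finite ℂ V]

instance finite_invariants (W : Subgroup (V ≃ₗ[ℂ] V)) [Finite W] :
    Module.Finite (invariants W) (Coord V) := by
  have : Algebra.IsIntegral (invariants W) (Coord V) := Algebra.IsInvariant.isIntegral _ _ W
  have : Algebra.FiniteType (invariants W) (Coord V) :=
    Algebra.FiniteType.of_restrictScalars_finiteType ℂ (invariants W) (Coord V)
  exact Algebra.IsIntegral.finite

/-- Near the origin, the coordinate ring is free over the invariants of a reflection group. -/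
theorem exists_local_basis {W : Subgroup (V ≃ₗ[ℂ] V)} (hW : IsReflectionGroup W) :
    ∃ (n : ℕ) (b : Fin n → Coord V) (f : Coord V), f ∈ invariants W ∧ evalAt 0 f = 1 ∧
      (∀ s, ∃ c : Fin n → Coord V, (∀ j, c j ∈ invariants W) ∧ f * s = ∑ j, c j * b j) ∧
      ∀ a : Fin n → Coord V, (∀ w ∈ W, ∑ j, a j * w • b j = 0) → a = 0 := by
  have := hW.finite
  let N : Submodule ℂ (Coord V) := (hilbertIdeal W).restrictScalars ℂ
  -- A basis of a complement of the Hilbert ideal will serve as the local basis.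
  obtain ⟨U, hU⟩ := N.exists_isCompl
  have hUfin : Module.Finite ℂ U := by
    obtain ⟨s, hs⟩ := (finite_invariants W).fg_top
    have : Module.Finite ℂ (Submodule.span ℂ (s : Set (Coord V))) :=
      Module.Finite.span_finset ℂ s
    have hsurj : Function.Surjective
        (N.mkQ ∘ₗ (Submodule.span ℂ (s : Set (Coord V))).subtype) := by
      intro y
      obtain ⟨p, rfl⟩ := N.mkQ_surjective y
      have hp : p ∈ Submodule.span (invariants W) (s : Set (Coord V)) := hs ▸ trivial
      induction hp using Submodule.span_induction with
      | mem x hx => exact ⟨⟨x, Submodule.subset_span hx⟩, rfl⟩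
      | zero => exact ⟨0, by simp⟩
      | add x y _ _ hx hy =>
        obtain ⟨x', hx'⟩ := hx
        obtain ⟨y', hy'⟩ := hy
        exact ⟨x' + y', by rw [map_add, hx', hy', map_add]⟩
      | smul c x _ hx =>
        obtain ⟨x', hx'⟩ := hx
        refine ⟨evalAt 0 (c : Coord V) • x', ?_⟩
        rw [map_smul, hx', ← map_smul, ← sub_eq_zero, ← map_sub]
        refine (Submodule.Quotient.mk_eq_zero _).2 ?_
        have : (evalAt 0 (c : Coord V)) • x - c • x =
            (algebraMap ℂ (Coord V) (evalAt 0 (c : Coord V)) - (c : Coord V)) * x := by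
          rw [sub_mul, ← Algebra.smul_def]; rfl
        rw [this]
        refine Ideal.mul_mem_right _ _ (Ideal.subset_span ⟨?_, ?_⟩)
        · exact sub_mem (Subalgebra.algebraMap_mem _ _) c.2
        · simp
    have : Module.Finite ℂ (Coord V ⧸ N) := Module.Finite.of_surjective _ hsurj
    exact Module.Finite.equiv (Submodule.quotientEquivOfIsCompl N U hU)
  let n := Module.finrank ℂ U
  let b : Module.Basis (Fin n) ℂ U := Module.finBasis ℂ U
  -- the functionals
  let Φ : Module.End ℂ (Coord V) →ₗ[ℂ] Module.Dual ℂ U :=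
    { toFun := fun X => (evalAt (0 : V)).toLinearMap ∘ₗ X ∘ₗ U.subtype
      map_add' := fun X Y => by ext; simp
      map_smul' := fun c X => by ext; simp }
  -- A vector of `U` killed by all these functionals lies in the Hilbert ideal, hence is zero. So
  -- the functionals fill the dual of `U`, and dual operators `Y i` with `(Y i (b j))(0) = δ_ij`
  -- exist.
  have hΦ : (Subalgebra.toSubmodule (relationOperators W)).map Φ = ⊤ := by
    refine eq_top_of_dualCoannihilator_eq_bot _ (eq_bot_iff.2 fun u hu => ?_)
    rw [Submodule.mem_dualCoannihilator] at hu
    obtain ⟨m, hm⟩ := exists_mem_degLE (u : Coord V)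
    have h1 : (u : Coord V) ∈ N := mem_hilbertIdeal_of_operators hW m _ hm fun X hX =>
      hu (Φ X) ⟨X, hX, rfl⟩
    have h2 : (u : Coord V) ∈ (⊥ : Submodule ℂ (Coord V)) :=
      hU.inf_eq_bot ▸ ⟨h1, u.2⟩
    exact Subtype.ext ((Submodule.mem_bot ℂ).1 h2)
  have hY : ∀ i, ∃ X ∈ relationOperators W, Φ X = b.coord i := fun i => by
    have : b.coord i ∈ (Subalgebra.toSubmodule (relationOperators W)).map Φ := hΦ ▸ trivial
    obtain ⟨X, hX, h⟩ := this
    exact ⟨X, hX, h⟩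
  choose Y hYmem hYb using hY
  -- Nakayama over the ring of invariants: `U` spans modulo the maximal ideal of the origin, whose
  -- extension is the Hilbert ideal.
  have hnak : ∃ r : invariants W, r - 1 ∈ invariantsMax W ∧
      r • (⊤ : Submodule (invariants W) (Coord V)) ≤
        Submodule.span (invariants W) (Set.range fun j => (b j : Coord V)) := by
    refine Submodule.exists_sub_one_mem_and_smul_le_of_fg_of_le_sup
      (finite_invariants W).fg_top le_rfl ?_
    rw [← hilbertIdeal_eq_smul_top]
    intro p _
    have hp : p ∈ N ⊔ U := hU.sup_eq_top ▸ trivial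
    obtain ⟨x, hx, y, hy, rfl⟩ := Submodule.mem_sup.1 hp
    refine add_mem (Submodule.mem_sup_right hx) (Submodule.mem_sup_left ?_)
    have h1 := congrArg U.subtype (b.sum_repr ⟨y, hy⟩)
    rw [map_sum] at h1
    change _ = y at h1
    rw [← h1]
    refine sum_mem fun i _ => ?_
    rw [map_smul]
    exact (Submodule.span (invariants W) _).smul_of_tower_mem _ (Submodule.subset_span ⟨i, rfl⟩)
  obtain ⟨f, hf1, hf⟩ := hnak
  refine ⟨n, fun j => b j, f, f.2, ?_, ?_, ?_⟩
  · have h := RingHom.mem_ker.1 hf1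
    rw [map_sub, map_one, sub_eq_zero] at h
    exact h
  · intro s
    have : f • s ∈ Submodule.span (invariants W) (Set.range fun j => (b j : Coord V)) :=
      hf (Submodule.smul_mem_pointwise_smul _ _ _ trivial)
    obtain ⟨c, hc⟩ := (Submodule.mem_span_range_iff_exists_fun _).1 this
    exact ⟨fun j => c j, fun j => (c j).2, hc.symm⟩
  · intro a ha
    -- The operators `Y i` turn the relation into the linear system `M a = 0`, and `M` is the
    -- identity at the origin, so its determinant is nonzero.
    let M : Matrix (Fin n) (Fin n) (Coord V) := fun i j => Y i (b j)
    have hM : (evalAt (0 : V)).toRingHom.mapMatrix M = 1 := by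
      ext i j
      have : evalAt (0 : V) (Y i (b j)) = b.coord i (b j) := by rw [← hYb]; rfl
      simp only [RingHom.mapMatrix_apply, Matrix.map_apply]
      refine this.trans ?_
      rw [Module.Basis.coord_apply, Module.Basis.repr_self, Matrix.one_apply,
        Finsupp.single_apply]
      simp only [eq_comm]
    have hdet : M.det ≠ 0 := by
      intro h
      have := congrArg (evalAt (0 : V)).toRingHom h
      rw [RingHom.map_det, hM, Matrix.det_one, map_zero] at this
      exact one_ne_zero this
    refine Matrix.eq_zero_of_mulVec_eq_zero hdet (funext fun i => ?_)
    have := hYmem i n a (fun j => b j) ha 1 (one_mem W)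
    simp only [one_smul] at this
    simp only [Matrix.mulVec, dotProduct, M, Pi.zero_apply]
    rw [← this]
    exact Finset.sum_congr rfl fun j _ => mul_comm _ _

end Steinberg

/-! ### Steinberg's theorem on stabilizers of points -/

section SteinbergTheorem

variable {V : Type} [AddCommGroup V] [Module ℂ V]

/-- The subgroup generated by the reflections in `W` that fix `v`. -/
def reflectionStab (W : Subgroup (V ≃ₗ[ℂ] V)) (v : V) : Subgroup (V ≃ₗ[ℂ] V) :=
  Subgroup.closure {r | r ∈ W ∧ IsReflection r ∧ r v = v}

theorem reflectionStab_le (W : Subgroup (V ≃ₗ[ℂ] V)) (v : V) : reflectionStab W v ≤ W :=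
  (Subgroup.closure_le _).2 fun _ h => h.1

/-- On the line through `v`, `f` is a polynomial in one variable with nonzero constant term. This
allows `v` to be moved into the locus where the local basis works without changing its stabilizer.
-/
theorem exists_evalAt_smul_ne_zero {f : Coord V} (hf : evalAt 0 f ≠ 0) (v : V) :
    ∃ t : ℂ, t ≠ 0 ∧ evalAt (t • v) f ≠ 0 := by
  let F : Coord V →ₐ[ℂ] Polynomial ℂ := SymmetricAlgebra.lift
    (LinearMap.toSpanSingleton ℂ (Polynomial ℂ) Polynomial.X ∘ₗ Module.Dual.eval ℂ V v)
  have hF : ∀ (t : ℂ) (p : Coord V), (F p).eval t = evalAt (t • v) p := by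
    intro t p
    rw [← Polynomial.coe_aeval_eq_eval]
    change ((Polynomial.aeval t).comp F) p = _
    congr 1
    exact coord_algHom_ext fun ℓ => by simp [F, mul_comm]
  have h0 : F f ≠ 0 := fun h => hf (by
    rw [← zero_smul ℂ v, ← hF, h, Polynomial.eval_zero])
  obtain ⟨t, ht⟩ := Infinite.exists_notMem_finset (insert 0 (F f).roots.toFinset)
  rw [Finset.mem_insert, Multiset.mem_toFinset, Polynomial.mem_roots h0, not_or] at ht
  exact ⟨t, ht.1, fun h => ht.2 (by rw [Polynomial.IsRoot, hF, h])⟩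

/-- If `g ∉ K` and no element of `gK` acts trivially on linear forms modulo the prime `P`, then
some `K`-invariant is moved by `g` modulo `P`. -/
theorem exists_invariant_sub_smul_notMem {K : Subgroup (V ≃ₗ[ℂ] V)} [Finite K] {g : V ≃ₗ[ℂ] V}
    (P : Ideal (Coord V)) [P.IsPrime]
    (h : ∀ k ∈ K, ∃ ℓ, lin ℓ - (g * k) • lin ℓ ∉ P) :
    ∃ c ∈ invariants K, c - g • c ∉ P := by
  have := Fintype.ofFinite K
  by_contra! hc
  -- for all s there is k with s - g k s ∈ P
  have h1 : ∀ s : Coord V, ∃ k : K, s - (g * (k : V ≃ₗ[ℂ] V)) • s ∈ P := by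
    intro s
    -- The orbit polynomial of `s` has `K`-invariant coefficients. If `g` moves no invariant modulo
    -- `P`, then `F` and its image `G` under `g` agree modulo `P`, so the root `s` of `F` is a root
    -- of `G` modulo `P`.
    let F : Polynomial (Coord V) := ∏ k : K, (Polynomial.X - Polynomial.C ((k : V ≃ₗ[ℂ] V) • s))
    let G : Polynomial (Coord V) :=
      ∏ k : K, (Polynomial.X - Polynomial.C ((g * (k : V ≃ₗ[ℂ] V)) • s))
    have hG : G = F.map (MulSemiringAction.toRingHom (V ≃ₗ[ℂ] V) (Coord V) g) := by
      simp only [F, G, Polynomial.map_prod, Polynomial.map_sub, Polynomial.map_X,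
        Polynomial.map_C, mul_smul]
      rfl
    have hF : ∀ i, F.coeff i ∈ invariants K := by
      intro i
      rw [mem_invariants]
      intro w hw
      have : F.map (MulSemiringAction.toRingHom (V ≃ₗ[ℂ] V) (Coord V) w) = F := by
        simp only [F, Polynomial.map_prod, Polynomial.map_sub, Polynomial.map_X,
          Polynomial.map_C, MulSemiringAction.toRingHom_apply, smul_smul]
        exact Fintype.prod_equiv (Equiv.mulLeft (⟨w, hw⟩ : K)) _ _ fun g => rfl
      conv_rhs => rw [← this]
      rw [Polynomial.coeff_map]
      rfl
    have hFG : F.map (Ideal.Quotient.mk P) = G.map (Ideal.Quotient.mk P) := by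
      ext i
      rw [hG, Polynomial.coeff_map, Polynomial.coeff_map, Polynomial.coeff_map]
      exact Ideal.Quotient.eq.2 (hc _ (hF i))
    have hFs : F.eval s = 0 := by
      rw [Polynomial.eval_prod]
      exact Finset.prod_eq_zero (Finset.mem_univ 1) (by simp)
    have hGs : G.eval s ∈ P := by
      rw [← Ideal.Quotient.eq_zero_iff_mem, ← Polynomial.eval₂_at_apply, ← Polynomial.eval_map,
        ← hFG, Polynomial.eval_map, Polynomial.eval₂_at_apply, hFs, map_zero]
    rw [Polynomial.eval_prod] at hGs
    obtain ⟨k, -, hk⟩ := Ideal.IsPrime.prod_mem_iff.1 hGs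
    exact ⟨k, by simpa using hk⟩
  -- So far `k` depends on `s`. The linear forms served by a given `k` form a subspace, and a space
  -- over an infinite field is not a finite union of proper subspaces.
  let p : K → Submodule ℂ (Module.Dual ℂ V) := fun k =>
    (P.restrictScalars ℂ).comap ((LinearMap.id - (coordAct (g * (k : V ≃ₗ[ℂ] V))).toLinearMap) ∘ₗ
      SymmetricAlgebra.ι ℂ (Module.Dual ℂ V))
  have h2 : ⋃ k, (p k : Set (Module.Dual ℂ V)) = Set.univ := by
    rw [Set.eq_univ_iff_forall]
    intro ℓ
    obtain ⟨k, hk⟩ := h1 (lin ℓ)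
    exact Set.mem_iUnion.2 ⟨k, hk⟩
  obtain ⟨k, hk⟩ := Subspace.exists_eq_top_of_iUnion_eq_univ h2
  obtain ⟨ℓ, hℓ⟩ := h k k.2
  have hm : ℓ ∈ p k := hk ▸ trivial
  exact hℓ hm

variable [Module.Finite ℂ V]

/-- A nonzero linear form divisible by `q` divides `q`, so all the forms `ℓ ∘ (1 - g⁻¹)` have
kernels containing the kernel of a single one, `m`. The fixed locus of `g` is therefore the
hyperplane `ker m`. It contains `v` because `q` vanishes there. -/
theorem prime_dvd_of_trivial {g : V ≃ₗ[ℂ] V} (hg : IsOfFinOrder g) (hg1 : g ≠ 1) {q : Coord V}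
    (hq : Prime q) (h : ∀ ℓ, q ∣ lin ℓ - g • lin ℓ) {v : V} (hv : evalAt v q = 0) :
    IsReflection g ∧ g v = v := by
  have hfix : ∀ ℓ : Module.Dual ℂ V, lin ℓ - g • lin ℓ =
      lin (ℓ ∘ₗ (LinearMap.id - (g.symm : V →ₗ[ℂ] V))) := fun ℓ => by
    rw [smul_lin, ← map_sub]
    congr 1
    ext x
    simp
  simp only [hfix] at h
  have hgv : g v = v := by
    have : ∀ ℓ : Module.Dual ℂ V, ℓ (v - g.symm v) = 0 := by
      intro ℓ
      obtain ⟨c, hc⟩ := h ℓ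
      have := congrArg (evalAt v) hc
      rw [map_mul, hv, zero_mul, evalAt_lin] at this
      exact this
    have h0 := (Module.forall_dual_apply_eq_zero_iff ℂ _).1 this
    rw [sub_eq_zero] at h0
    conv_lhs => rw [h0]
    exact g.apply_symm_apply v
  refine ⟨⟨hg, ?_⟩, hgv⟩
  obtain ⟨u, hu⟩ : ∃ u, u - g.symm u ≠ 0 := by
    by_contra! hc
    refine hg1 (LinearEquiv.ext fun x => ?_)
    conv_lhs => rw [sub_eq_zero.1 (hc x)]
    exact g.apply_symm_apply x
  obtain ⟨ℓ, hℓ⟩ : ∃ ℓ : Module.Dual ℂ V, ℓ (u - g.symm u) ≠ 0 := by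
    by_contra! hc
    exact hu ((Module.forall_dual_apply_eq_zero_iff ℂ _).1 hc)
  set m := ℓ ∘ₗ (LinearMap.id - (g.symm : V →ₗ[ℂ] V)) with hm
  have hm0 : m ≠ 0 := fun h0 => hℓ (by simpa [hm] using LinearMap.congr_fun h0 u)
  have hker : LinearMap.ker m = fixedLocus g := by
    ext x
    constructor
    · intro hx
      have h3 : ∀ ℓ' : Module.Dual ℂ V, ℓ' (x - g.symm x) = 0 := fun ℓ' =>
        ker_le_ker_of_dvd hq.not_isUnit hm0 (h ℓ) (h ℓ') hx
      have h0 := sub_eq_zero.1 ((Module.forall_dual_apply_eq_zero_iff ℂ _).1 h3)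
      rw [mem_fixedLocus]
      conv_lhs => rw [h0]
      exact g.apply_symm_apply x
    · intro hx
      rw [mem_fixedLocus] at hx
      have : g.symm x = x := by conv_lhs => rw [← hx]; exact g.symm_apply_apply x
      simp [hm, this]
  rw [← hker]
  exact LinearMap.isCoatom_ker_of_surjective (LinearMap.surjective hm0)

/-- Steinberg's theorem: the stabilizer of a point in a reflection group is generated by the
reflections that it contains. -/
theorem mem_reflectionStab {W : Subgroup (V ≃ₗ[ℂ] V)} (hW : IsReflectionGroup W) (v : V)
    {h : V ≃ₗ[ℂ] V} (hh : h ∈ W) (hhv : h v = v) : h ∈ reflectionStab W v := by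
  classical
  have := hW.finite
  have := Fintype.ofFinite W
  obtain ⟨n, b, f, hfW, hf0, hgen, hind⟩ := exists_local_basis hW
  obtain ⟨t, ht, hft⟩ := exists_evalAt_smul_ne_zero (by rw [hf0]; exact one_ne_zero) v
  have htv : ∀ g : V ≃ₗ[ℂ] V, g (t • v) = t • v ↔ g v = v := fun g => by
    rw [map_smul, (smul_right_injective V ht).eq_iff]
  set K := reflectionStab W v with hK
  have hKW : K ≤ W := reflectionStab_le W v
  have : Finite K := Finite.of_injective _ (Subgroup.inclusion_injective hKW)
  -- functions `W → S` in the span of the families of conjugates of the `b j`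
  let 𝔞 : Coord V → (Fin n → Coord V) → Prop := fun p a =>
    ∀ w ∈ W, ∑ j, a j * w • b j = if w ∈ K then p else 0
  -- The algebra generated by the orbit functions `w ↦ w • s`. After multiplication by `f` its
  -- elements become combinations of the orbit functions of the `b j`.
  let T : Subalgebra (Coord V) (W → Coord V) :=
    Algebra.adjoin (Coord V) (Set.range fun (s : Coord V) (w : W) => (w : V ≃ₗ[ℂ] V) • s)
  have hT : ∀ φ ∈ T, ∃ a : Fin n → Coord V, ∀ w : W, ∑ j, a j * (w : V ≃ₗ[ℂ] V) • b j =
      f * φ w := by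
    intro φ hφ
    let M : Submonoid (W → Coord V) :=
      { carrier := Set.range fun (s : Coord V) (w : W) => (w : V ≃ₗ[ℂ] V) • s
        mul_mem' := by
          rintro _ _ ⟨s, rfl⟩ ⟨s', rfl⟩
          exact ⟨s * s', funext fun w => smul_mul' _ _ _⟩
        one_mem' := ⟨1, funext fun w => smul_one _⟩ }
    have hφ' : φ ∈ Submodule.span (Coord V) (M : Set (W → Coord V)) := by
      rw [← M.closure_eq, ← Algebra.adjoin_eq_span]
      exact hφ
    induction hφ' using Submodule.span_induction with
    | mem x hx =>
      obtain ⟨s, rfl⟩ := hx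
      obtain ⟨c, hcW, hc⟩ := hgen s
      refine ⟨c, fun w => ?_⟩
      have := congrArg ((w : V ≃ₗ[ℂ] V) • ·) hc
      simp only [smul_mul', Finset.smul_sum] at this
      rw [mem_invariants.1 hfW w w.2] at this
      rw [this]
      exact Finset.sum_congr rfl fun j _ => by rw [mem_invariants.1 (hcW j) w w.2]
    | zero => exact ⟨0, fun w => by simp⟩
    | add x y hx hy ihx ihy =>
      obtain ⟨a, ha⟩ := ihx (by
        change x ∈ Subalgebra.toSubmodule T
        rw [Algebra.adjoin_eq_span]; rw [← M.closure_eq] at hx; exact hx)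
      obtain ⟨a', ha'⟩ := ihy (by
        change y ∈ Subalgebra.toSubmodule T
        rw [Algebra.adjoin_eq_span]; rw [← M.closure_eq] at hy; exact hy)
      exact ⟨a + a', fun w => by
        simp only [Pi.add_apply, add_mul, Finset.sum_add_distrib, ha, ha', mul_add]⟩
    | smul c x hx ihx =>
      obtain ⟨a, ha⟩ := ihx (by
        change x ∈ Subalgebra.toSubmodule T
        rw [Algebra.adjoin_eq_span]; rw [← M.closure_eq] at hx; exact hx)
      refine ⟨c • a, fun w => ?_⟩
      simp only [Pi.smul_apply, smul_eq_mul, mul_assoc, ← Finset.mul_sum, ha]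
      ring
  -- For each `g ∉ K` choose a `K`-invariant `c g` moved by `g` modulo `P`. The product over these
  -- `g` of the functions `w ↦ w • c g - g • c g` vanishes off `K` and is constant on `K`, with
  -- value outside `P`.
  have hlocal : ∀ (P : Ideal (Coord V)) [P.IsPrime], f ∉ P →
      (∀ g ∈ W, g ∉ K → ∃ ℓ, lin ℓ - g • lin ℓ ∉ P) → ∃ q a, 𝔞 q a ∧ q ∉ P := by
    intro P _ hfP hP
    have hc : ∀ g : W, (g : V ≃ₗ[ℂ] V) ∉ K →
        ∃ c ∈ invariants K, c - (g : V ≃ₗ[ℂ] V) • c ∉ P := fun g hg =>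
      exists_invariant_sub_smul_notMem P fun k hk =>
        hP _ (mul_mem g.2 (hKW hk)) fun hgk => hg ((Subgroup.mul_mem_cancel_right K hk).1 hgk)
    choose! c hcK hcP using hc
    let s : Finset W := Finset.univ.filter fun g => (g : V ≃ₗ[ℂ] V) ∉ K
    let E : W → Coord V := ∏ g ∈ s, ((fun w : W => (w : V ≃ₗ[ℂ] V) • c g) -
      algebraMap (Coord V) (W → Coord V) ((g : V ≃ₗ[ℂ] V) • c g))
    have hE : E ∈ T := prod_mem fun g _ =>
      sub_mem (Algebra.subset_adjoin ⟨c g, rfl⟩) (Subalgebra.algebraMap_mem _ _)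
    obtain ⟨a, ha⟩ := hT E hE
    let q := ∏ g ∈ s, (c g - (g : V ≃ₗ[ℂ] V) • c g)
    have hEval : ∀ w : W, E w = if (w : V ≃ₗ[ℂ] V) ∈ K then q else 0 := by
      intro w
      have : E w = ∏ g ∈ s, ((w : V ≃ₗ[ℂ] V) • c g - (g : V ≃ₗ[ℂ] V) • c g) := by
        simp [E, Finset.prod_apply]
      rw [this]
      split_ifs with hw
      · refine Finset.prod_congr rfl fun g hg => ?_
        rw [mem_invariants.1 (hcK g (Finset.mem_filter.1 hg).2) _ hw]
      · exact Finset.prod_eq_zero (Finset.mem_filter.2 ⟨Finset.mem_univ w, hw⟩) (sub_self _)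
    refine ⟨f * q, a, fun w hw => ?_, fun hfq => ?_⟩
    · rw [ha ⟨w, hw⟩, hEval]
      simp only [mul_ite, mul_zero]
    · obtain h1 | h1 := Ideal.IsPrime.mem_or_mem ‹_› hfq
      · exact hfP h1
      · obtain ⟨g, hg, hgP⟩ := Ideal.IsPrime.prod_mem_iff.1 h1
        exact hcP g (Finset.mem_filter.1 hg).2 hgP
  have hne1 : ∀ g : V ≃ₗ[ℂ] V, g ∉ K → g ≠ 1 := fun g hg h1 => hg (h1 ▸ one_mem K)
  have hfin : ∀ g ∈ W, IsOfFinOrder g := fun g hg => by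
    have := isOfFinOrder_of_finite (⟨g, hg⟩ : W)
    exact Submonoid.isOfFinOrder_coe.2 this
  -- The height-one primes through the point: an element other than `1` acting trivially modulo `π`
  -- is a reflection fixing the point, hence belongs to `K`.
  have hprime : ∀ π : Coord V, Prime π → evalAt (t • v) π = 0 → ∃ q a, 𝔞 q a ∧ ¬ π ∣ q := by
    intro π hπ hπv
    have : (Ideal.span {π}).IsPrime := (Ideal.span_singleton_prime hπ.ne_zero).2 hπ
    obtain ⟨q, a, h1, h2⟩ := hlocal (Ideal.span {π}) (fun hf => by
        obtain ⟨c, hc⟩ := Ideal.mem_span_singleton.1 hf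
        exact hft (by rw [hc, map_mul, hπv, zero_mul])) (fun g hgW hgK => by
        by_contra! hc
        obtain ⟨h3, h4⟩ := prime_dvd_of_trivial (hfin g hgW) (hne1 g hgK) hπ
          (fun ℓ => Ideal.mem_span_singleton.1 (hc ℓ)) hπv
        exact hgK (Subgroup.subset_closure ⟨hgW, h3, (htv g).1 h4⟩))
    exact ⟨q, a, h1, fun h => h2 (Ideal.mem_span_singleton.2 h)⟩
  -- The prime factors vanishing at the point are removed one at a time. Comparison with a relation
  -- whose value `q` is not divisible by `π` shows, by uniqueness of coefficients, that `π` divides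
  -- every `a j`. The factors not vanishing at the point accumulate in `s`.
  have hdescend : ∀ p : Coord V, p ≠ 0 → ∀ s a, evalAt (t • v) s ≠ 0 → 𝔞 (s * p) a →
      ∃ q a', 𝔞 q a' ∧ evalAt (t • v) q ≠ 0 := by
    intro p
    induction p using UniqueFactorizationMonoid.induction_on_prime with
    | h₁ => exact fun h => absurd rfl h
    | h₂ x hx =>
      intro _ s a hs ha
      refine ⟨_, a, ha, ?_⟩
      rw [map_mul]
      exact mul_ne_zero hs (hx.map (evalAt (t • v))).ne_zero
    | h₃ p π hp hπ ih =>
      intro _ s a hs ha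
      by_cases hπv : evalAt (t • v) π = 0
      · obtain ⟨q, a', ha', hq⟩ := hprime π hπ hπv
        have hdvd : ∀ j, π ∣ a j := by
          have h0 : (fun j => q * a j - s * (π * p) * a' j) = 0 := by
            refine hind _ fun w hw => ?_
            have h1 := ha w hw
            have h2 := ha' w hw
            simp only [sub_mul, Finset.sum_sub_distrib, mul_assoc q, ← Finset.mul_sum, h1,
              mul_assoc (s * (π * p)), h2]
            split_ifs <;> ring
          intro j
          have h1 := congrFun h0 j
          simp only [Pi.zero_apply, sub_eq_zero] at h1
          refine (hπ.dvd_or_dvd (?_ : π ∣ q * a j)).resolve_left hq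
          rw [h1]
          exact ⟨s * p * a' j, by ring⟩
        choose a'' ha'' using hdvd
        refine ih hp s a'' hs fun w hw => mul_left_cancel₀ hπ.ne_zero ?_
        have h1 := ha w hw
        simp only [ha'', mul_assoc, ← Finset.mul_sum] at h1
        rw [h1]
        split_ifs <;> ring
      · refine ih hp (s * π) a ?_ ?_
        · rw [map_mul]; exact mul_ne_zero hs hπv
        · rwa [mul_assoc]
  obtain ⟨q₀, a₀, ha₀, hq₀⟩ := hlocal ⊥ (fun hf => hft (by
      rw [(Submodule.mem_bot _).1 hf, map_zero])) (fun g _ hgK => by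
      by_contra! hc
      refine hne1 g hgK (LinearEquiv.ext fun x => ?_)
      have h3 : ∀ ℓ : Module.Dual ℂ V, ℓ (x - g.symm x) = 0 := fun ℓ => by
        have := congrArg (evalAt x) ((Submodule.mem_bot _).1 (hc ℓ))
        rw [smul_lin, ← map_sub, evalAt_lin, map_zero] at this
        simpa using this
      have h0 := sub_eq_zero.1 ((Module.forall_dual_apply_eq_zero_iff ℂ _).1 h3)
      conv_lhs => rw [h0]
      exact g.apply_symm_apply x)
  obtain ⟨q, a, ha, hqv⟩ := hdescend q₀ (fun h => hq₀ (h ▸ zero_mem _)) 1 a₀ (by simp)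
    (by rwa [one_mul])
  have hev : ∀ g : V ≃ₗ[ℂ] V, g v = v → ∀ p, evalAt (t • v) (g • p) = evalAt (t • v) p := by
    intro g hg p
    rw [evalAt_smul]
    congr 2
    rw [inv_smul_eq_iff]
    exact ((htv g).2 hg).symm
  -- Since `h` fixes the point, the left sides for `1` and `h` have the same value there. The right
  -- side is `q ≠ 0` for `1`, and would be `0` for `h` if `h ∉ K`.
  have h1 := congrArg (evalAt (t • v)) (ha 1 (one_mem W))
  have h2 := congrArg (evalAt (t • v)) (ha h hh)
  rw [if_pos (one_mem K), map_sum] at h1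
  rw [map_sum] at h2
  simp only [map_mul, hev h hhv, one_smul] at h1 h2
  by_contra hcon
  rw [if_neg hcon, map_zero] at h2
  exact hqv (h1 ▸ h2)

end SteinbergTheorem

/-! ### Cameral covers as fibres of the quotient map -/

theorem exists_complex_point (B : Type) [CommRing B] [Algebra ℂ B] [Nontrivial B]
    [Algebra.FiniteType ℂ B] : Nonempty (B →ₐ[ℂ] ℂ) := by
  obtain ⟨m, hm⟩ := Ideal.exists_maximal B
  let _ : Field (B ⧸ m) := Ideal.Quotient.field m
  have : Algebra.FiniteType ℂ (B ⧸ m) :=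
    Algebra.FiniteType.of_surjective (Ideal.Quotient.mkₐ ℂ m) Ideal.Quotient.mk_surjective
  have : Module.Finite ℂ (B ⧸ m) := finite_of_finite_type_of_isJacobsonRing ℂ (B ⧸ m)
  exact ⟨(IsAlgClosed.lift : (B ⧸ m) →ₐ[ℂ] ℂ).comp (Ideal.Quotient.mkₐ ℂ m)⟩

section Fibre

variable {V : Type} [AddCommGroup V] [Module ℂ V] {W : Subgroup (V ≃ₗ[ℂ] V)}
variable {R : Type} [CommRing R] [Algebra ℂ R] [MulSemiringAction W R] [SMulCommClass W ℂ R]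

/-- A presentation of `Spec R` as a fibre of the quotient map `V → V / W`. -/
structure IsFibre (φ : Coord V →ₐ[ℂ] R) : Prop where
  surj : Function.Surjective φ
  map_smul : ∀ (w : W) (p : Coord V), φ ((w : V ≃ₗ[ℂ] V) • p) = w • φ p
  map_invariant : ∀ p ∈ invariants W, ∃ c : ℂ, φ p = algebraMap ℂ R c
  ker_le : RingHom.ker φ ≤ Ideal.span {p | p ∈ invariants W ∧ φ p = 0}

/-- Specialization of the given isomorphism along a complex point `β` of the étale cover presents
`Spec R` as the fibre of `V → V / W` over the image of `β`. -/
theorem IsCameralCover.exists_isFibre (hR : IsCameralCover W R) :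
    ∃ φ : Coord V →ₐ[ℂ] R, IsFibre (W := W) φ := by
  obtain ⟨B, _, _, _, _, hB, hsurj, e, he⟩ := hR
  have : Nontrivial B := by
    obtain ⟨p, -⟩ := hsurj ⊥
    exact ⟨⟨0, 1, fun h => p.2.ne_top ((Ideal.eq_top_iff_one _).2 (h ▸ zero_mem _))⟩⟩
  obtain ⟨β⟩ := exists_complex_point B
  let βR : B ⊗[ℂ] R →ₐ[ℂ] R :=
    Algebra.TensorProduct.lift ((Algebra.ofId ℂ R).comp β) (AlgHom.id ℂ R)
      (fun _ _ => Commute.all _ _)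
  have hβR : ∀ b r, βR (b ⊗ₜ r) = algebraMap ℂ R (β b) * r := fun b r => by
    simp [βR, Algebra.ofId_apply]
  have hβs : ∀ b x, βR (b • x) = algebraMap ℂ R (β b) * βR x := by
    intro b x
    induction x with
    | zero => simp
    | add x y hx hy => rw [smul_add, map_add, hx, hy, map_add, mul_add]
    | tmul c r => rw [TensorProduct.smul_tmul', hβR, hβR, smul_eq_mul, map_mul, map_mul, mul_assoc]
  let i : Coord V →+* B ⊗[invariants W] Coord V :=
    (Algebra.TensorProduct.includeRight : Coord V →ₐ[invariants W] B ⊗[invariants W] Coord V)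
  have hi : ∀ p, i p = 1 ⊗ₜ p := fun p => rfl
  let φ₀ : Coord V →+* R := βR.toRingHom.comp ((e : _ →+* B ⊗[ℂ] R).comp i)
  have hφ₀ : ∀ p, φ₀ p = βR (e (1 ⊗ₜ p)) := fun p => rfl
  have hinv : ∀ f : invariants W, φ₀ (f : Coord V) =
      algebraMap ℂ R (β (algebraMap (invariants W) B f)) := by
    intro f
    have h1 : (1 : B) ⊗ₜ[invariants W] (f : Coord V) =
        algebraMap (invariants W) B f • (1 : B ⊗[invariants W] Coord V) := by
      have : (f : Coord V) = f • (1 : Coord V) := by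
        rw [Algebra.smul_def, mul_one]; rfl
      rw [this, ← TensorProduct.smul_tmul, Algebra.TensorProduct.one_def,
        TensorProduct.smul_tmul', Algebra.smul_def, smul_eq_mul]
    rw [hφ₀, h1, _root_.map_smul, map_one, hβs, map_one, mul_one]
  let φ : Coord V →ₐ[ℂ] R :=
    { φ₀ with
      commutes' := fun c => by
        have := hinv (algebraMap ℂ (invariants W) c)
        rw [← IsScalarTower.algebraMap_apply ℂ (invariants W) B, AlgHom.commutes] at this
        exact this }
  have hφ : ∀ p, φ p = βR (e (1 ⊗ₜ p)) := fun p => rfl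
  have hφinv : ∀ f : invariants W, φ (f : Coord V) =
      algebraMap ℂ R (β (algebraMap (invariants W) B f)) := hinv
  refine ⟨φ, ⟨?_, ?_, ?_, ?_⟩⟩
  · intro r
    obtain ⟨x, hx⟩ := e.surjective (1 ⊗ₜ r)
    have h2 : ∀ x, ∃ p, φ p = βR (e x) := by
      intro x
      induction x with
      | zero => exact ⟨0, by simp⟩
      | add x y hx hy =>
        obtain ⟨p, hp⟩ := hx
        obtain ⟨q, hq⟩ := hy
        exact ⟨p + q, by rw [map_add, hp, hq, map_add, map_add]⟩
      | tmul b p =>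
        refine ⟨β b • p, ?_⟩
        have : b ⊗ₜ[invariants W] p = b • ((1 : B) ⊗ₜ[invariants W] p) := by
          rw [TensorProduct.smul_tmul', smul_eq_mul, mul_one]
        rw [this, _root_.map_smul, _root_.map_smul, hβs, Algebra.smul_def, hφ]
    obtain ⟨p, hp⟩ := h2 x
    exact ⟨p, by rw [hp, hx, hβR]; simp⟩
  · intro w p
    have h1 := he w (1 ⊗ₜ p)
    rw [Algebra.TensorProduct.map_tmul] at h1
    have h2 : ∀ x, βR (Algebra.TensorProduct.map (AlgHom.id B B) (actAlgHom W R w) x) =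
        w • βR x := by
      intro x
      induction x with
      | zero => simp
      | add x y hx hy => rw [map_add, map_add, hx, hy, map_add, smul_add]
      | tmul b r =>
        rw [Algebra.TensorProduct.map_tmul, hβR, hβR, ← Algebra.smul_def, ← Algebra.smul_def,
          smul_comm w]
        rfl
    rw [hφ, hφ, ← h2, ← h1]
    rfl
  · exact fun p hp => ⟨_, hφinv ⟨p, hp⟩⟩
  · set I : Ideal (Coord V) := Ideal.span {p | p ∈ invariants W ∧ φ p = 0} with hI
    have hmem : ∀ f : invariants W,
        (f : Coord V) - algebraMap ℂ (Coord V) (β (algebraMap (invariants W) B f)) ∈ I := by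
      intro f
      refine Ideal.subset_span ⟨sub_mem f.2 (Subalgebra.algebraMap_mem _ _), ?_⟩
      rw [map_sub, hφinv, AlgHom.commutes, sub_self]
    let g : B →ₐ[invariants W] Coord V ⧸ I :=
      { (algebraMap ℂ (Coord V ⧸ I)).comp β.toRingHom with
        commutes' := fun f => by
          refine Eq.symm (Ideal.Quotient.eq.2 (hmem f)) }
    have hg : ∀ b, g b = algebraMap ℂ (Coord V ⧸ I) (β b) := fun b => rfl
    let ψ : B ⊗[invariants W] Coord V →ₐ[invariants W] Coord V ⧸ I :=
      Algebra.TensorProduct.lift g (Ideal.Quotient.mkₐ (invariants W) I)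
        (fun _ _ => Commute.all _ _)
    have hψ : ∀ b p, ψ (b ⊗ₜ p) = algebraMap ℂ _ (β b) * Ideal.Quotient.mk I p := fun b p => by
      simp [ψ, hg]
    have hψs : ∀ b x, ψ (b • x) = algebraMap ℂ _ (β b) * ψ x := by
      intro b x
      induction x with
      | zero => simp
      | add x y hx hy => rw [smul_add, map_add, hx, hy, map_add, mul_add]
      | tmul c r =>
        rw [TensorProduct.smul_tmul', hψ, hψ, smul_eq_mul, map_mul, map_mul, mul_assoc]
    have hes : ∀ (b : B) x, e.symm (b • x) = b • e.symm x := fun b x => _root_.map_smul e.symm b x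
    -- `ψ ∘ e.symm` is semilinear along `β`, so it depends on `z` only through `βR z`. A polynomial
    -- killed by `φ` therefore dies modulo `I`.
    have hz : ∀ z, ψ (e.symm z) = ψ (e.symm (1 ⊗ₜ βR z)) := by
      intro z
      induction z with
      | zero => simp
      | add x y hx hy => rw [map_add, map_add, hx, hy, map_add, tmul_add, map_add, map_add]
      | tmul b r =>
        have h1 : b ⊗ₜ[ℂ] r = b • ((1 : B) ⊗ₜ[ℂ] r) := by
          rw [TensorProduct.smul_tmul', smul_eq_mul, mul_one]
        have h2 : (1 : B) ⊗ₜ[ℂ] (algebraMap ℂ R (β b) * r) =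
            algebraMap ℂ B (β b) • ((1 : B) ⊗ₜ[ℂ] r) := by
          rw [← Algebra.smul_def, TensorProduct.tmul_smul, algebraMap_smul]
        rw [hβR, h2, h1, hes, hes, hψs, hψs, AlgHom.commutes]
        rfl
    intro p hp
    have h1 : ψ (1 ⊗ₜ p) = Ideal.Quotient.mk I p := by rw [hψ]; simp
    have h2 : ψ (1 ⊗ₜ p) = 0 := by
      have h3 : e.symm (e (1 ⊗ₜ p)) = 1 ⊗ₜ p := e.symm_apply_apply _
      have hp0 : βR (e (1 ⊗ₜ p)) = 0 := hp
      rw [← h3, hz, hp0, tmul_zero, map_zero, map_zero]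
    exact Ideal.Quotient.eq_zero_iff_mem.1 (h1.symm.trans h2)

end Fibre

/-! ### Coinvariants -/

section Coinvariants

variable {V : Type} [AddCommGroup V] [Module ℂ V] (W : Subgroup (V ≃ₗ[ℂ] V)) (X : Submodule ℂ V)

/-- The coordinate ring of `Co(W_X, V)`. -/
def Coinv : Type := Coord V ⧸ coinvariantIdeal (pointwiseStab W X)

instance : CommRing (Coinv W X) :=
  inferInstanceAs (CommRing (Coord V ⧸ coinvariantIdeal (pointwiseStab W X)))

instance : Algebra ℂ (Coinv W X) :=
  inferInstanceAs (Algebra ℂ (Coord V ⧸ coinvariantIdeal (pointwiseStab W X)))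

/-- The restriction of polynomial functions to `Co(W_X, V)`. -/
def coinvMk : Coord V →ₐ[ℂ] Coinv W X :=
  Ideal.Quotient.mkₐ ℂ (coinvariantIdeal (pointwiseStab W X))

theorem coinvMk_surjective : Function.Surjective (coinvMk W X) := Ideal.Quotient.mk_surjective

variable {W X} in
theorem coinvMk_eq_zero {p : Coord V} :
    coinvMk W X p = 0 ↔ p ∈ coinvariantIdeal (pointwiseStab W X) :=
  Ideal.Quotient.eq_zero_iff_mem

/-- Homomorphisms from the coordinate ring of `Co(W_X, V)`. -/
def coinvLift {B : Type} [CommRing B] [Algebra ℂ B] (f : Coord V →ₐ[ℂ] B)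
    (hf : ∀ p ∈ coinvariantIdeal (pointwiseStab W X), f p = 0) : Coinv W X →ₐ[ℂ] B :=
  Ideal.Quotient.liftₐ (coinvariantIdeal (pointwiseStab W X)) f hf

variable {W X} in
theorem coinv_algHom_ext {B : Type} [CommRing B] [Algebra ℂ B] {F G : Coinv W X →ₐ[ℂ] B}
    (h : ∀ p, F (coinvMk W X p) = G (coinvMk W X p)) : F = G :=
  AlgHom.ext fun c => by
    obtain ⟨p, rfl⟩ := coinvMk_surjective W X c
    exact h p

variable {W X}

theorem mem_pointwiseStab {w : W} :
    w ∈ pointwiseStab W X ↔ ∀ x ∈ X, (w : V ≃ₗ[ℂ] V) x = x :=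
  mem_fixingSubgroup_iff W

theorem mem_setStab {w : W} :
    w ∈ setStab W X ↔ (w : V ≃ₗ[ℂ] V) • (X : Set V) = (X : Set V) := Iff.rfl

theorem pointwiseStab_le_setStab : pointwiseStab W X ≤ setStab W X := by
  intro w hw
  rw [mem_setStab]
  ext x
  rw [mem_pointwiseStab] at hw
  constructor
  · rintro ⟨y, hy, rfl⟩
    change (w : V ≃ₗ[ℂ] V) y ∈ (X : Set V)
    rwa [hw y hy]
  · exact fun hx => ⟨x, hx, hw x hx⟩

theorem conj_mem_pointwiseStab {n w : W} (hn : n ∈ setStab W X) (hw : w ∈ pointwiseStab W X) :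
    n⁻¹ * w * n ∈ pointwiseStab W X := by
  have := (pointwiseStab_normal W X).conj_mem ⟨w, pointwiseStab_le_setStab hw⟩
    (Subgroup.mem_subgroupOf.2 hw) (⟨n, hn⟩⁻¹)
  simpa [Subgroup.mem_subgroupOf] using this

theorem mem_invariants_map {H : Subgroup W} {p : Coord V} :
    p ∈ invariants (H.map W.subtype) ↔ ∀ h ∈ H, ((h : W) : V ≃ₗ[ℂ] V) • p = p := by
  rw [mem_invariants]
  constructor
  · exact fun h w hw => h w (Subgroup.mem_map_of_mem W.subtype hw)
  · rintro h _ ⟨w, hw, rfl⟩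
    exact h w hw

theorem mem_coinvariantIdeal {H : Subgroup W} {p : Coord V}
    (h : ∀ h ∈ H, ((h : W) : V ≃ₗ[ℂ] V) • p = p) (h0 : evalAt 0 p = 0) :
    p ∈ coinvariantIdeal H :=
  Ideal.subset_span ⟨mem_invariants_map.2 h, by rw [algebraMapInv_eq_evalAt, h0]⟩

theorem coinvariantIdeal_le {H : Subgroup W} {I : Ideal (Coord V)}
    (h : ∀ p, (∀ h ∈ H, ((h : W) : V ≃ₗ[ℂ] V) • p = p) → evalAt 0 p = 0 → p ∈ I) :
    coinvariantIdeal H ≤ I :=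
  Ideal.span_le.2 fun p hp => h p (mem_invariants_map.1 hp.1) (by
    rw [← algebraMapInv_eq_evalAt]; exact hp.2)

/-- The action of `stab(X)` on `Co(W_X, V)`. -/
def coinvAct : setStab W X →* (Coinv W X →ₐ[ℂ] Coinv W X) where
  toFun n := coinvLift W X ((coinvMk W X).comp (coordAct ((n : W) : V ≃ₗ[ℂ] V))) fun p hp => by
    have : coinvariantIdeal (pointwiseStab W X) ≤
        (coinvariantIdeal (pointwiseStab W X)).comap (coordAct ((n : W) : V ≃ₗ[ℂ] V)) :=
      coinvariantIdeal_le fun p hp hp0 => by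
        change ((n : W) : V ≃ₗ[ℂ] V) • p ∈ coinvariantIdeal _
        refine mem_coinvariantIdeal (fun h hh => ?_) (by rw [evalAt_smul, smul_zero, hp0])
        have h1 := hp _ (conj_mem_pointwiseStab n.2 hh)
        rw [Subgroup.coe_mul, Subgroup.coe_mul, mul_smul, mul_smul, Subgroup.coe_inv,
          inv_smul_eq_iff] at h1
        exact h1
    exact coinvMk_eq_zero.2 (this hp)
  map_one' := coinv_algHom_ext fun p => congrArg (coinvMk W X) (one_smul (V ≃ₗ[ℂ] V) p)
  map_mul' a b := coinv_algHom_ext fun p =>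
    congrArg (coinvMk W X) (mul_smul ((a : W) : V ≃ₗ[ℂ] V) ((b : W) : V ≃ₗ[ℂ] V) p)

@[simp] theorem coinvAct_mk (n : setStab W X) (p : Coord V) :
    coinvAct n (coinvMk W X p) = coinvMk W X (((n : W) : V ≃ₗ[ℂ] V) • p) := rfl

variable (W X) in
/-- The origin of `Co(W_X, V)`. -/
def coinvPoint : Coinv W X →ₐ[ℂ] ℂ :=
  coinvLift W X (evalAt 0) fun p hp => by
    have : coinvariantIdeal (pointwiseStab W X) ≤ RingHom.ker (evalAt (0 : V)) :=
      coinvariantIdeal_le fun p _ h => h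
    exact this hp

@[simp] theorem coinvPoint_mk (p : Coord V) :
    coinvPoint W X (coinvMk W X p) = evalAt 0 p := rfl

/-- An element of the pointwise stabilizer, as an element of `stab(X)`. -/
def toStab (h : pointwiseStab W X) : setStab W X := ⟨h, pointwiseStab_le_setStab h.2⟩

/-- An orbit sum is an invariant polynomial, so in the coinvariants it is its value at the origin.
This is the source of the statements that invariants are scalars and that invariant functionals are
multiples of evaluation. -/
theorem sum_coinvAct [Fintype (pointwiseStab W X)] (c : Coinv W X) :
    ∑ h : pointwiseStab W X, coinvAct (toStab h) c =
      algebraMap ℂ (Coinv W X) (Fintype.card (pointwiseStab W X) * coinvPoint W X c) := by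
  obtain ⟨p, rfl⟩ := coinvMk_surjective W X c
  simp only [coinvAct_mk, coinvPoint_mk, ← map_sum]
  rw [← (coinvMk W X).commutes, ← sub_eq_zero, ← map_sub, coinvMk_eq_zero]
  refine mem_coinvariantIdeal (fun k hk => ?_) ?_
  · rw [smul_sub, smul_algebraMap_coord, Finset.smul_sum]
    congr 1
    simp only [smul_smul]
    exact Fintype.sum_equiv (Equiv.mulLeft (⟨k, hk⟩ : pointwiseStab W X)) _ _ fun g => rfl
  · rw [map_sub, map_sum]
    simp only [evalAt_smul, smul_zero, Finset.sum_const, AlgHom.commutes, Finset.card_univ]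
    simp

variable [Finite W]

/-- A linear form is a root of its orbit polynomial, whose coefficients are invariant. Modulo the
coinvariant ideal this polynomial becomes a power of the variable, so linear forms are nilpotent,
and the statement passes to sums and products. -/
theorem isNilpotent_coinv (c : Coinv W X) :
    IsNilpotent (c - algebraMap ℂ (Coinv W X) (coinvPoint W X c)) := by
  obtain ⟨p, rfl⟩ := coinvMk_surjective W X c
  rw [coinvPoint_mk]
  rw [← (coinvMk W X).commutes, ← map_sub]
  induction p using SymmetricAlgebra.induction with
  | algebraMap c => simp
  | ι ℓ =>
    have := Fintype.ofFinite (pointwiseStab W X)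
    let F : Polynomial (Coord V) := ∏ k : pointwiseStab W X,
      (Polynomial.X - Polynomial.C (((k : W) : V ≃ₗ[ℂ] V) • lin ℓ))
    have hmon : F.Monic := Polynomial.monic_prod_of_monic _ _ fun k _ => Polynomial.monic_X_sub_C _
    have hF : ∀ i, ∀ k ∈ pointwiseStab W X, ((k : W) : V ≃ₗ[ℂ] V) • F.coeff i = F.coeff i := by
      intro i w hw
      have : F.map (MulSemiringAction.toRingHom (V ≃ₗ[ℂ] V) (Coord V) (w : V ≃ₗ[ℂ] V)) = F := by
        simp only [F, Polynomial.map_prod, Polynomial.map_sub, Polynomial.map_X,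
          Polynomial.map_C, MulSemiringAction.toRingHom_apply, smul_smul]
        exact Fintype.prod_equiv (Equiv.mulLeft (⟨w, hw⟩ : pointwiseStab W X)) _ _ fun g => rfl
      conv_rhs => rw [← this]
      rw [Polynomial.coeff_map]
      rfl
    have hF0 : F.map (evalAt (0 : V)).toRingHom = Polynomial.X ^ F.natDegree := by
      have h1 : F.map (evalAt (0 : V)).toRingHom =
          Polynomial.X ^ Fintype.card (pointwiseStab W X) := by
        have h2 : ∀ k : pointwiseStab W X,
            (evalAt (0 : V)).toRingHom (((k : W) : V ≃ₗ[ℂ] V) • lin ℓ) = 0 := fun k => by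
          change evalAt 0 _ = 0
          rw [evalAt_smul, smul_zero, evalAt_lin, map_zero]
        simp only [F, Polynomial.map_prod, Polynomial.map_sub, Polynomial.map_X,
          Polynomial.map_C, h2, map_zero, sub_zero, Finset.prod_const, Finset.card_univ]
      have h3 : F.natDegree = Fintype.card (pointwiseStab W X) := by
        rw [← hmon.natDegree_map (evalAt (0 : V)).toRingHom, h1, Polynomial.natDegree_X_pow]
      rw [h1, h3]
    have hFq : F.map (coinvMk W X).toRingHom =
        Polynomial.X ^ F.natDegree := by
      ext i
      rw [Polynomial.coeff_map, Polynomial.coeff_X_pow]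
      have h1 := congrArg (fun q => Polynomial.coeff q i) hF0
      simp only [Polynomial.coeff_map, Polynomial.coeff_X_pow] at h1
      change evalAt 0 (F.coeff i) = _ at h1
      have h2 : F.coeff i - algebraMap ℂ _ (evalAt 0 (F.coeff i)) ∈
          coinvariantIdeal (pointwiseStab W X) :=
        mem_coinvariantIdeal (fun k hk => by rw [smul_sub, smul_algebraMap_coord, hF i k hk])
          (by simp)
      have h3 := coinvMk_eq_zero.2 h2
      rw [map_sub, sub_eq_zero, AlgHom.commutes] at h3
      change coinvMk W X (F.coeff i) = _
      rw [h3, h1]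
      split_ifs <;> simp
    have hFs : F.eval (lin ℓ) = 0 := by
      rw [Polynomial.eval_prod]
      exact Finset.prod_eq_zero (Finset.mem_univ 1) (by simp)
    refine ⟨F.natDegree, ?_⟩
    rw [evalAt_lin, map_zero, map_zero, sub_zero]
    have := congrArg (Polynomial.eval ((coinvMk W X).toRingHom (lin ℓ))) hFq
    rw [Polynomial.eval_map, Polynomial.eval₂_at_apply, hFs, map_zero, Polynomial.eval_pow,
      Polynomial.eval_X] at this
    exact this.symm
  | mul a b ha hb =>
    have : a * b - algebraMap ℂ (Coord V) (evalAt 0 (a * b)) =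
        (a - algebraMap ℂ (Coord V) (evalAt 0 a)) * b +
          algebraMap ℂ (Coord V) (evalAt 0 a) * (b - algebraMap ℂ (Coord V) (evalAt 0 b)) := by
      rw [map_mul, map_mul]; ring
    rw [this, map_add, map_mul, map_mul]
    exact (Commute.all _ _).isNilpotent_add ((Commute.all _ _).isNilpotent_mul_right ha)
      ((Commute.all _ _).isNilpotent_mul_left hb)
  | add a b ha hb =>
    have : a + b - algebraMap ℂ (Coord V) (evalAt 0 (a + b)) =
        (a - algebraMap ℂ (Coord V) (evalAt 0 a)) +
          (b - algebraMap ℂ (Coord V) (evalAt 0 b)) := by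
      rw [map_add, map_add]; ring
    rw [this, map_add]
    exact (Commute.all _ _).isNilpotent_add ha hb

theorem isUnit_coinv {c : Coinv W X} (h : coinvPoint W X c ≠ 0) : IsUnit c := by
  have h1 := isNilpotent_coinv c
  have h2 : IsUnit (algebraMap ℂ (Coinv W X) (coinvPoint W X c)) := (IsUnit.mk0 _ h).map _
  have := h1.isUnit_add_right_of_commute h2 (Commute.all _ _)
  rwa [sub_add_cancel] at this

variable [Module.Finite ℂ V]

instance finite_coinv : Module.Finite ℂ (Coinv W X) := by
  have : Algebra.IsIntegral ℂ (Coinv W X) := ⟨fun c => by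
    obtain ⟨n, hn⟩ := isNilpotent_coinv c
    have h1 : IsIntegral ℂ (c - algebraMap ℂ (Coinv W X) (coinvPoint W X c)) :=
      IsIntegral.of_pow (n := n + 1) n.succ_pos (by rw [pow_succ, hn, zero_mul]; exact isIntegral_zero)
    have := h1.add (isIntegral_algebraMap (R := ℂ) (x := coinvPoint W X c))
    rwa [sub_add_cancel] at this⟩
  have : Algebra.FiniteType ℂ (Coinv W X) :=
    Algebra.FiniteType.of_surjective (coinvMk W X) (coinvMk_surjective W X)
  exact Algebra.IsIntegral.finite

end Coinvariants

/-! ### The component of a point of a cameral cover -/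

section Component

variable {V : Type} [AddCommGroup V] [Module ℂ V] {W : Subgroup (V ≃ₗ[ℂ] V)}
variable {R : Type} [CommRing R] [Algebra ℂ R] [MulSemiringAction W R]
variable {φ : Coord V →ₐ[ℂ] R} {σ : R →ₐ[ℂ] ℂ} {v : V}

theorem IsFibre.mem_pointStab_iff (hφ : IsFibre (W := W) φ) (hv : σ.comp φ = evalAt v) {w : W} :
    w ∈ pointStab σ ↔ (w : V ≃ₗ[ℂ] V) v = v := by
  have hv' : ∀ p, σ (φ p) = evalAt v p := fun p => DFunLike.congr_fun hv p
  constructor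
  · intro hw
    have h1 : ∀ ℓ : Module.Dual ℂ V, ℓ ((w : V ≃ₗ[ℂ] V) v - v) = 0 := by
      intro ℓ
      have hw' := (pointStab σ).inv_mem hw (φ (lin ℓ))
      rw [← hφ.map_smul, hv', hv', evalAt_smul] at hw'
      rw [map_sub, sub_eq_zero, ← evalAt_lin, ← evalAt_lin v, ← hw', Subgroup.coe_inv, inv_inv]
      rfl
    exact sub_eq_zero.1 ((Module.forall_dual_apply_eq_zero_iff ℂ _).1 h1)
  · intro hw r
    obtain ⟨p, rfl⟩ := hφ.surj r
    rw [← hφ.map_smul, hv', hv', evalAt_smul]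
    congr 2
    rw [inv_smul_eq_iff]
    exact hw.symm

/-- Averaging a lift over `W` gives an invariant lift, and `φ` is scalar on invariants. -/
theorem IsFibre.exists_scalar [Finite W] (hφ : IsFibre (W := W) φ) {r : R}
    (hr : ∀ w : W, w • r = r) : ∃ c : ℂ, r = algebraMap ℂ R c := by
  have := Fintype.ofFinite W
  obtain ⟨p, rfl⟩ := hφ.surj r
  obtain ⟨c, hc⟩ := hφ.map_invariant _ (sum_smul_mem_invariants W p)
  rw [map_sum] at hc
  simp only [hφ.map_smul, hr, Finset.sum_const, Finset.card_univ] at hc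
  refine ⟨(Fintype.card W : ℂ)⁻¹ * c, ?_⟩
  rw [map_mul, ← hc, ← Nat.cast_smul_eq_nsmul ℂ, ← Algebra.smul_def, smul_smul,
    inv_mul_cancel₀ (by exact_mod_cast Fintype.card_ne_zero), one_smul]

theorem IsFibre.finite [Finite W] [Module.Finite ℂ V] (hφ : IsFibre (W := W) φ) :
    Module.Finite ℂ R := by
  have : Algebra.IsInvariant ℂ R W := ⟨fun r hr => by
    obtain ⟨c, hc⟩ := hφ.exists_scalar hr
    exact ⟨c, hc.symm⟩⟩
  have : Algebra.IsIntegral ℂ R := Algebra.IsInvariant.isIntegral ℂ R W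
  have : Algebra.FiniteType ℂ R := Algebra.FiniteType.of_surjective φ hφ.surj
  exact Algebra.IsIntegral.finite

variable [SMulCommClass W ℂ R]

/-- The idempotent of the component of `σ`. -/
theorem IsFibre.exists_idempotent [Finite W] [Module.Finite ℂ V] (hφ : IsFibre (W := W) φ) :
    ∃ e : R, e * e = e ∧ σ e = 1 ∧ (∀ w : W, w ∉ pointStab σ → (w • e) * e = 0) ∧
      (∀ w : W, w ∉ pointStab σ → σ (w • e) = 0) := by
  have := hφ.finite
  have : IsArtinianRing R := IsArtinianRing.of_finite ℂ R
  let p : PrimeSpectrum R := ⟨RingHom.ker σ, RingHom.ker_isPrime σ⟩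
  obtain ⟨e, he, hep⟩ := PrimeSpectrum.exists_idempotent_basicOpen_eq_of_isClopen
    (isClopen_discrete ({p} : Set (PrimeSpectrum R)))
  have hmem : ∀ q : PrimeSpectrum R, e ∉ q.asIdeal ↔ q = p := fun q => by
    rw [← Set.mem_singleton_iff, hep]; rfl
  have hσe : σ e = 1 := by
    have h1 : σ e ≠ 0 := (hmem p).2 rfl
    have h2 : σ e * σ e = σ e := by rw [← map_mul, he]
    exact mul_right_cancel₀ h1 (by rw [h2, one_mul])
  -- The two idempotents are supported at different points, so their product lies in every prime;
  -- being idempotent and nilpotent, it is zero.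
  have hmul : ∀ w : W, w ∉ pointStab σ → (w • e) * e = 0 := by
    intro w hw
    have hidem : IsIdempotentElem ((w • e) * e) := by
      refine IsIdempotentElem.mul ?_ he
      rw [IsIdempotentElem, ← smul_mul', he]
    have hnil : IsNilpotent ((w • e) * e) := by
      rw [← mem_nilradical, nilradical_eq_sInf, Ideal.mem_sInf]
      intro P hP
      have hP' : P.IsPrime := hP
      by_contra hcon
      have h1 : e ∉ P := fun h => hcon (P.mul_mem_left _ h)
      have h2 : w • e ∉ P := fun h => hcon (P.mul_mem_right _ h)
      have hPp : P = RingHom.ker σ := congrArg PrimeSpectrum.asIdeal ((hmem ⟨P, hP⟩).1 h1)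
      rw [hPp] at h2
      let σ' : R →ₐ[ℂ] ℂ := σ.comp (actAlgHom W R w)
      have h3 : (⟨RingHom.ker σ', RingHom.ker_isPrime σ'⟩ : PrimeSpectrum R) = p :=
        (hmem _).1 h2
      have h4 : RingHom.ker σ' = RingHom.ker σ := congrArg PrimeSpectrum.asIdeal h3
      refine hw fun r => ?_
      have h5 : r - algebraMap ℂ R (σ r) ∈ RingHom.ker σ := by
        rw [RingHom.mem_ker, map_sub, AlgHom.commutes]; exact sub_self _
      rw [← h4, RingHom.mem_ker, map_sub, AlgHom.commutes, sub_eq_zero] at h5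
      exact h5
    obtain ⟨n, hn⟩ := hnil
    rw [← hidem.pow_succ_eq n, pow_succ, hn, zero_mul]
  refine ⟨e, he, hσe, hmul, fun w hw => ?_⟩
  have := congrArg σ (hmul w hw)
  rwa [map_mul, hσe, mul_one, map_zero] at this

variable {X : Submodule ℂ V}

/-- The identification of the component of `σ` in `Spec R` with `Co(W_X, V)`, together with the
resulting decomposition of `R`. -/
structure ComponentModel (X : Submodule ℂ V) (σ : R →ₐ[ℂ] ℂ) where
  /-- Restriction of functions to the component of `σ`. -/
  res : R →ₐ[ℂ] Coinv W X
  /-- Extension of functions by zero. -/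
  ext : Coinv W X →ₗ[ℂ] R
  res_ext : ∀ c, res (ext c) = c
  point_res : ∀ r, coinvPoint W X (res r) = σ r
  res_smul : ∀ (h : pointwiseStab W X) r, res ((h : W) • r) = coinvAct (toStab h) (res r)
  res_smul_ext : ∀ w : W, w ∉ pointwiseStab W X → ∀ c, res (w • ext c) = 0
  ext_res : ∀ r, ext (res r) = ext 1 * r
  sum_ext_res : ∀ [Fintype W] (r : R), ∑ w : W, w • ext (res (w⁻¹ • r)) =
    (Nat.card (pointwiseStab W X) : ℂ) • r

/-- Translation by `v` gives a surjection from `R` to the coinvariants of `W_X`. What needs proof is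
that its kernel dies on the component of `σ`, that is, that `W_X`-invariant polynomials are constant
there although only `W`-invariants are known to be constant on the fibre. Averaging over `W` after
multiplication by the idempotent `e` bridges the gap. -/
theorem IsFibre.exists_componentModel [Finite W] [Module.Finite ℂ V] (hφ : IsFibre (W := W) φ)
    (hσ : pointStab σ = pointwiseStab W X) (hv : σ.comp φ = evalAt v) :
    Nonempty (ComponentModel (W := W) X σ) := by
  classical
  obtain ⟨e, hee, hσe, hwe, hσwe⟩ := hφ.exists_idempotent (σ := σ)
  rw [hσ] at hwe hσwe
  have hv' : ∀ p, σ (φ p) = evalAt v p := fun p => DFunLike.congr_fun hv p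
  have hfix : ∀ h ∈ pointwiseStab W X, (h : V ≃ₗ[ℂ] V) • v = v := fun h hh =>
    (hφ.mem_pointStab_iff hv).1 (hσ ▸ hh)
  -- translation induces a map on the fibre
  have htr : ∀ p, (∀ h ∈ pointwiseStab W X, ((h : W) : V ≃ₗ[ℂ] V) • p = p) → evalAt v p = 0 →
      translate v p ∈ coinvariantIdeal (pointwiseStab W X) := fun p hp hp0 =>
    mem_coinvariantIdeal (fun h hh => by rw [← translate_smul _ _ (hfix h hh), hp h hh])
      (by rw [evalAt_zero_translate, hp0])
  have hker : ∀ p ∈ RingHom.ker φ, translate v p ∈ coinvariantIdeal (pointwiseStab W X) := by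
    have : RingHom.ker φ ≤ (coinvariantIdeal (pointwiseStab W X)).comap (translate v) := by
      refine hφ.ker_le.trans (Ideal.span_le.2 fun p hp => ?_)
      refine htr p (fun h _ => mem_invariants.1 hp.1 _ h.2) ?_
      rw [← hv', hp.2, map_zero]
    exact this
  obtain ⟨θ, hθ⟩ : ∃ θ : R →ₐ[ℂ] Coinv W X, ∀ p, θ (φ p) = coinvMk W X (translate v p) := by
    refine ⟨(Ideal.Quotient.liftₐ (RingHom.ker φ) ((coinvMk W X).comp (translate v))
      fun p hp => coinvMk_eq_zero.2 (hker p hp)).comp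
      (Ideal.quotientKerAlgEquivOfSurjective hφ.surj).symm, fun p => ?_⟩
    have : (Ideal.quotientKerAlgEquivOfSurjective hφ.surj).symm (φ p) =
        Ideal.Quotient.mk _ p := by
      rw [AlgEquiv.symm_apply_eq]; rfl
    let q := Ideal.Quotient.liftₐ (RingHom.ker φ)
      ((coinvMk W X).comp (translate v))
      fun p hp => coinvMk_eq_zero.2 (hker p hp)
    exact congrArg q this
  have hθsurj : Function.Surjective θ := by
    intro c
    obtain ⟨p, rfl⟩ := coinvMk_surjective W X c
    exact ⟨φ (translate (-v) p), by rw [hθ, translate_translate_neg]⟩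
  have hpt : ∀ r, coinvPoint W X (θ r) = σ r := by
    intro r
    obtain ⟨p, rfl⟩ := hφ.surj r
    rw [hθ, coinvPoint_mk, evalAt_zero_translate, hv']
  have hθe : θ e = 1 := by
    have h1 : IsUnit (θ e) := isUnit_coinv (by rw [hpt, hσe]; exact one_ne_zero)
    exact h1.mul_right_cancel (by rw [← map_mul, hee, one_mul])
  -- sums of translates of the idempotent
  have hsum : ∀ [Fintype W] , ∑ w : W, w • e = (Nat.card (pointwiseStab W X) : R) := by
    intro _
    obtain ⟨c, hc⟩ := hφ.exists_scalar (r := ∑ w : W, w • e) (fun w => by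
      rw [Finset.smul_sum]
      simp only [smul_smul]
      exact Fintype.sum_equiv (Equiv.mulLeft w) _ _ fun g => rfl)
    have h1 := congrArg σ hc
    have h2 : ∀ w : W, σ (w • e) = if w ∈ pointwiseStab W X then 1 else 0 := fun w => by
      split_ifs with hw
      · rw [← hσ] at hw; rw [hw, hσe]
      · exact hσwe w hw
    rw [map_sum, AlgHom.commutes] at h1
    simp only [h2, Finset.sum_boole] at h1
    rw [hc, ← Fintype.card_subtype, ← Nat.card_eq_fintype_card] at *
    change ((Nat.card (pointwiseStab W X) : ℕ) : ℂ) = c at h1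
    rw [← h1, map_natCast]
  -- functions vanishing on the component
  have hinv : ∀ p : Coord V, (∀ h ∈ pointwiseStab W X, ((h : W) : V ≃ₗ[ℂ] V) • p = p) →
      evalAt v p = 0 → e * φ p = 0 := by
    intro p hp hp0
    have := Fintype.ofFinite W
    have hph : ∀ h ∈ pointwiseStab W X, h • φ p = φ p := fun h hh => by
      rw [← hφ.map_smul, hp h hh]
    obtain ⟨c, hc⟩ := hφ.exists_scalar (r := ∑ w : W, w • (e * φ p)) (fun w => by
      rw [Finset.smul_sum]
      simp only [smul_smul]
      exact Fintype.sum_equiv (Equiv.mulLeft w) _ _ fun g => rfl)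
    -- Multiplication by `e` kills the terms with `w ∉ W_X`, and on the others `φ p` is fixed. As
    -- the orbit sum is a scalar `c`, this reads `c e = |W_X| e φ(p)`, and evaluation at `σ` gives
    -- `c = 0`.
    have h1 : e * ∑ w : W, w • (e * φ p) = e * φ p * ∑ w : W, w • e := by
      rw [Finset.mul_sum, Finset.mul_sum]
      refine Finset.sum_congr rfl fun w _ => ?_
      rw [smul_mul']
      by_cases hw : w ∈ pointwiseStab W X
      · rw [hph w hw]; ring
      · rw [← mul_assoc, mul_comm e, hwe w hw, zero_mul, mul_assoc, mul_comm (φ p), ← mul_assoc,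
          mul_comm e, hwe w hw, zero_mul]
    rw [hc, hsum] at h1
    have hne : (Nat.card (pointwiseStab W X) : ℂ) ≠ 0 := by exact_mod_cast Nat.card_pos.ne'
    have hc0 : c = 0 := by
      have h2 := congrArg σ h1
      simp only [map_mul, hσe, hv', hp0, AlgHom.commutes, mul_zero, zero_mul, one_mul] at h2
      exact h2
    rw [hc0, map_zero, mul_zero] at h1
    have h3 : e * φ p = algebraMap ℂ R ((Nat.card (pointwiseStab W X) : ℂ)⁻¹ *
        (Nat.card (pointwiseStab W X) : ℂ)) * (e * φ p) := by
      rw [inv_mul_cancel₀ hne, map_one, one_mul]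
    rw [h3, map_mul, map_natCast, mul_assoc, mul_comm _ (e * φ p), ← h1, mul_zero]
  have hθker : ∀ r, θ r = 0 → e * r = 0 := by
    intro r hr
    obtain ⟨p, rfl⟩ := hφ.surj r
    rw [hθ, coinvMk_eq_zero] at hr
    have h1 : coinvariantIdeal (pointwiseStab W X) ≤
        Ideal.comap (φ.comp (translate (-v))) (LinearMap.ker (LinearMap.mulLeft R e)) := by
      refine coinvariantIdeal_le fun q hq hq0 => ?_
      change e * φ (translate (-v) q) = 0
      have hfix' : ∀ h ∈ pointwiseStab W X, (h : V ≃ₗ[ℂ] V) • (-v) = -v := fun h hh => by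
        rw [smul_neg, hfix h hh]
      refine hinv _ (fun h hh => by rw [← translate_smul _ _ (hfix' h hh), hq h hh]) ?_
      rw [← evalAt_zero_translate, translate_translate_neg, hq0]
    have h2 := h1 hr
    have h3 : translate (-v) (translate v p) = p := by
      have := translate_translate_neg (-v) p
      rwa [neg_neg] at this
    change e * φ (translate (-v) (translate v p)) = 0 at h2
    rwa [h3] at h2
  -- Any linear section will do, since `e` annihilates the kernel of `θ`.
  obtain ⟨κ, hκ⟩ := LinearMap.exists_rightInverse_of_surjective θ.toLinearMap
    (LinearMap.range_eq_top.2 hθsurj)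
  have hκ' : ∀ c, θ (κ c) = c := fun c => LinearMap.congr_fun hκ c
  let ι : Coinv W X →ₗ[ℂ] R := LinearMap.mulLeft ℂ e ∘ₗ κ
  have hι : ∀ c, ι c = e * κ c := fun c => rfl
  have hιθ : ∀ r, ι (θ r) = e * r := by
    intro r
    rw [hι, ← sub_eq_zero, ← mul_sub]
    exact hθker _ (by rw [map_sub, hκ', sub_self])
  have hι1 : ι 1 = e := by rw [← map_one θ, hιθ, mul_one]
  refine ⟨{ res := θ, ext := ι, point_res := hpt, res_ext := ?_, res_smul := ?_,
            res_smul_ext := ?_, ext_res := ?_, sum_ext_res := ?_ }⟩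
  · intro c
    rw [hι, map_mul, hθe, one_mul, hκ']
  · intro h r
    obtain ⟨p, rfl⟩ := hφ.surj r
    rw [← hφ.map_smul, hθ, hθ, translate_smul _ _ (hfix h h.2)]
    rfl
  · intro w hw c
    have h1 : θ (w • e) = 0 := by
      have := congrArg θ (hwe w hw)
      rwa [map_mul, hθe, mul_one, map_zero] at this
    rw [hι, smul_mul', map_mul, h1, zero_mul]
  · intro r
    rw [hιθ, hι1]
  · intro _ r
    simp only [hιθ, smul_mul', smul_inv_smul]
    rw [← Finset.sum_mul, hsum, Algebra.smul_def, map_natCast]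

/-- The ring of coinvariants is local, so restriction to the component is localization at `σ`. -/
theorem ComponentModel.res_eq_zero_iff [Finite W] (M : ComponentModel (W := W) X σ) (r : R) :
    M.res r = 0 ↔ ∃ s, σ s ≠ 0 ∧ s * r = 0 := by
  constructor
  · intro h
    refine ⟨M.ext 1, ?_, by rw [← M.ext_res, h, map_zero]⟩
    rw [← M.point_res, M.res_ext, map_one]
    exact one_ne_zero
  · rintro ⟨s, hs, hsr⟩
    have h1 : IsUnit (M.res s) := isUnit_coinv (by rwa [M.point_res])
    have h2 := congrArg M.res hsr
    rw [map_mul, map_zero] at h2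
    exact h1.mul_right_eq_zero.1 h2

end Component

/-! ### Equivariant maps after base change -/

section BaseChange

variable (A : CommAlgCat.{0} ℂ)

/-- Base change of a homomorphism of algebras. -/
def bc {P Q : Type} [CommRing P] [Algebra ℂ P] [CommRing Q] [Algebra ℂ Q] (f : P →ₐ[ℂ] Q) :
    A ⊗[ℂ] P →ₐ[A] A ⊗[ℂ] Q :=
  Algebra.TensorProduct.map (AlgHom.id A A) f

section

variable {P Q S : Type} [CommRing P] [Algebra ℂ P] [CommRing Q] [Algebra ℂ Q]
  [CommRing S] [Algebra ℂ S]

@[simp] theorem bc_tmul (f : P →ₐ[ℂ] Q) (a : A) (p : P) : bc A f (a ⊗ₜ p) = a ⊗ₜ f p := rfl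

theorem bc_congr {f g : P →ₐ[ℂ] Q} (h : ∀ p, f p = g p) (x : A ⊗[ℂ] P) :
    bc A f x = bc A g x := by
  rw [AlgHom.ext h]

theorem bc_comp (f : P →ₐ[ℂ] Q) (g : Q →ₐ[ℂ] S) (x : A ⊗[ℂ] P) :
    bc A g (bc A f x) = bc A (g.comp f) x := by
  induction x with
  | zero => simp
  | add x y hx hy => simp only [map_add, hx, hy]
  | tmul a p => rfl

theorem bc_id (x : A ⊗[ℂ] P) : bc A (AlgHom.id ℂ P) x = x := by
  induction x with
  | zero => simp
  | add x y hx hy => simp only [map_add, hx, hy]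
  | tmul a p => rfl

theorem bc_baseMap {A B : CommAlgCat.{0} ℂ} (f : A ⟶ B) (g : P →ₐ[ℂ] Q) (x : A ⊗[ℂ] P) :
    bc B g (baseMap P f x) = baseMap Q f (bc A g x) := by
  induction x with
  | zero => simp
  | add x y hx hy => simp only [map_add, hx, hy]
  | tmul a p => rfl

theorem algHom_tensor_ext {B : Type} [CommRing B] [Algebra A B] {F G : A ⊗[ℂ] P →ₐ[A] B}
    (h : ∀ p : P, F (1 ⊗ₜ p) = G (1 ⊗ₜ p)) : F = G := by
  refine AlgHom.ext fun x => ?_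
  induction x with
  | zero => simp
  | add x y hx hy => simp only [map_add, hx, hy]
  | tmul a p =>
    have : a ⊗ₜ[ℂ] p = a • ((1 : A) ⊗ₜ[ℂ] p) := by simp [TensorProduct.smul_tmul']
    rw [this, map_smul, map_smul, h]

end

variable {V : Type} [AddCommGroup V] [Module ℂ V] {W : Subgroup (V ≃ₗ[ℂ] V)} {X : Submodule ℂ V}
variable {R : Type} [CommRing R] [Algebra ℂ R] [MulSemiringAction W R] [SMulCommClass W ℂ R]
variable {σ : R →ₐ[ℂ] ℂ}

/-- The action of `w` on `A ⊗ R`. -/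
abbrev actA (w : W) : A ⊗[ℂ] R →ₐ[A] A ⊗[ℂ] R := bc A (actAlgHom W R w)

theorem actA_mul (w w' : W) (x : A ⊗[ℂ] R) : actA A (w * w') x = actA A w (actA A w' x) := by
  rw [bc_comp]
  exact bc_congr A (fun r => mul_smul w w' r) x

theorem actA_one (x : A ⊗[ℂ] R) : actA A (1 : W) x = x := by
  conv_rhs => rw [← bc_id A x]
  exact bc_congr A (fun r => one_smul W r) x

theorem actA_inv_actA (w : W) (x : A ⊗[ℂ] R) : actA A w⁻¹ (actA A w x) = x := by
  rw [← actA_mul, inv_mul_cancel, actA_one]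

theorem actA_actA_inv (w : W) (x : A ⊗[ℂ] R) : actA A w (actA A w⁻¹ x) = x := by
  rw [← actA_mul, mul_inv_cancel, actA_one]

/-- The action of `n ∈ stab(X)` on `A ⊗ C`. -/
abbrev coinvA (n : setStab W X) : A ⊗[ℂ] Coinv W X →ₐ[A] A ⊗[ℂ] Coinv W X := bc A (coinvAct n)

theorem coinvA_mul (n m : setStab W X) (x : A ⊗[ℂ] Coinv W X) :
    coinvA A (n * m) x = coinvA A n (coinvA A m x) := by
  rw [bc_comp, coinvA, map_mul]
  rfl

theorem coinvA_one (x : A ⊗[ℂ] Coinv W X) : coinvA A (1 : setStab W X) x = x := by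
  rw [coinvA, map_one]
  exact bc_id A x

/-- The homomorphism `A ⊗ P → A` attached to a point. -/
def pointA {P : Type} [CommRing P] [Algebra ℂ P] (τ : P →ₐ[ℂ] ℂ) : A ⊗[ℂ] P →ₐ[A] A :=
  Algebra.TensorProduct.lift (AlgHom.id A A) ((Algebra.ofId ℂ A).comp τ) fun _ _ => Commute.all _ _

@[simp] theorem pointA_tmul {P : Type} [CommRing P] [Algebra ℂ P] (τ : P →ₐ[ℂ] ℂ) (a : A) (p : P) :
    pointA A τ (a ⊗ₜ p) = a * algebraMap ℂ A (τ p) := by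
  simp [pointA, Algebra.ofId_apply]

theorem pointMap_eq (x : A ⊗[ℂ] R) : pointMap σ A x = pointA A σ x := by
  induction x with
  | zero => simp
  | add x y hx hy => simp only [map_add, hx, hy]
  | tmul a r => simp [pointMap]

theorem pointA_bc {P Q : Type} [CommRing P] [Algebra ℂ P] [CommRing Q] [Algebra ℂ Q]
    (f : P →ₐ[ℂ] Q) (τ : Q →ₐ[ℂ] ℂ) (x : A ⊗[ℂ] P) :
    pointA A τ (bc A f x) = pointA A (τ.comp f) x := by
  induction x with
  | zero => simp
  | add x y hx hy => simp only [map_add, hx, hy]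
  | tmul a r => simp

namespace ComponentModel

variable (M : ComponentModel (W := W) X σ)

/-- Restriction to the component of `σ`, after base change. -/
abbrev resA : A ⊗[ℂ] R →ₐ[A] A ⊗[ℂ] Coinv W X := bc A M.res

/-- Extension by zero from the component of `σ`, after base change. -/
abbrev extA : A ⊗[ℂ] Coinv W X →ₗ[A] A ⊗[ℂ] R := M.ext.baseChange A

theorem resA_extA (y : A ⊗[ℂ] Coinv W X) : M.resA A (M.extA A y) = y := by
  induction y with
  | zero => simp
  | add x y hx hy => simp only [map_add, hx, hy]
  | tmul a c => simp [M.res_ext]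

theorem extA_resA (x : A ⊗[ℂ] R) : M.extA A (M.resA A x) = (1 ⊗ₜ M.ext 1) * x := by
  induction x with
  | zero => simp
  | add x y hx hy => simp only [map_add, hx, hy, mul_add]
  | tmul a r => simp [M.ext_res]

theorem pointA_resA (x : A ⊗[ℂ] R) : pointA A (coinvPoint W X) (M.resA A x) = pointA A σ x := by
  rw [pointA_bc]
  congr 2
  exact AlgHom.ext M.point_res

theorem resA_actA (h : pointwiseStab W X) (x : A ⊗[ℂ] R) :
    M.resA A (actA A (h : W) x) = coinvA A (toStab h) (M.resA A x) := by
  rw [bc_comp, bc_comp]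
  exact bc_congr A (fun r => M.res_smul h r) x

theorem resA_actA_extA {w : W} (hw : w ∉ pointwiseStab W X) (y : A ⊗[ℂ] Coinv W X) :
    M.resA A (actA A w (M.extA A y)) = 0 := by
  induction y with
  | zero => simp
  | add x y hx hy => simp only [map_add, hx, hy, add_zero]
  | tmul a c =>
    have := M.res_smul_ext w hw c
    change a ⊗ₜ M.res (w • M.ext c) = 0
    rw [this, tmul_zero]

theorem sum_extA_resA [Fintype W] (x : A ⊗[ℂ] R) :
    ∑ w : W, actA A w (M.extA A (M.resA A (actA A w⁻¹ x))) =
      (Nat.card (pointwiseStab W X) : ℂ) • x := by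
  induction x with
  | zero => simp
  | add x y hx hy => simp only [map_add, Finset.sum_add_distrib, hx, hy, smul_add]
  | tmul a r =>
    rw [← TensorProduct.tmul_smul, ← M.sum_ext_res, TensorProduct.tmul_sum]
    rfl

variable [Finite W]

/-- The translates of the component of `σ` cover the whole of `Spec R`, so restrictions of
translates determine a function. -/
theorem ext_of_resA {x y : A ⊗[ℂ] R} (h : ∀ w : W, M.resA A (actA A w x) = M.resA A (actA A w y)) :
    x = y := by
  have := Fintype.ofFinite W
  have hne : (Nat.card (pointwiseStab W X) : ℂ) ≠ 0 := by exact_mod_cast Nat.card_pos.ne'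
  refine (smul_right_injective _ hne) ?_
  simp only
  rw [← M.sum_extA_resA, ← M.sum_extA_resA]
  exact Finset.sum_congr rfl fun w _ => by rw [h]

/-- The `W`-equivariant endomorphism of `A ⊗ R` induced by a `W_X`-equivariant map to `A ⊗ C`. -/
def ind (ψ : A ⊗[ℂ] R →ₗ[A] A ⊗[ℂ] Coinv W X) : A ⊗[ℂ] R →ₗ[A] A ⊗[ℂ] R :=
  algebraMap ℂ A (Nat.card (pointwiseStab W X) : ℂ)⁻¹ • letI := Fintype.ofFinite W; ∑ w : W,
    (actA A w).toLinearMap ∘ₗ M.extA A ∘ₗ ψ ∘ₗ (actA A w⁻¹).toLinearMap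

theorem ind_apply [Fintype W] (ψ : A ⊗[ℂ] R →ₗ[A] A ⊗[ℂ] Coinv W X) (x : A ⊗[ℂ] R) :
    M.ind A ψ x = algebraMap ℂ A (Nat.card (pointwiseStab W X) : ℂ)⁻¹ •
      ∑ w : W, actA A w (M.extA A (ψ (actA A w⁻¹ x))) := by
  rw [ind, LinearMap.smul_apply, LinearMap.sum_apply]
  congr 1
  exact Finset.sum_congr (by ext; simp) fun _ _ => rfl

theorem ind_actA (ψ : A ⊗[ℂ] R →ₗ[A] A ⊗[ℂ] Coinv W X) (w : W) (x : A ⊗[ℂ] R) :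
    M.ind A ψ (actA A w x) = actA A w (M.ind A ψ x) := by
  have := Fintype.ofFinite W
  rw [ind_apply, ind_apply, map_smul, map_sum]
  congr 1
  refine (Fintype.sum_equiv (Equiv.mulLeft w) _ _ fun u => ?_).symm
  rw [Equiv.coe_mulLeft, actA_mul, mul_inv_rev, actA_mul, actA_inv_actA]

/-- Equivariance under `W_X` of a map to `A ⊗ C`. -/
def Equivariant (ψ : A ⊗[ℂ] R → A ⊗[ℂ] Coinv W X) : Prop :=
  ∀ (h : pointwiseStab W X) x, ψ (actA A (h : W) x) = coinvA A (toStab h) (ψ x)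

/-- Frobenius reciprocity. The terms with `w ∉ W_X` are supported on other components; the remaining
`|W_X|` terms all equal `ψ x` by equivariance, whence the normalization of `ind`. -/
theorem resA_ind {ψ : A ⊗[ℂ] R →ₗ[A] A ⊗[ℂ] Coinv W X} (hψ : Equivariant A ψ) (x : A ⊗[ℂ] R) :
    M.resA A (M.ind A ψ x) = ψ x := by
  classical
  have := Fintype.ofFinite W
  have hne : (Nat.card (pointwiseStab W X) : ℂ) ≠ 0 := by exact_mod_cast Nat.card_pos.ne'
  have h1 : ∀ w : W, M.resA A (actA A w (M.extA A (ψ (actA A w⁻¹ x)))) =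
      if w ∈ pointwiseStab W X then ψ x else 0 := by
    intro w
    split_ifs with hw
    · have h2 := M.resA_actA A ⟨w, hw⟩ (M.extA A (ψ (actA A w⁻¹ x)))
      rw [resA_extA, ← hψ] at h2
      simp only [actA_actA_inv] at h2
      exact h2
    · exact M.resA_actA_extA A hw _
  rw [ind_apply, map_smul, map_sum]
  simp only [h1]
  rw [Finset.sum_ite, Finset.sum_const_zero, add_zero, Finset.sum_const, ← Fintype.card_subtype,
    ← Nat.card_eq_fintype_card, ← Nat.cast_smul_eq_nsmul A, smul_smul,
    ← map_natCast (algebraMap ℂ A), ← map_mul]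
  change algebraMap ℂ A (_ * (Nat.card (pointwiseStab W X) : ℂ)) • _ = _
  rw [inv_mul_cancel₀ hne, map_one, one_smul]

theorem resA_actA_ind {ψ : A ⊗[ℂ] R →ₗ[A] A ⊗[ℂ] Coinv W X} (hψ : Equivariant A ψ) (w : W)
    (x : A ⊗[ℂ] R) : M.resA A (actA A w (M.ind A ψ x)) = ψ (actA A w x) := by
  rw [← ind_actA, M.resA_ind A hψ]

/-- `ind` for homomorphisms of algebras. -/
def indAlg (ψ : A ⊗[ℂ] R →ₐ[A] A ⊗[ℂ] Coinv W X) (hψ : Equivariant A ψ) :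
    A ⊗[ℂ] R →ₐ[A] A ⊗[ℂ] R :=
  AlgHom.ofLinearMap (M.ind A ψ.toLinearMap)
    (M.ext_of_resA A fun w => by
      rw [M.resA_actA_ind A (ψ := ψ.toLinearMap) hψ, map_one (actA A w), map_one (M.resA A)]
      exact map_one ψ)
    (fun x y => M.ext_of_resA A fun w => by
      rw [M.resA_actA_ind A (ψ := ψ.toLinearMap) hψ, map_mul (actA A w), map_mul (actA A w),
        map_mul (M.resA A), M.resA_actA_ind A (ψ := ψ.toLinearMap) hψ,
        M.resA_actA_ind A (ψ := ψ.toLinearMap) hψ]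
      exact map_mul ψ _ _)

theorem indAlg_actA (ψ : A ⊗[ℂ] R →ₐ[A] A ⊗[ℂ] Coinv W X) (hψ : Equivariant A ψ) (w : W)
    (x : A ⊗[ℂ] R) : M.indAlg A ψ hψ (actA A w x) = actA A w (M.indAlg A ψ hψ x) :=
  M.ind_actA A ψ.toLinearMap w x

theorem resA_indAlg (ψ : A ⊗[ℂ] R →ₐ[A] A ⊗[ℂ] Coinv W X) (hψ : Equivariant A ψ)
    (x : A ⊗[ℂ] R) : M.resA A (M.indAlg A ψ hψ x) = ψ x :=
  M.resA_ind A (ψ := ψ.toLinearMap) hψ x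

theorem eq_of_resA_comp {G G' : A ⊗[ℂ] R → A ⊗[ℂ] R} (hG : ∀ (w : W) x, G (actA A w x) = actA A w (G x))
    (hG' : ∀ (w : W) x, G' (actA A w x) = actA A w (G' x))
    (h : ∀ x, M.resA A (G x) = M.resA A (G' x)) : G = G' :=
  funext fun x => M.ext_of_resA A fun w => by rw [← hG, ← hG', h]

end ComponentModel

/-! ### Points of the automorphism group functor -/

/-- An automorphism of the cover from a pair of inverse equivariant homomorphisms. -/
def autOfAlgHom (G G' : A ⊗[ℂ] R →ₐ[A] A ⊗[ℂ] R) (h : ∀ x, G (G' x) = x) (h' : ∀ x, G' (G x) = x)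
    (hG : ∀ (w : W) x, G (actA A w x) = actA A w (G x)) : (autCover W R).pts A :=
  ⟨⟨G.toLinearMap, G'.toLinearMap, LinearMap.ext h, LinearMap.ext h'⟩,
    map_one G, map_mul G, hG⟩

variable {A} in
/-- The algebra automorphism underlying a point of the automorphism group. -/
def autAlgHom (g : (autCover W R).pts A) : A ⊗[ℂ] R →ₐ[A] A ⊗[ℂ] R :=
  AlgHom.ofLinearMap g.1.1 g.2.1 g.2.2.1

theorem autAlgHom_actA (g : (autCover W R).pts A) (w : W) (x : A ⊗[ℂ] R) :
    autAlgHom g (actA A w x) = actA A w (autAlgHom g x) := g.2.2.2 w x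

theorem autAlgHom_mul (g h : (autCover W R).pts A) (x : A ⊗[ℂ] R) :
    autAlgHom (g * h) x = autAlgHom g (autAlgHom h x) := rfl

theorem autAlgHom_one (x : A ⊗[ℂ] R) : autAlgHom (1 : (autCover W R).pts A) x = x := rfl

theorem autCover_ext {g h : (autCover W R).pts A} (H : ∀ x, autAlgHom g x = autAlgHom h x) :
    g = h := Subtype.ext (Units.ext (LinearMap.ext H))

theorem mem_autPointed {g : (autCover W R).pts A} :
    g ∈ (autPointed W σ).pts A ↔ ∀ x, pointA A σ (autAlgHom g x) = pointA A σ x := by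
  simp only [← pointMap_eq]
  rfl

theorem autAlgHom_map {A B : CommAlgCat.{0} ℂ} (f : A ⟶ B) (g : (autCover W R).pts A)
    (x : A ⊗[ℂ] R) :
    autAlgHom ((autCover W R).toFunctor.map f g : (autCover W R).pts B) (baseMap R f x) =
      baseMap R f (autAlgHom g x) :=
  endMapFun_baseMap R f g.1.1 x

end BaseChange

/-! ### Translates of the base point under automorphisms -/

section Translates

variable {V : Type} [AddCommGroup V] [Module ℂ V] {W : Subgroup (V ≃ₗ[ℂ] V)} {X : Submodule ℂ V}

/-- `X` is an intersection of mirrors, and the corresponding reflections lie in `W_X`. So `X` is the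
full fixed space of `W_X`, which is where the hypothesis that `X` belongs to the intersection poset
enters. -/
theorem eq_fixed_of_mem_intersections (hX : X ∈ intersections (mirrors W)) {x : V}
    (hx : ∀ h ∈ pointwiseStab W X, ((h : W) : V ≃ₗ[ℂ] V) x = x) : x ∈ X := by
  obtain ⟨S, hS, rfl⟩ := hX
  rw [Submodule.mem_sInf]
  intro m hm
  obtain ⟨r, hr, -, rfl⟩ := hS hm
  exact hx ⟨r, hr⟩ (mem_pointwiseStab.2 fun y hy => (sInf_le hm : sInf S ≤ fixedLocus r) hy)

/-- An element normalizing `W_X` maps `X` into the fixed space of `W_X`, which is `X`; equality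
follows by dimension. -/
theorem mem_setStab_of_conj [Module.Finite ℂ V] (hX : X ∈ intersections (mirrors W)) {w : W}
    (hw : ∀ h ∈ pointwiseStab W X, w⁻¹ * h * w ∈ pointwiseStab W X) : w ∈ setStab W X := by
  have h1 : X.map ((w : V ≃ₗ[ℂ] V) : V →ₗ[ℂ] V) ≤ X := by
    rintro _ ⟨x, hx, rfl⟩
    refine eq_fixed_of_mem_intersections hX fun h hh => ?_
    have h2 := mem_pointwiseStab.1 (hw h hh) x hx
    have h3 := congrArg (w : V ≃ₗ[ℂ] V) h2
    simp only [Subgroup.coe_mul, LinearEquiv.mul_apply, Subgroup.coe_inv] at h3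
    have h4 : ∀ y, (w : V ≃ₗ[ℂ] V) ((w : V ≃ₗ[ℂ] V)⁻¹ y) = y :=
      fun y => (w : V ≃ₗ[ℂ] V).apply_symm_apply y
    rw [h4] at h3
    exact h3
  have h2 : X.map ((w : V ≃ₗ[ℂ] V) : V →ₗ[ℂ] V) = X :=
    Submodule.eq_of_le_of_finrank_eq h1 (LinearEquiv.finrank_map_eq _ _)
  rw [mem_setStab]
  have h3 := congrArg (fun Y : Submodule ℂ V => (Y : Set V)) h2
  simp only [Submodule.map_coe] at h3
  exact h3

variable (A : CommAlgCat.{0} ℂ)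

theorem sum_coinvA [Fintype (pointwiseStab W X)] (y : A ⊗[ℂ] Coinv W X) :
    ∑ h : pointwiseStab W X, coinvA A (toStab h) y =
      (Fintype.card (pointwiseStab W X) : A) • pointA A (coinvPoint W X) y •
        (1 : A ⊗[ℂ] Coinv W X) := by
  induction y with
  | zero => simp
  | add x y hx hy => simp only [map_add, Finset.sum_add_distrib, hx, hy, add_smul, smul_add]
  | tmul a c =>
    have : ∀ h : pointwiseStab W X, coinvA A (toStab h) (a ⊗ₜ[ℂ] c) =
        a ⊗ₜ[ℂ] coinvAct (toStab h) c := fun _ => rfl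
    simp only [this]
    rw [← TensorProduct.tmul_sum, sum_coinvAct, Algebra.algebraMap_eq_smul_one,
      TensorProduct.tmul_smul, pointA_tmul, Algebra.TensorProduct.one_def,
      TensorProduct.smul_tmul', TensorProduct.smul_tmul', TensorProduct.smul_tmul']
    congr 1
    rw [Algebra.smul_def, map_mul, map_natCast, smul_eq_mul, smul_eq_mul]
    ring

variable [Finite W]

theorem natCast_smul_cancel {E : Type} [AddCommGroup E] [Module A E] {n : ℕ} (hn : n ≠ 0) {x y : E}
    (h : (n : A) • x = (n : A) • y) : x = y := by
  have h1 : algebraMap ℂ A ((n : ℂ)⁻¹) * (n : A) = 1 := by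
    rw [← map_natCast (algebraMap ℂ A), ← map_mul,
      inv_mul_cancel₀ (by exact_mod_cast hn), map_one]
  rw [← one_smul A x, ← one_smul A y, ← h1, mul_smul, mul_smul, h]

theorem eq_smul_one_of_invariant {y : A ⊗[ℂ] Coinv W X}
    (hy : ∀ h : pointwiseStab W X, coinvA A (toStab h) y = y) :
    y = pointA A (coinvPoint W X) y • (1 : A ⊗[ℂ] Coinv W X) := by
  have := Fintype.ofFinite (pointwiseStab W X)
  have h1 := sum_coinvA A y
  simp only [hy, Finset.sum_const, Finset.card_univ] at h1
  rw [← Nat.cast_smul_eq_nsmul A] at h1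
  exact natCast_smul_cancel A Fintype.card_ne_zero h1

/-- An invariant functional does not see averaging over `W_X`, and the average of `y` is its value
at the origin. -/
theorem apply_eq_of_invariant {E : Type} [AddCommGroup E] [Module A E]
    (τ : A ⊗[ℂ] Coinv W X →ₗ[A] E)
    (hτ : ∀ (h : pointwiseStab W X) y, τ (coinvA A (toStab h) y) = τ y) (y : A ⊗[ℂ] Coinv W X) :
    τ y = pointA A (coinvPoint W X) y • τ 1 := by
  have := Fintype.ofFinite (pointwiseStab W X)
  have h1 := congrArg τ (sum_coinvA A y)
  simp only [map_sum, hτ, Finset.sum_const, Finset.card_univ, map_smul] at h1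
  rw [← Nat.cast_smul_eq_nsmul A] at h1
  exact natCast_smul_cancel A Fintype.card_ne_zero h1

variable {R : Type} [CommRing R] [Algebra ℂ R] [MulSemiringAction W R] [SMulCommClass W ℂ R]
variable {σ : R →ₐ[ℂ] ℂ}

namespace ComponentModel

variable (M : ComponentModel (W := W) X σ)

theorem ext_one_mul_smul {w : W} (hw : w ∉ pointwiseStab W X) :
    M.ext 1 * (w • M.ext 1) = 0 := by
  rw [← M.ext_res, M.res_smul_ext w hw, map_zero]

theorem smul_ext_one (h : pointwiseStab W X) : (h : W) • M.ext 1 = M.ext 1 := by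
  have h1 : ∀ h : pointwiseStab W X, M.ext 1 * ((h : W) • M.ext 1) = M.ext 1 := fun h => by
    rw [← M.ext_res, M.res_smul, M.res_ext, map_one]
  have h2 := congrArg ((h : W) • ·) (h1 h⁻¹)
  simp only [smul_mul', Subgroup.coe_inv, smul_inv_smul] at h2
  rw [← h2, mul_comm, h1]

theorem ext_coinvAct (h : pointwiseStab W X) (c : Coinv W X) :
    M.ext (coinvAct (toStab h) c) = (h : W) • M.ext c := by
  conv_lhs => rw [← M.res_ext c, ← M.res_smul, M.ext_res]
  conv_rhs => rw [← M.res_ext c, M.ext_res, smul_mul', M.smul_ext_one]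

theorem ext_mul_ext_one (c : Coinv W X) : M.ext 1 * M.ext c = M.ext c := by
  rw [← M.ext_res, M.res_ext]

theorem extA_coinvA (h : pointwiseStab W X) (y : A ⊗[ℂ] Coinv W X) :
    M.extA A (coinvA A (toStab h) y) = actA A (h : W) (M.extA A y) := by
  induction y with
  | zero => simp
  | add x y hx hy => simp only [map_add, hx, hy]
  | tmul a c => exact congrArg (a ⊗ₜ[ℂ] ·) (M.ext_coinvAct h c)

/-- The idempotent of the translate by `w` of the component of `σ`, after base change. -/
def idemA (w : W) : A ⊗[ℂ] R := 1 ⊗ₜ (w • M.ext 1)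

theorem extA_one : M.extA A 1 = M.idemA A (1 : W) := by
  rw [Algebra.TensorProduct.one_def, idemA, one_smul]
  rfl

theorem actA_idemA (w u : W) : actA A w (M.idemA A u) = M.idemA A (w * u) := by
  rw [idemA, idemA, mul_smul]
  rfl

theorem idemA_mul_self (w : W) : M.idemA A w * M.idemA A w = M.idemA A w := by
  rw [idemA, Algebra.TensorProduct.tmul_mul_tmul, one_mul, ← smul_mul', M.ext_mul_ext_one]

theorem idemA_mul {w u : W} (h : w⁻¹ * u ∉ pointwiseStab W X) :
    M.idemA A w * M.idemA A u = 0 := by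
  have h1 := congrArg (w • ·) (M.ext_one_mul_smul h)
  simp only [smul_mul', smul_smul, mul_inv_cancel_left, smul_zero] at h1
  rw [idemA, idemA, Algebra.TensorProduct.tmul_mul_tmul, h1, tmul_zero]

theorem idemA_mul_right (w : W) (h : pointwiseStab W X) :
    M.idemA A (w * h) = M.idemA A w := by
  rw [idemA, idemA, mul_smul, M.smul_ext_one]

theorem pointA_actA (M : ComponentModel (W := W) X σ) (h : pointwiseStab W X) (x : A ⊗[ℂ] R) :
    pointA A σ (actA A (h : W) x) = pointA A σ x := by
  have h2 : ∀ y : A ⊗[ℂ] Coinv W X,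
      pointA A (coinvPoint W X) (coinvA A (toStab h) y) = pointA A (coinvPoint W X) y := by
    intro y
    rw [pointA_bc]
    congr 2
    refine coinv_algHom_ext fun p => ?_
    rw [AlgHom.comp_apply, coinvAct_mk, coinvPoint_mk, coinvPoint_mk, evalAt_smul, smul_zero]
  rw [← M.pointA_resA, M.resA_actA, h2, M.pointA_resA]

theorem pointA_idemA_one : pointA A σ (M.idemA A (1 : W)) = 1 := by
  rw [← M.extA_one, ← M.pointA_resA, M.resA_extA, map_one]

variable {A}

/-- The function on `Spec A` that is `1` where `g` moves the base point into the component
with index `w`, and `0` elsewhere. -/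
def coeff (g : (autCover W R).pts A) (w : W) : A := pointA A σ (autAlgHom g (M.idemA A w))

theorem pointA_autAlgHom_actA (M : ComponentModel (W := W) X σ) (g : (autCover W R).pts A) (h : pointwiseStab W X) (x : A ⊗[ℂ] R) :
    pointA A σ (autAlgHom g (actA A (h : W) x)) = pointA A σ (autAlgHom g x) := by
  rw [autAlgHom_actA, M.pointA_actA]

theorem coeff_mul_self (g : (autCover W R).pts A) (w : W) :
    M.coeff g w * M.coeff g w = M.coeff g w := by
  rw [coeff, ← map_mul, ← map_mul, idemA_mul_self]

theorem coeff_mul (g : (autCover W R).pts A) {w u : W} (h : w⁻¹ * u ∉ pointwiseStab W X) :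
    M.coeff g w * M.coeff g u = 0 := by
  rw [coeff, coeff, ← map_mul, ← map_mul, M.idemA_mul A h, map_zero, map_zero]

theorem coeff_mul_left (g : (autCover W R).pts A) (h : pointwiseStab W X) (w : W) :
    M.coeff g (h * w) = M.coeff g w := by
  rw [coeff, ← actA_idemA, M.pointA_autAlgHom_actA, coeff]

theorem coeff_mul_right (g : (autCover W R).pts A) (h : pointwiseStab W X) (w : W) :
    M.coeff g (w * h) = M.coeff g w := by
  rw [coeff, idemA_mul_right, coeff]

variable [Module.Finite ℂ V]

/-- If `w` does not stabilize `X`, some `h ∈ W_X` carries the component with index `w` to a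
different one. The two coefficients are equal by equivariance and orthogonal, so the idempotent
`coeff g w` is zero. -/
theorem coeff_eq_zero (hX : X ∈ intersections (mirrors W)) (g : (autCover W R).pts A) {w : W}
    (hw : w ∉ setStab W X) : M.coeff g w = 0 := by
  by_contra h0
  refine hw (mem_setStab_of_conj hX fun h hh => ?_)
  by_contra hcon
  refine h0 ?_
  rw [← M.coeff_mul_self]
  conv_lhs => enter [2]; rw [← M.coeff_mul_left g ⟨h, hh⟩]
  exact M.coeff_mul g (by rwa [← mul_assoc])

/-- The image of the base point under an automorphism is determined by the functions `coeff`. -/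
theorem pointA_autAlgHom [Fintype W] (hX : X ∈ intersections (mirrors W))
    (g : (autCover W R).pts A) (x : A ⊗[ℂ] R) :
    (Nat.card (pointwiseStab W X) : A) • pointA A σ (autAlgHom g x) =
      ∑ w : W, M.coeff g w * pointA A σ (actA A w⁻¹ x) := by
  have h1 := congrArg (fun y => pointA A σ (autAlgHom g y)) (M.sum_extA_resA A x)
  simp only [map_sum] at h1
  have h2 : (Nat.card (pointwiseStab W X) : ℂ) • x = (Nat.card (pointwiseStab W X) : A) • x := by
    rw [Nat.cast_smul_eq_nsmul, Nat.cast_smul_eq_nsmul]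
  rw [h2, map_smul, map_smul] at h1
  rw [← h1]
  refine Finset.sum_congr rfl fun w _ => ?_
  set y := M.resA A (actA A w⁻¹ x) with hy
  have hpt : pointA A σ (actA A w⁻¹ x) = pointA A (coinvPoint W X) y := by
    rw [hy, M.pointA_resA]
  have hco : pointA A σ (autAlgHom g (actA A w (M.extA A 1))) = M.coeff g w := by
    rw [extA_one, actA_idemA, mul_one, coeff]
  rw [hpt]
  by_cases hw : w ∈ setStab W X
  -- As `w` normalizes `W_X`, this functional is `W_X`-invariant, hence a multiple of evaluation at
  -- the origin. An automorphism therefore cannot move `σ` infinitesimally off its orbit, although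
  -- the fibre may be nonreduced.
  · let τ : A ⊗[ℂ] Coinv W X →ₗ[A] A := (pointA A σ).toLinearMap ∘ₗ (autAlgHom g).toLinearMap ∘ₗ
      (actA A w).toLinearMap ∘ₗ M.extA A
    have h3 := apply_eq_of_invariant A τ (fun h y => by
      change pointA A σ (autAlgHom g (actA A w (M.extA A (coinvA A (toStab h) y)))) =
        pointA A σ (autAlgHom g (actA A w (M.extA A y)))
      have h4 := conj_mem_pointwiseStab (X := X) ((setStab W X).inv_mem hw) h.2
      rw [inv_inv] at h4
      have h5 : w * h = (⟨_, h4⟩ : pointwiseStab W X) * w := by simp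
      rw [extA_coinvA, ← actA_mul, h5, actA_mul, M.pointA_autAlgHom_actA]) y
    change pointA A σ (autAlgHom g (actA A w (M.extA A y))) = _ •
      pointA A σ (autAlgHom g (actA A w (M.extA A 1))) at h3
    rw [h3, hco, smul_eq_mul, mul_comm]
  · have h3 : M.extA A y = M.extA A 1 * M.extA A y := by
      rw [M.extA_one, idemA, one_smul, ← M.extA_resA, M.resA_extA]
    rw [h3, map_mul, map_mul, map_mul, hco, M.coeff_eq_zero hX g hw, zero_mul, zero_mul]

/-- `σ ∘ g` is a combination of `W`-translates of `σ`, and an equivariant `q` fixing `σ` fixes all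
of these. So `σ ∘ g ∘ q = σ ∘ g`. -/
theorem autPointed_normal (M : ComponentModel (W := W) X σ) (hX : X ∈ intersections (mirrors W)) :
    ((autPointed W σ).pts A).Normal := by
  have := Fintype.ofFinite W
  refine ⟨fun (q : (autCover W R).pts A) hq (g : (autCover W R).pts A) => (mem_autPointed A).2 fun x => ?_⟩
  have hq' := (mem_autPointed A).1 hq
  have h1 : ∀ y, pointA A σ (autAlgHom (A := A) g (autAlgHom (A := A) q y)) =
      pointA A σ (autAlgHom (A := A) g y) := by
    intro y
    refine natCast_smul_cancel A (n := Nat.card (pointwiseStab W X)) Nat.card_pos.ne' ?_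
    rw [M.pointA_autAlgHom hX, M.pointA_autAlgHom hX]
    refine Finset.sum_congr rfl fun w _ => ?_
    rw [← autAlgHom_actA, hq']
  have h2 := h1 (autAlgHom (A := A) (g : (autCover W R).pts A)⁻¹ x)
  have h3 : autAlgHom (g : (autCover W R).pts A) (autAlgHom (g : (autCover W R).pts A)⁻¹ x) = x := by
    rw [← autAlgHom_mul, mul_inv_cancel, autAlgHom_one]
  rw [h3] at h2
  exact h2

end ComponentModel

end Translates

/-! ### Idempotents attached to locally constant functions -/

section Idempotents

variable {B : Type} [CommRing B]

theorem idempotent_eq_zero_of_forall_mem {c : B} (hc : c * c = c)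
    (h : ∀ p : PrimeSpectrum B, c ∈ p.asIdeal) : c = 0 := by
  have hnil : IsNilpotent c := by
    rw [← mem_nilradical, nilradical_eq_sInf, Ideal.mem_sInf]
    exact fun P hP => h ⟨P, hP⟩
  obtain ⟨n, hn⟩ := hnil
  rw [← IsIdempotentElem.pow_succ_eq n hc, pow_succ, hn, zero_mul]

variable {Γ : Type}

theorem exists_idem (f : LocallyConstant (PrimeSpectrum B) Γ) (γ : Γ) :
    ∃ b : B, b * b = b ∧ ∀ p : PrimeSpectrum B, b ∉ p.asIdeal ↔ f p = γ := by
  obtain ⟨b, hb, hbf⟩ := PrimeSpectrum.exists_idempotent_basicOpen_eq_of_isClopen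
    (f.isLocallyConstant.isClopen_fiber γ)
  exact ⟨b, hb, fun p => by
    have := Set.ext_iff.1 hbf p
    exact this.symm⟩

/-- The idempotent that is `1` exactly where the locally constant function has the value `γ`. -/
def idem (f : LocallyConstant (PrimeSpectrum B) Γ) (γ : Γ) : B := (exists_idem f γ).choose

theorem idem_mul_self (f : LocallyConstant (PrimeSpectrum B) Γ) (γ : Γ) :
    idem f γ * idem f γ = idem f γ := (exists_idem f γ).choose_spec.1

theorem idem_notMem (f : LocallyConstant (PrimeSpectrum B) Γ) (γ : Γ) (p : PrimeSpectrum B) :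
    idem f γ ∉ p.asIdeal ↔ f p = γ := (exists_idem f γ).choose_spec.2 p

theorem eq_idem (f : LocallyConstant (PrimeSpectrum B) Γ) (γ : Γ) {b : B} (hb : b * b = b)
    (h : ∀ p : PrimeSpectrum B, b ∉ p.asIdeal ↔ f p = γ) : b = idem f γ := by
  refine PrimeSpectrum.basicOpen_injOn_isIdempotentElem hb (idem_mul_self f γ) ?_
  ext p
  exact (h p).trans (idem_notMem f γ p).symm

theorem idem_mul (f : LocallyConstant (PrimeSpectrum B) Γ) {γ δ : Γ} (h : γ ≠ δ) :
    idem f γ * idem f δ = 0 := by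
  refine idempotent_eq_zero_of_forall_mem ?_ fun p => ?_
  · rw [mul_mul_mul_comm, idem_mul_self, idem_mul_self]
  · by_contra hcon
    have h1 := (idem_notMem f γ p).1 fun h' => hcon (p.asIdeal.mul_mem_right _ h')
    have h2 := (idem_notMem f δ p).1 fun h' => hcon (p.asIdeal.mul_mem_left _ h')
    exact h (h1.symm.trans h2)

theorem sum_idem [Fintype Γ] (f : LocallyConstant (PrimeSpectrum B) Γ) : ∑ γ, idem f γ = 1 := by
  classical
  rw [← sub_eq_zero, ← neg_eq_zero, neg_sub]
  have hmul : ∀ γ, idem f γ * ∑ δ, idem f δ = idem f γ := by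
    intro γ
    rw [Finset.mul_sum, Finset.sum_eq_single γ (fun δ _ h => idem_mul f h.symm) (by simp),
      idem_mul_self]
  refine idempotent_eq_zero_of_forall_mem ?_ fun p => ?_
  · have : (∑ γ, idem f γ) * ∑ δ, idem f δ = ∑ δ, idem f δ := by
      rw [Finset.sum_mul]
      exact Finset.sum_congr rfl fun γ _ => hmul γ
    linear_combination this
  · have h1 : idem f (f p) * (1 - ∑ γ, idem f γ) = 0 := by
      rw [mul_sub, hmul, mul_one, sub_self]
    exact (p.2.mem_or_mem (h1 ▸ zero_mem p.asIdeal)).resolve_left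
      ((idem_notMem f _ p).2 rfl)

theorem idem_const_self (γ : Γ) : idem (LocallyConstant.const (PrimeSpectrum B) γ) γ = 1 :=
  (eq_idem _ _ (mul_one 1) fun p =>
    ⟨fun _ => rfl, fun _ h => p.2.ne_top ((Ideal.eq_top_iff_one _).2 h)⟩).symm

theorem idem_const {γ δ : Γ} (h : γ ≠ δ) :
    idem (LocallyConstant.const (PrimeSpectrum B) γ) δ = 0 :=
  (eq_idem _ _ (mul_zero 0) fun _ => ⟨fun h0 => absurd (zero_mem _) h0, fun h' => absurd h' h⟩).symm

theorem idem_comap {B' : Type} [CommRing B'] (u : B →+* B')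
    (f : LocallyConstant (PrimeSpectrum B) Γ) (f' : LocallyConstant (PrimeSpectrum B') Γ)
    (h : ∀ p, f' p = f (PrimeSpectrum.comap u p)) (γ : Γ) : u (idem f γ) = idem f' γ :=
  eq_idem _ _ (by rw [← map_mul, idem_mul_self]) fun p => by
    rw [h, ← idem_notMem f γ]; rfl

theorem idem_mul_mul_of_eq [Group Γ] (f g : LocallyConstant (PrimeSpectrum B) Γ) (γ δ : Γ) :
    idem (f * g) (γ * δ) * (idem f γ * idem g δ) = idem f γ * idem g δ := by
  have h0 : (1 - idem (f * g) (γ * δ)) * (idem f γ * idem g δ) = 0 := by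
    refine idempotent_eq_zero_of_forall_mem ?_ fun p => ?_
    · have h1 := idem_mul_self (f * g) (γ * δ)
      have h2 := idem_mul_self f γ
      have h3 := idem_mul_self g δ
      have h4 : (1 - idem (f * g) (γ * δ)) * (1 - idem (f * g) (γ * δ)) =
          1 - idem (f * g) (γ * δ) := by linear_combination h1
      rw [mul_mul_mul_comm, h4, mul_mul_mul_comm, h2, h3]
    · by_contra hcon
      have h1 := (idem_notMem f γ p).1 fun h' =>
        hcon (p.asIdeal.mul_mem_left _ (p.asIdeal.mul_mem_right _ h'))
      have h2 := (idem_notMem g δ p).1 fun h' =>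
        hcon (p.asIdeal.mul_mem_left _ (p.asIdeal.mul_mem_left _ h'))
      have h3 := (idem_notMem (f * g) (γ * δ) p).2 (by
        rw [LocallyConstant.mul_apply, h1, h2])
      have h4 : idem (f * g) (γ * δ) * (1 - idem (f * g) (γ * δ)) = 0 := by
        rw [mul_sub, idem_mul_self, mul_one, sub_self]
      exact hcon (p.asIdeal.mul_mem_right _
        ((p.2.mem_or_mem (h4 ▸ zero_mem p.asIdeal)).resolve_left h3))
  linear_combination -h0

theorem idem_mul_mul_of_ne [Group Γ] (f g : LocallyConstant (PrimeSpectrum B) Γ) {γ δ ε : Γ}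
    (h : γ * δ ≠ ε) : idem (f * g) ε * (idem f γ * idem g δ) = 0 := by
  rw [← idem_mul_mul_of_eq, ← mul_assoc, idem_mul _ h.symm, zero_mul]

/-- The decomposition of `Spec A` by the values of `f * g` is refined to the one by pairs of values.
This makes the gluing along locally constant functions multiplicative. -/
theorem sum_idem_mul_smul [Group Γ] [Fintype Γ] {E : Type} [AddCommGroup E] [Module B E]
    (f g : LocallyConstant (PrimeSpectrum B) Γ) (F : Γ → E) :
    ∑ ε, idem (f * g) ε • F ε = ∑ γ, ∑ δ, (idem f γ * idem g δ) • F (γ * δ) := by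
  classical
  have h1 : (∑ γ, idem f γ) * ∑ δ, idem g δ = 1 := by rw [sum_idem, sum_idem, one_mul]
  rw [Finset.sum_mul_sum] at h1
  calc ∑ ε, idem (f * g) ε • F ε
      = (∑ γ, ∑ δ, idem f γ * idem g δ) • ∑ ε, idem (f * g) ε • F ε := by rw [h1, one_smul]
    _ = _ := by
      rw [Finset.sum_smul]
      refine Finset.sum_congr rfl fun γ _ => ?_
      rw [Finset.sum_smul]
      refine Finset.sum_congr rfl fun δ _ => ?_
      rw [Finset.smul_sum, Finset.sum_eq_single (γ * δ)]
      · rw [smul_smul, mul_comm, idem_mul_mul_of_eq]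
      · intro ε _ h
        rw [smul_smul, mul_comm, idem_mul_mul_of_ne _ _ h.symm, zero_smul]
      · simp

end Idempotents

/-! ### The action of the stabilizer on the cover -/

section StabAction

variable {V : Type} [AddCommGroup V] [Module ℂ V] {W : Subgroup (V ≃ₗ[ℂ] V)} {X : Submodule ℂ V}
variable [Finite W]
variable {R : Type} [CommRing R] [Algebra ℂ R] [MulSemiringAction W R] [SMulCommClass W ℂ R]
variable {σ : R →ₐ[ℂ] ℂ}

instance : Finite (StabQuotient W X) := Quotient.finite _

instance : Fintype (StabQuotient W X) := Fintype.ofFinite _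

namespace ComponentModel

variable (M : ComponentModel (W := W) X σ) (A : CommAlgCat.{0} ℂ)

/-- The conjugate by `n ∈ stab(X)` of the restriction to the component of `σ`. -/
def conjRes (n : setStab W X) : A ⊗[ℂ] R →ₐ[A] A ⊗[ℂ] Coinv W X :=
  (coinvA A n).comp ((M.resA A).comp (actA A (n⁻¹ : setStab W X).1))

theorem conjRes_apply (n : setStab W X) (x : A ⊗[ℂ] R) :
    M.conjRes A n x = coinvA A n (M.resA A (actA A (n⁻¹ : setStab W X).1 x)) := rfl

theorem conjRes_one (x : A ⊗[ℂ] R) : M.conjRes A 1 x = M.resA A x := by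
  rw [conjRes_apply, coinvA_one, inv_one, Subgroup.coe_one, actA_one]

/-- Restriction commutes with `W_X`, so conjugation by an element of `W_X` has no effect, and
`conjRes` descends to `stab(X) / W_X`. -/
theorem conjRes_mul_toStab (n : setStab W X) (h : pointwiseStab W X) (x : A ⊗[ℂ] R) :
    M.conjRes A (n * toStab h) x = M.conjRes A n x := by
  rw [conjRes_apply, conjRes_apply, coinvA_mul, mul_inv_rev, Subgroup.coe_mul, actA_mul]
  have h1 : ((toStab h)⁻¹ : setStab W X).1 = ((h⁻¹ : pointwiseStab W X) : W) := rfl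
  have h2 : toStab h⁻¹ = (toStab h)⁻¹ := rfl
  rw [h1, M.resA_actA, ← coinvA_mul A (toStab h), h2, mul_inv_cancel, coinvA_one]

/-- `n` normalizes `W_X`, so both twists by `n` permute `W_X` in the same way and cancel. -/
theorem conjRes_equivariant (n : setStab W X) : Equivariant A (M.conjRes A n) := by
  intro h x
  have h4 := conj_mem_pointwiseStab n.2 h.2
  have h5 : (n⁻¹ : setStab W X).1 * (h : W) =
      ((⟨_, h4⟩ : pointwiseStab W X) : W) * (n⁻¹ : setStab W X).1 := by simp
  have h6 : n * toStab (⟨_, h4⟩ : pointwiseStab W X) = toStab h * n := by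
    apply Subtype.ext
    change (n : W) * ((n : W)⁻¹ * (h : W) * (n : W)) = h * n
    group
  rw [conjRes_apply, conjRes_apply, ← actA_mul, h5, actA_mul, M.resA_actA, ← coinvA_mul, h6,
    coinvA_mul]

/-- `conjRes`, for classes modulo `W_X`. -/
def conjResQ (γ : StabQuotient W X) : A ⊗[ℂ] R →ₐ[A] A ⊗[ℂ] Coinv W X := M.conjRes A γ.out

theorem conjResQ_mk (n : setStab W X) : M.conjResQ A (n : StabQuotient W X) = M.conjRes A n := by
  refine AlgHom.ext fun x => ?_
  obtain ⟨h, hh⟩ := QuotientGroup.mk_out_eq_mul ((pointwiseStab W X).subgroupOf (setStab W X)) n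
  have h1 : (h : setStab W X) = toStab ⟨h.1.1, Subgroup.mem_subgroupOf.1 h.2⟩ := rfl
  rw [conjResQ, hh, h1, M.conjRes_mul_toStab]

/-- The combination of the maps `conjResQ` along a locally constant function. -/
def glueRes (f : LocallyConstant (PrimeSpectrum A) (StabQuotient W X)) :
    A ⊗[ℂ] R →ₐ[A] A ⊗[ℂ] Coinv W X :=
  AlgHom.ofLinearMap (∑ γ, idem f γ • (M.conjResQ A γ).toLinearMap)
    (by
      simp only [LinearMap.sum_apply, LinearMap.smul_apply, AlgHom.toLinearMap_apply, map_one]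
      rw [← Finset.sum_smul, sum_idem, one_smul])
    (fun x y => by
      classical
      simp only [LinearMap.sum_apply, LinearMap.smul_apply, AlgHom.toLinearMap_apply, map_mul]
      rw [Finset.sum_mul_sum]
      refine Finset.sum_congr rfl fun γ _ => ?_
      rw [Finset.sum_eq_single γ]
      · rw [smul_mul_smul_comm, idem_mul_self]
      · intro δ _ h
        rw [smul_mul_smul_comm, idem_mul _ h.symm, zero_smul]
      · simp)

theorem glueRes_apply (f : LocallyConstant (PrimeSpectrum A) (StabQuotient W X)) (x : A ⊗[ℂ] R) :
    M.glueRes A f x = ∑ γ, idem f γ • M.conjResQ A γ x := by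
  simp [glueRes]

theorem glueRes_const (n : setStab W X) (x : A ⊗[ℂ] R) :
    M.glueRes A (LocallyConstant.const (PrimeSpectrum A) (n : StabQuotient W X)) x =
      M.conjRes A n x := by
  classical
  rw [glueRes_apply, Finset.sum_eq_single (n : StabQuotient W X)]
  · rw [idem_const_self, one_smul, conjResQ_mk]
  · intro δ _ h
    rw [idem_const h.symm, zero_smul]
  · simp

theorem glueRes_equivariant (f : LocallyConstant (PrimeSpectrum A) (StabQuotient W X)) :
    Equivariant A (M.glueRes A f) := by
  intro h x
  rw [glueRes_apply, glueRes_apply, map_sum]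
  refine Finset.sum_congr rfl fun γ _ => ?_
  rw [map_smul, conjResQ, M.conjRes_equivariant]

/-- The endomorphism of `A ⊗ R` attached to a locally constant function with values in
`stab(X) / W_X`. -/
def stabHom (f : LocallyConstant (PrimeSpectrum A) (StabQuotient W X)) :
    A ⊗[ℂ] R →ₐ[A] A ⊗[ℂ] R :=
  M.indAlg A (M.glueRes A f) (M.glueRes_equivariant A f)

theorem stabHom_actA (f : LocallyConstant (PrimeSpectrum A) (StabQuotient W X)) (w : W)
    (x : A ⊗[ℂ] R) : M.stabHom A f (actA A w x) = actA A w (M.stabHom A f x) :=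
  M.indAlg_actA A _ _ w x

theorem resA_stabHom (f : LocallyConstant (PrimeSpectrum A) (StabQuotient W X)) (x : A ⊗[ℂ] R) :
    M.resA A (M.stabHom A f x) = M.glueRes A f x :=
  M.resA_indAlg A _ _ x

theorem stabHom_one (x : A ⊗[ℂ] R) : M.stabHom A 1 x = x := by
  refine congrFun (M.eq_of_resA_comp A (G := M.stabHom A 1) (G' := id) (M.stabHom_actA A 1)
    (fun _ _ => rfl) fun x => ?_) x
  rw [resA_stabHom]
  have h := M.glueRes_const A 1 x
  rw [conjRes_one] at h
  exact h

/-- Both sides are equivariant, so it suffices to compare restrictions to the component. There the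
inner translation by `n⁻¹` moves through `stabHom A g` and both sides become the same double sum. -/
theorem stabHom_mul (f g : LocallyConstant (PrimeSpectrum A) (StabQuotient W X)) (x : A ⊗[ℂ] R) :
    M.stabHom A (f * g) x = M.stabHom A f (M.stabHom A g x) := by
  refine congrFun (M.eq_of_resA_comp A (G := M.stabHom A (f * g))
    (G' := fun x => M.stabHom A f (M.stabHom A g x)) (M.stabHom_actA A _)
    (fun w x => by rw [stabHom_actA, stabHom_actA]) fun x => ?_) x
  rw [resA_stabHom, resA_stabHom, glueRes_apply, glueRes_apply, sum_idem_mul_smul]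
  refine Finset.sum_congr rfl fun γ _ => ?_
  obtain ⟨n, rfl⟩ := QuotientGroup.mk_surjective γ
  rw [conjResQ_mk, conjRes_apply, ← stabHom_actA, resA_stabHom, glueRes_apply, map_sum,
    Finset.smul_sum]
  refine Finset.sum_congr rfl fun δ _ => ?_
  obtain ⟨m, rfl⟩ := QuotientGroup.mk_surjective δ
  rw [map_smul, smul_smul, ← QuotientGroup.mk_mul, conjResQ_mk, conjResQ_mk, conjRes_apply,
    conjRes_apply, coinvA_mul, mul_inv_rev, Subgroup.coe_mul, actA_mul]

/-- The automorphism attached to a locally constant function with values in `stab(X) / W_X`. -/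
def stabAut (f : LocallyConstant (PrimeSpectrum A) (StabQuotient W X)) : (autCover W R).pts A :=
  autOfAlgHom A (M.stabHom A f) (M.stabHom A f⁻¹)
    (fun x => by rw [← stabHom_mul, mul_inv_cancel, stabHom_one])
    (fun x => by rw [← stabHom_mul, inv_mul_cancel, stabHom_one]) (M.stabHom_actA A f)

theorem autAlgHom_stabAut (f : LocallyConstant (PrimeSpectrum A) (StabQuotient W X))
    (x : A ⊗[ℂ] R) : autAlgHom (M.stabAut A f) x = M.stabHom A f x := rfl

variable {A} in
theorem stabHom_baseMap {B : CommAlgCat.{0} ℂ} (u : A ⟶ B)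
    (f : LocallyConstant (PrimeSpectrum A) (StabQuotient W X))
    (f' : LocallyConstant (PrimeSpectrum B) (StabQuotient W X))
    (h : ∀ p, f' p = f (PrimeSpectrum.comap u.hom.toRingHom p)) (x : A ⊗[ℂ] R) :
    baseMap R u (M.stabHom A f x) = M.stabHom B f' (baseMap R u x) := by
  refine M.ext_of_resA B fun w => ?_
  rw [bc_baseMap, bc_baseMap, ← stabHom_actA, ← stabHom_actA, resA_stabHom, resA_stabHom,
    glueRes_apply, glueRes_apply, map_sum]
  refine Finset.sum_congr rfl fun γ _ => ?_
  rw [baseMap_smul, conjResQ, conjResQ, conjRes_apply, conjRes_apply, bc_baseMap, bc_baseMap,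
    bc_baseMap, bc_baseMap]
  congr 1
  exact idem_comap u.hom.toRingHom f f' h γ

/-- The homomorphism `ρ` from `stab(X) / W_X` to the automorphism group of the cover. -/
def stabMap : constantGroup (StabQuotient W X) ⟶ (autCover W R).toFunctor where
  app A := GrpCat.ofHom
    { toFun := M.stabAut A
      map_one' := autCover_ext A (M.stabHom_one A)
      map_mul' := fun f g => autCover_ext A (M.stabHom_mul A f g) }
  naturality A B u := by
    refine GrpCat.hom_ext (MonoidHom.ext fun f => ?_)
    refine Subtype.ext (Units.ext (end_ext fun r => ?_))
    change M.stabHom B _ (1 ⊗ₜ r) = endMapFun R u _ (1 ⊗ₜ r)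
    rw [endMapFun_tmul, one_smul]
    have h1 : (1 : B) ⊗ₜ[ℂ] r = baseMap R u ((1 : A) ⊗ₜ[ℂ] r) := by
      rw [baseMap_tmul, map_one]
    rw [h1]
    exact (M.stabHom_baseMap u f _ (fun p => rfl) _).symm

/-- The locally constant function can be read off from the automorphism that it defines. This gives
injectivity of `ρ` and the comparison with an arbitrary automorphism. -/
theorem coeff_stabAut (f : LocallyConstant (PrimeSpectrum A) (StabQuotient W X))
    (n : setStab W X) : M.coeff (M.stabAut A f) (n : W) = idem f (n : StabQuotient W X) := by
  classical
  have h0 : ∀ m : setStab W X, pointA A (coinvPoint W X) (M.conjRes A m (M.idemA A (n : W))) =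
      if (m : StabQuotient W X) = (n : StabQuotient W X) then 1 else 0 := by
    intro m
    have h1 : ∀ y : A ⊗[ℂ] Coinv W X,
        pointA A (coinvPoint W X) (coinvA A m y) = pointA A (coinvPoint W X) y := by
      intro y
      rw [pointA_bc]
      congr 2
      refine coinv_algHom_ext fun p => ?_
      rw [AlgHom.comp_apply, coinvAct_mk, coinvPoint_mk, coinvPoint_mk, evalAt_smul, smul_zero]
    rw [conjRes_apply, h1, actA_idemA]
    split_ifs with h
    · rw [QuotientGroup.eq, Subgroup.mem_subgroupOf] at h
      have h2 := M.idemA_mul_right A 1 ⟨_, h⟩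
      rw [one_mul] at h2
      have h3 : (m⁻¹ : setStab W X).1 * (n : W) = ((m⁻¹ * n : setStab W X) : W) := rfl
      rw [h3, h2, M.pointA_resA, M.pointA_idemA_one]
    · rw [QuotientGroup.eq, Subgroup.mem_subgroupOf] at h
      have h2 := M.idemA_mul A (w := 1) (u := (m⁻¹ : setStab W X).1 * (n : W)) (by
        simpa using h)
      have h3 := congrArg (pointA A σ) h2
      rw [map_mul, M.pointA_idemA_one, one_mul, map_zero] at h3
      rw [M.pointA_resA, h3]
  rw [ComponentModel.coeff, autAlgHom_stabAut, ← M.pointA_resA, resA_stabHom, glueRes_apply,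
    map_sum, Finset.sum_eq_single (n : StabQuotient W X)]
  · rw [map_smul, conjResQ_mk, h0, if_pos rfl, smul_eq_mul, mul_one]
  · intro δ _ h
    obtain ⟨m, rfl⟩ := QuotientGroup.mk_surjective δ
    rw [map_smul, conjResQ_mk, h0, if_neg h, smul_zero]
  · simp

theorem eq_one_of_stabAut_mem {f : LocallyConstant (PrimeSpectrum A) (StabQuotient W X)}
    (h : M.stabAut A f ∈ (autPointed W σ).pts A) : f = 1 := by
  have h1 := (mem_autPointed A).1 h (M.idemA A (1 : W))
  rw [M.pointA_idemA_one] at h1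
  have h2 := M.coeff_stabAut A f 1
  rw [Subgroup.coe_one] at h2
  have h3 : idem f ((1 : setStab W X) : StabQuotient W X) = 1 := h2.symm.trans h1
  refine LocallyConstant.ext fun p => ?_
  have h4 : f p = ((1 : setStab W X) : StabQuotient W X) := (idem_notMem f _ p).1 (by
    rw [h3]
    exact fun h' => p.2.ne_top ((Ideal.eq_top_iff_one _).2 h'))
  exact h4

variable [Module.Finite ℂ V]

theorem exists_coeff_eq_idem (hX : X ∈ intersections (mirrors W)) (g : (autCover W R).pts A) :
    ∃ f : LocallyConstant (PrimeSpectrum A) (StabQuotient W X),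
      ∀ n : setStab W X, M.coeff g (n : W) = idem f (n : StabQuotient W X) := by
  have := Fintype.ofFinite W
  have hex : ∀ p : PrimeSpectrum A, ∃ n : setStab W X, M.coeff g (n : W) ∉ p.asIdeal := by
    intro p
    by_contra! hcon
    -- The coefficients add up to `|W_X|`, a unit of the `ℂ`-algebra `A`, so at no prime do they all
    -- vanish.
    have h1 := M.pointA_autAlgHom hX g 1
    simp only [map_one, mul_one, smul_eq_mul] at h1
    have h2 : (Nat.card (pointwiseStab W X) : A) ∈ p.asIdeal := by
      rw [h1]
      refine sum_mem fun w _ => ?_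
      by_cases hw : w ∈ setStab W X
      · exact hcon ⟨w, hw⟩
      · rw [M.coeff_eq_zero hX g hw]; exact zero_mem _
    have h3 : IsUnit (Nat.card (pointwiseStab W X) : A) := by
      have : IsUnit (Nat.card (pointwiseStab W X) : ℂ) :=
        IsUnit.mk0 _ (by exact_mod_cast Nat.card_pos.ne')
      have := this.map (algebraMap ℂ A)
      rwa [map_natCast] at this
    exact p.2.ne_top (Ideal.eq_top_of_isUnit_mem _ h2 h3)
  choose ν hν using hex
  have hiff : ∀ (n : setStab W X) (p : PrimeSpectrum A), M.coeff g (n : W) ∉ p.asIdeal ↔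
      (ν p : StabQuotient W X) = (n : StabQuotient W X) := by
    intro n p
    constructor
    · intro hn
      by_contra hcon
      rw [QuotientGroup.eq, Subgroup.mem_subgroupOf] at hcon
      have h1 := M.coeff_mul g (w := (ν p : W)) (u := (n : W)) hcon
      obtain h2 | h2 := p.2.mem_or_mem (h1 ▸ zero_mem p.asIdeal)
      · exact hν p h2
      · exact hn h2
    · intro h hn
      rw [QuotientGroup.eq, Subgroup.mem_subgroupOf] at h
      have h1 := M.coeff_mul_right g ⟨_, h⟩ (ν p : W)
      have h2 : (ν p : W) * ((ν p)⁻¹ * n : setStab W X) = (n : W) := by simp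
      rw [h2] at h1
      exact hν p (h1 ▸ hn)
  let f : LocallyConstant (PrimeSpectrum A) (StabQuotient W X) :=
    { toFun := fun p => (ν p : StabQuotient W X)
      isLocallyConstant := by
        rw [IsLocallyConstant.iff_isOpen_fiber]
        intro γ
        obtain ⟨n, rfl⟩ := QuotientGroup.mk_surjective γ
        have : {p | (ν p : StabQuotient W X) = (n : StabQuotient W X)} =
            (PrimeSpectrum.basicOpen (M.coeff g (n : W)) : Set (PrimeSpectrum A)) := by
          ext p
          exact (hiff n p).symm
        change IsOpen {p | (ν p : StabQuotient W X) = (n : StabQuotient W X)}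
        rw [this]
        exact (PrimeSpectrum.basicOpen _).2 }
  exact ⟨f, fun n => eq_idem f _ (M.coeff_mul_self g _) (hiff n)⟩

theorem isSemidirectProduct_stabMap (hX : X ∈ intersections (mirrors W)) :
    IsSemidirectProduct (autPointed W σ) M.stabMap := by
  intro A
  have := Fintype.ofFinite W
  have hker : ∀ f, M.stabMap.app A f ∈ (autPointed W σ).pts A → f = 1 :=
    fun f hf => M.eq_one_of_stabAut_mem A hf
  refine ⟨M.autPointed_normal hX, ?_, ?_⟩
  · refine (injective_iff_map_eq_one (M.stabMap.app A).hom).2 fun f hf => hker f ?_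
    change (M.stabMap.app A).hom f ∈ _
    rw [hf]
    exact one_mem _
  · refine Subgroup.isComplement'_of_disjoint_and_mul_eq_univ ?_ ?_
    · rw [Subgroup.disjoint_def]
      rintro _ h1 ⟨f, rfl⟩
      rw [hker f h1, map_one]
    · rw [Set.eq_univ_iff_forall]
      intro (g : (autCover W R).pts A)
      obtain ⟨f, hf⟩ := M.exists_coeff_eq_idem A hX g
      -- The coefficients determine the image of the base point, so `g` and `stabAut f` move `σ` in
      -- the same way and differ by an element fixing it.
      have hτ : ∀ x, pointA A σ (autAlgHom g x) = pointA A σ (autAlgHom (M.stabAut A f) x) := by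
        intro x
        refine natCast_smul_cancel A (n := Nat.card (pointwiseStab W X)) Nat.card_pos.ne' ?_
        rw [M.pointA_autAlgHom hX, M.pointA_autAlgHom hX]
        refine Finset.sum_congr rfl fun w _ => ?_
        congr 1
        by_cases hw : w ∈ setStab W X
        · rw [hf ⟨w, hw⟩, M.coeff_stabAut A f ⟨w, hw⟩]
        · rw [M.coeff_eq_zero hX g hw, M.coeff_eq_zero hX _ hw]
      refine Set.mem_mul.2 ⟨g * (M.stabAut A f)⁻¹, (mem_autPointed A).2 fun x => ?_,
        M.stabAut A f, ⟨f, rfl⟩, inv_mul_cancel_right g _⟩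
      have h1 := hτ (autAlgHom (M.stabAut A f)⁻¹ x)
      rw [← autAlgHom_mul, ← autAlgHom_mul, mul_inv_cancel, autAlgHom_one] at h1
      exact h1

/-- On the component of `σ`, `ρ(n)` is `n ∘ res ∘ n⁻¹`. Composed with the translation by `n`, the
inner `n⁻¹` cancels and only the linear action on the coinvariants remains. -/
theorem inducesNaturalAction_stabMap : InducesNaturalAction W σ X M.stabMap := by
  refine ⟨M.res, fun c => ⟨M.ext c, M.res_ext c⟩, M.res_eq_zero_iff, ?_⟩
  rintro n A g hg r p hp
  have hg' : M.stabAut A (LocallyConstant.const (PrimeSpectrum A) (n : StabQuotient W X)) = g := hg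
  subst hg'
  have h1 : M.resA A (actA A (n : W) (M.stabHom A
      (LocallyConstant.const (PrimeSpectrum A) (n : StabQuotient W X)) (1 ⊗ₜ r))) =
      1 ⊗ₜ coinvAct n (coinvMk W X p) := by
    rw [← stabHom_actA, resA_stabHom, glueRes_const, conjRes_apply]
    have h2 : (n⁻¹ : setStab W X).1 = (n : W)⁻¹ := rfl
    rw [h2, actA_inv_actA, bc_tmul, bc_tmul]
    exact congrArg (fun c => (1 : A) ⊗ₜ[ℂ] coinvAct n c) hp
  exact h1

end ComponentModel

end StabAction

/-! ### Irreducible components of a reflection arrangement -/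

section ReflectionArrangements

variable {V : Type} [AddCommGroup V] [Module ℂ V]

/-- The reflections of `W` whose mirrors contain `X`. -/
def Refl (W : Subgroup (V ≃ₗ[ℂ] V)) (X : Submodule ℂ V) : Type :=
  {r : V ≃ₗ[ℂ] V // r ∈ W ∧ IsReflection r ∧ X ≤ fixedLocus r}

variable {W : Subgroup (V ≃ₗ[ℂ] V)} {X : Submodule ℂ V}

theorem IsDirectSum.symm {A B C : Set (Submodule ℂ V)} (h : IsDirectSum A B C) :
    IsDirectSum A C B := by
  obtain ⟨h0, V₁, V₂, h1, h2, h3⟩ := h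
  exact ⟨by rw [h0, Set.union_comm], V₂, V₁, h1.symm, h3, h2⟩

namespace Refl

instance [Finite W] : Finite (Refl W X) :=
  Finite.of_injective (fun r : Refl W X => (⟨r.1, r.2.1⟩ : W)) fun _ _ h =>
    Subtype.ext (congrArg (fun w : W => (w : V ≃ₗ[ℂ] V)) h)

/-- The mirror of a reflection. -/
def mirror (r : Refl W X) : Submodule ℂ V := fixedLocus r.1

/-- A linear form with kernel the mirror of `r`. -/
def form (r : Refl W X) : Module.Dual ℂ V := r.2.2.1.exists_form.choose

/-- The root of `r` matching `form r`. -/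
def root (r : Refl W X) : V := r.2.2.1.exists_form.choose_spec.choose

theorem apply_eq (r : Refl W X) (u : V) : r.1 u = u + r.form u • r.root :=
  r.2.2.1.exists_form.choose_spec.choose_spec.1 u

theorem form_root_ne_zero (r : Refl W X) : r.form r.root ≠ 0 :=
  r.2.2.1.exists_form.choose_spec.choose_spec.2.1

theorem mem_mirror {r : Refl W X} {u : V} : u ∈ r.mirror ↔ r.form u = 0 := by
  rw [mirror, ← r.2.2.1.exists_form.choose_spec.choose_spec.2.2]
  rfl

theorem apply_root (r : Refl W X) : r.1 r.root = (1 + r.form r.root) • r.root := by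
  rw [r.apply_eq, add_smul, one_smul]

theorem root_ne_zero (r : Refl W X) : r.root ≠ 0 := fun h =>
  r.form_root_ne_zero (by rw [h, map_zero])

theorem one_add_form_root_ne_zero (r : Refl W X) : 1 + r.form r.root ≠ 0 := fun h => by
  have h1 := r.apply_root
  rw [h, zero_smul] at h1
  exact r.root_ne_zero (r.1.map_eq_zero_iff.1 h1)

theorem mirror_ne_top (r : Refl W X) : r.mirror ≠ ⊤ := r.2.2.1.2.1

/-- Two reflections are adjacent if the first moves the root of the second. -/
def Adj (r q : Refl W X) : Prop := r.form q.root ≠ 0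

theorem range_mirror : Set.range (mirror (W := W) (X := X)) = containing (mirrors W) X := by
  ext H
  constructor
  · rintro ⟨r, rfl⟩
    exact ⟨⟨r.1, r.2.1, r.2.2.1, rfl⟩, r.2.2.2⟩
  · rintro ⟨⟨w, hw, hr, rfl⟩, hX⟩
    exact ⟨⟨w, hw, hr, hX⟩, rfl⟩

section

variable [Finite W]

/-- Conjugation of reflections, `q r q⁻¹`. -/
def conj (q r : Refl W X) : Refl W X :=
  ⟨q.1 * r.1 * q.1⁻¹, by
    have hmem : q.1 * r.1 * q.1⁻¹ ∈ W := W.mul_mem (W.mul_mem q.2.1 r.2.1) (W.inv_mem q.2.1)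
    have hfix : fixedLocus (q.1 * r.1 * q.1⁻¹) = Submodule.orderIsoMapComap q.1 r.mirror := by
      ext x
      change q.1 (r.1 (q.1.symm x)) = x ↔ x ∈ r.mirror.map (q.1 : V →ₗ[ℂ] V)
      rw [← LinearEquiv.eq_symm_apply, Submodule.mem_map_equiv]
      rfl
    refine ⟨hmem, ⟨?_, ?_⟩, fun x hx => ?_⟩
    · exact Submonoid.isOfFinOrder_coe.2 (isOfFinOrder_of_finite (⟨_, hmem⟩ : W))
    · rw [hfix, OrderIso.isCoatom_iff]
      exact r.2.2.1.2
    · have h1 : q.1.symm x = x := by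
        rw [LinearEquiv.symm_apply_eq]
        exact (q.2.2.2 hx : q.1 x = x).symm
      have h2 : r.1 x = x := r.2.2.2 hx
      have h3 : q.1 x = x := q.2.2.2 hx
      change q.1 (r.1 (q.1.symm x)) = x
      rw [h1, h2, h3]⟩

theorem conj_apply (q r : Refl W X) (x : V) : (q.conj r).1 x = q.1 (r.1 (q.1.symm x)) := rfl

theorem mem_mirror_conj {q r : Refl W X} {x : V} :
    x ∈ (q.conj r).mirror ↔ q.1.symm x ∈ r.mirror := by
  change q.1 (r.1 (q.1.symm x)) = x ↔ _
  rw [← LinearEquiv.eq_symm_apply]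
  rfl

/-- Forms and roots are arbitrary choices, so the chosen root of a conjugate matches the transported
root only up to a nonzero scalar. -/
theorem exists_root_conj (q r : Refl W X) : ∃ c : ℂ, c ≠ 0 ∧ (q.conj r).root = c • q.1 r.root := by
  set s := q.conj r
  have h1 : s.form s.root • s.root = r.form (q.1.symm s.root) • q.1 r.root := by
    have h2 := s.apply_eq s.root
    rw [conj_apply, r.apply_eq, map_add, q.1.apply_symm_apply, map_smul, add_right_inj] at h2
    exact h2.symm
  refine ⟨(s.form s.root)⁻¹ * r.form (q.1.symm s.root), ?_, ?_⟩
  · refine mul_ne_zero (inv_ne_zero s.form_root_ne_zero) fun h0 => ?_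
    rw [h0, zero_smul] at h1
    exact (smul_ne_zero s.form_root_ne_zero s.root_ne_zero) h1
  · rw [mul_smul, ← h1, smul_smul, inv_mul_cancel₀ s.form_root_ne_zero, one_smul]

/-- If `q` fixes the root of `r`, that root is off the mirror of the conjugate, which is thus
adjacent to `r`. Otherwise `q` is adjacent both to `r` and to the conjugate, as `q` multiplies its
own form by the nonzero number `1 + q.form q.root`. In particular the classes are stable under
conjugation by their members. -/
theorem quot_conj (q r : Refl W X) : Quot.mk Adj (q.conj r) = Quot.mk Adj r ∨
    Quot.mk Adj (q.conj r) = Quot.mk Adj q ∧ Quot.mk Adj q = Quot.mk Adj r := by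
  by_cases h : q.form r.root = 0
  · refine Or.inl (Quot.sound ?_)
    rw [Adj, Ne, ← mem_mirror, mem_mirror_conj]
    have h1 : q.1.symm r.root = r.root := by
      rw [LinearEquiv.symm_apply_eq, q.apply_eq, h, zero_smul, add_zero]
    rw [h1, mem_mirror]
    exact r.form_root_ne_zero
  · refine Or.inr ⟨(Quot.sound ?_ : Quot.mk Adj q = _).symm, Quot.sound h⟩
    obtain ⟨c, hc, hr⟩ := exists_root_conj q r
    rw [Adj, hr, map_smul, smul_eq_mul, q.apply_eq, map_add, map_smul, smul_eq_mul]
    refine mul_ne_zero hc ?_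
    have := mul_ne_zero h q.one_add_form_root_ne_zero
    rwa [mul_add, mul_one] at this

/-- The sum `N` over the finite group generated by `S` kills the roots and maps into the
intersection of the mirrors, while each group element changes a vector only by a combination of
roots. This is the usual splitting into fixed vectors and their complement. -/
theorem isCompl_span_root (S : Set (Refl W X)) :
    IsCompl (Submodule.span ℂ (root '' S)) (⨅ r ∈ S, r.mirror) := by
  let G : Subgroup (V ≃ₗ[ℂ] V) := Subgroup.closure ((fun r : Refl W X => r.1) '' S)
  have hGW : G ≤ W := (Subgroup.closure_le W).2 (by rintro _ ⟨r, -, rfl⟩; exact r.2.1)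
  have : Finite G := Finite.of_injective _ (Subgroup.inclusion_injective hGW)
  have := Fintype.ofFinite G
  have hmemG : ∀ r ∈ S, r.1 ∈ G := fun r hr => Subgroup.subset_closure ⟨r, hr, rfl⟩
  let N : V →ₗ[ℂ] V := ∑ g : G, ((g : V ≃ₗ[ℂ] V) : V →ₗ[ℂ] V)
  have hN : ∀ x, N x = ∑ g : G, (g : V ≃ₗ[ℂ] V) x := fun x => by
    simp only [N, LinearMap.sum_apply]; rfl
  have hcard : (Fintype.card G : ℂ) ≠ 0 := by exact_mod_cast Fintype.card_ne_zero
  have hNr : ∀ r ∈ S, ∀ x, N (r.1 x) = N x := fun r hr x => by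
    rw [hN, hN]
    exact Fintype.sum_equiv (Equiv.mulRight (⟨r.1, hmemG r hr⟩ : G)) _ _ fun g => rfl
  have hrN : ∀ r ∈ S, ∀ x, r.1 (N x) = N x := fun r hr x => by
    rw [hN, map_sum]
    exact Fintype.sum_equiv (Equiv.mulLeft (⟨r.1, hmemG r hr⟩ : G)) _ _ fun g => rfl
  have hNspan : ∀ x ∈ Submodule.span ℂ (root '' S), N x = 0 := by
    intro x hx
    induction hx using Submodule.span_induction with
    | mem x hx =>
      obtain ⟨r, hr, rfl⟩ := hx
      have h1 := hNr r hr r.root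
      rw [r.apply_root, map_smul, add_smul, one_smul, add_eq_left] at h1
      exact (smul_eq_zero.1 h1).resolve_left r.form_root_ne_zero
    | zero => exact map_zero N
    | add x y _ _ hx hy => rw [map_add, hx, hy, add_zero]
    | smul a x _ hx => rw [map_smul, hx, smul_zero]
  have hsub : ∀ g ∈ G, ∀ x : V, g x - x ∈ Submodule.span ℂ (root '' S) := by
    intro g hg
    induction hg using Subgroup.closure_induction with
    | mem g hg =>
      obtain ⟨r, hr, rfl⟩ := hg
      intro x
      simp only [r.apply_eq x, add_sub_cancel_left]
      exact Submodule.smul_mem _ _ (Submodule.subset_span ⟨r, hr, rfl⟩)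
    | one => intro x; simp
    | mul g h _ _ hg hh =>
      intro x
      have := add_mem (hg (h x)) (hh x)
      rwa [sub_add_sub_cancel] at this
    | inv g _ hg =>
      intro x
      have h1 := neg_mem (hg (g⁻¹ x))
      have h2 : g (g⁻¹ x) = x := g.apply_symm_apply x
      rwa [h2, neg_sub] at h1
  constructor
  · rw [Submodule.disjoint_def]
    intro x hx hx'
    simp only [Submodule.mem_iInf] at hx'
    have hfix : ∀ g ∈ G, (g : V ≃ₗ[ℂ] V) x = x := by
      intro g hg
      have : G ≤ MulAction.stabilizer (V ≃ₗ[ℂ] V) x :=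
        (Subgroup.closure_le _).2 (by rintro _ ⟨r, hr, rfl⟩; exact hx' r hr)
      exact this hg
    have h1 := hNspan x hx
    rw [hN, Finset.sum_congr rfl fun (g : G) _ => hfix g.1 g.2, Finset.sum_const, Finset.card_univ,
      ← Nat.cast_smul_eq_nsmul ℂ] at h1
    exact (smul_eq_zero.1 h1).resolve_left hcard
  · rw [codisjoint_iff, eq_top_iff]
    intro x _
    refine Submodule.mem_sup.2 ⟨x - (Fintype.card G : ℂ)⁻¹ • N x, ?_,
      (Fintype.card G : ℂ)⁻¹ • N x, ?_, sub_add_cancel _ _⟩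
    · have h1 : x - (Fintype.card G : ℂ)⁻¹ • N x =
          -((Fintype.card G : ℂ)⁻¹ • ∑ g : G, ((g : V ≃ₗ[ℂ] V) x - x)) := by
        rw [Finset.sum_sub_distrib, ← hN, Finset.sum_const, Finset.card_univ,
          ← Nat.cast_smul_eq_nsmul ℂ, smul_sub, smul_smul, inv_mul_cancel₀ hcard, one_smul, neg_sub]
      rw [h1]
      exact neg_mem (Submodule.smul_mem _ _ (sum_mem fun g _ => hsub g g.2 x))
    · simp only [Submodule.mem_iInf]
      exact fun r hr => Submodule.smul_mem _ _ (hrN r hr x)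

/-- The sub-arrangement attached to a class of reflections. -/
def arr (K : Quot (Adj (W := W) (X := X))) : Set (Submodule ℂ V) :=
  mirror '' {r | Quot.mk Adj r = K}

theorem notMem_of_isDirectSum {A B C : Set (Submodule ℂ V)} (h : IsDirectSum A B C) (r : Refl W X)
    (hB : r.mirror ∈ B) (hC : r.mirror ∈ C) : False := by
  obtain ⟨-, V₁, V₂, h1, h2, h3⟩ := h
  refine r.mirror_ne_top (top_unique ?_)
  rw [← h1.sup_eq_top]
  exact sup_le (h3 _ hC) (h2 _ hB)

/-- The mirror of `q r q⁻¹` belongs to one of the two summands. If to that of `r`, a vector of `V₂`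
off the mirror of `q` and its image under `q⁻¹` both lie in the mirror of `r`, hence so does the
root of `q`. If to that of `q`, then `V₁`, which `q` fixes, lies in the mirror of `r` together with
`V₂`, which is impossible. -/
theorem form_root_eq_zero {S : Set (Refl W X)} (hS : ∀ q ∈ S, ∀ r ∈ S, q.conj r ∈ S)
    {B C : Set (Submodule ℂ V)} (h : IsDirectSum (mirror '' S) B C) {r q : Refl W X} (hr : r ∈ S)
    (hq : q ∈ S) (hB : r.mirror ∈ B) (hC : q.mirror ∈ C) : r.form q.root = 0 := by
  obtain ⟨h0, V₁, V₂, h1, h2, h3⟩ := h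
  have hV₂ : ∃ x ∈ V₂, q.form x ≠ 0 := by
    by_contra! hcon
    refine q.mirror_ne_top (top_unique ?_)
    rw [← h1.sup_eq_top]
    exact sup_le (h3 _ hC) fun x hx => mem_mirror.2 (hcon x hx)
  have h4 : (q.conj r).mirror ∈ B ∪ C := h0 ▸ ⟨_, hS q hq r hr, rfl⟩
  rcases h4 with h4 | h4
  · obtain ⟨x, hx, hqx⟩ := hV₂
    have h5 : x ∈ r.mirror := h2 _ hB hx
    have h6 : q.1.symm x ∈ r.mirror := mem_mirror_conj.1 (h2 _ h4 hx)
    have h7 := q.apply_eq (q.1.symm x)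
    rw [q.1.apply_symm_apply] at h7
    have h8 : q.form (q.1.symm x) ≠ 0 := fun h9 => by
      rw [h9, zero_smul, add_zero] at h7
      rw [← h7] at h9
      exact hqx h9
    rw [mem_mirror] at h5 h6
    rw [h7, map_add, h6, zero_add, map_smul, smul_eq_mul] at h5
    exact (mul_eq_zero.1 h5).resolve_left h8
  · exfalso
    refine r.mirror_ne_top (top_unique ?_)
    rw [← h1.sup_eq_top]
    refine sup_le (fun x hx => ?_) (h2 _ hB)
    have h5 := mem_mirror_conj.1 (h3 _ h4 hx)
    have h6 : q.1.symm x = x := by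
      rw [LinearEquiv.symm_apply_eq]
      exact (h3 _ hC hx : q.1 x = x).symm
    rwa [h6] at h5

theorem mem_iff_of_adj {S : Set (Refl W X)} (hS : ∀ q ∈ S, ∀ r ∈ S, q.conj r ∈ S)
    {B C : Set (Submodule ℂ V)} (h : IsDirectSum (mirror '' S) B C) {r q : Refl W X} (hr : r ∈ S)
    (hq : q ∈ S) (ha : Adj r q) : r.mirror ∈ B ↔ q.mirror ∈ B := by
  have hmem : ∀ s ∈ S, s.mirror ∈ B ∨ s.mirror ∈ C := fun s hs => by
    have : s.mirror ∈ B ∪ C := h.1 ▸ ⟨s, hs, rfl⟩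
    exact this
  constructor
  · exact fun hB => (hmem q hq).resolve_right fun hC => ha (form_root_eq_zero hS h hr hq hB hC)
  · exact fun hB => (hmem r hr).resolve_right fun hC =>
      ha (form_root_eq_zero hS h.symm hr hq hC hB)

/-- Adjacent reflections cannot be separated by a direct sum decomposition, and this propagates
along chains, which stay inside `S`. -/
theorem mem_iff_of_quot_eq {S : Set (Refl W X)} (hS : ∀ q ∈ S, ∀ r ∈ S, q.conj r ∈ S)
    (hS' : ∀ r q, Adj r q → (r ∈ S ↔ q ∈ S))
    {B C : Set (Submodule ℂ V)} (h : IsDirectSum (mirror '' S) B C) {r q : Refl W X} (hr : r ∈ S)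
    (hrq : Quot.mk Adj r = Quot.mk Adj q) : r.mirror ∈ B ↔ q.mirror ∈ B := by
  have key : ∀ r q : Refl W X, Relation.EqvGen Adj r q →
      (r ∈ S ↔ q ∈ S) ∧ (r ∈ S → (r.mirror ∈ B ↔ q.mirror ∈ B)) := by
    intro r q hrq
    induction hrq with
    | rel r q ha => exact ⟨hS' r q ha, fun hr => mem_iff_of_adj hS h hr ((hS' r q ha).1 hr) ha⟩
    | refl => exact ⟨Iff.rfl, fun _ => Iff.rfl⟩
    | symm r q _ ih => exact ⟨ih.1.symm, fun hq => (ih.2 (ih.1.2 hq)).symm⟩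
    | trans a b c _ _ h1 h2 => exact ⟨h1.1.trans h2.1, fun ha => (h1.2 ha).trans (h2.2 (h1.1.1 ha))⟩
  exact (key r q (Quot.eqvGen_exact hrq)).2 hr

theorem mirror_mem_arr {r : Refl W X} {K : Quot (Adj (W := W) (X := X))} :
    r.mirror ∈ arr K ↔ Quot.mk Adj r = K := by
  constructor
  · rintro ⟨q, rfl, hrq⟩
    refine (Quot.sound ?_ : Quot.mk Adj q = _).symm
    rw [Adj, Ne, ← mem_mirror, hrq, mem_mirror]
    exact r.form_root_ne_zero
  · exact fun h => ⟨r, h, rfl⟩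

theorem arr_injective : Function.Injective (arr (W := W) (X := X)) := by
  intro K L h
  induction K using Quot.ind with
  | mk r =>
    have : r.mirror ∈ arr L := h ▸ mirror_mem_arr.2 rfl
    exact mirror_mem_arr.1 this

theorem isDirectSum_arr (K : Quot (Adj (W := W) (X := X))) :
    IsDirectSum (containing (mirrors W) X) (arr K) (containing (mirrors W) X \ arr K) := by
  have hsub : arr K ⊆ containing (mirrors W) X := by
    rw [← range_mirror]
    exact Set.image_subset_range _ _
  refine ⟨(Set.union_sdiff_cancel hsub).symm, _, _,
    isCompl_span_root {r : Refl W X | Quot.mk Adj r = K}, ?_, ?_⟩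
  · rintro _ ⟨r, hr, rfl⟩
    exact iInf₂_le r hr
  · rintro H ⟨hH, hHK⟩
    rw [← range_mirror] at hH
    obtain ⟨r, rfl⟩ := hH
    rw [Submodule.span_le]
    rintro _ ⟨q, hq, rfl⟩
    refine mem_mirror.2 ?_
    by_contra h
    exact hHK (mirror_mem_arr.2 ((Quot.sound h).trans hq))

theorem isIrreducibleArr_arr (K : Quot (Adj (W := W) (X := X))) : IsIrreducibleArr (arr K) := by
  rintro ⟨B, C, ⟨b, hb⟩, ⟨c, hc⟩, h⟩
  have hbK : b ∈ arr K := by rw [h.1]; exact Or.inl hb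
  have hcK : c ∈ arr K := by rw [h.1]; exact Or.inr hc
  obtain ⟨r, hr, rfl⟩ := hbK
  obtain ⟨q, hq, rfl⟩ := hcK
  refine notMem_of_isDirectSum h q ?_ hc
  refine (mem_iff_of_quot_eq (S := {r | Quot.mk Adj r = K}) ?_ ?_ h hr (hr.trans hq.symm)).1 hb
  · rintro q (hq : _ = K) r (hr : _ = K)
    rcases quot_conj q r with h1 | h1
    · exact h1.trans hr
    · exact h1.1.trans hq
  · intro r q ha
    change _ = K ↔ _ = K
    rw [Quot.sound ha]

/-- A component containing a mirror contains the whole class of its reflection. Since each class is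
a direct summand of the whole arrangement, a component strictly larger than a class would split. -/
theorem irrComponents_eq_range :
    irrComponents (containing (mirrors W) X) = Set.range (arr (W := W) (X := X)) := by
  ext B
  constructor
  · rintro ⟨hB, ⟨b, hb⟩, hirr, hsum⟩
    have hB' := hB
    rw [← range_mirror] at hB'
    obtain ⟨r, rfl⟩ := hB' hb
    have hle : arr (Quot.mk Adj r) ⊆ B := by
      rintro _ ⟨q, hq, rfl⟩
      have hsum' := hsum
      rw [← range_mirror, ← Set.image_univ] at hsum'
      exact (mem_iff_of_quot_eq (fun _ _ _ _ => Set.mem_univ _) (fun _ _ _ => by simp) hsum'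
        (Set.mem_univ _)
        hq.symm).1 hb
    refine ⟨Quot.mk Adj r, ?_⟩
    by_contra hne
    refine hirr ⟨arr (Quot.mk Adj r), B \ arr (Quot.mk Adj r), ⟨_, mirror_mem_arr.2 rfl⟩, ?_, ?_⟩
    · rw [Set.sdiff_nonempty]
      exact fun h => hne (hle.antisymm h)
    · obtain ⟨-, V₁, V₂, h1, h2, h3⟩ := isDirectSum_arr (Quot.mk Adj r)
      exact ⟨(Set.union_sdiff_cancel hle).symm, V₁, V₂, h1, h2,
        fun H hH => h3 H ⟨hB hH.1, hH.2⟩⟩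
  · rintro ⟨K, rfl⟩
    refine ⟨?_, ?_, isIrreducibleArr_arr K, isDirectSum_arr K⟩
    · rw [← range_mirror]
      exact Set.image_subset_range _ _
    · induction K using Quot.ind with
      | mk r => exact ⟨_, mirror_mem_arr.2 rfl⟩

theorem ncard_irrComponents : (irrComponents (containing (mirrors W) X)).ncard =
    Nat.card (Quot (Adj (W := W) (X := X))) := by
  rw [irrComponents_eq_range, ← Nat.card_coe_set_eq, Nat.card_range_of_injective arr_injective]

end

end Refl

end ReflectionArrangements

/-! ### The grading of the coinvariants -/

section Grading

variable {V : Type} [AddCommGroup V] [Module ℂ V]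

/-- The dilation `p ↦ p(2 ·)` of polynomial functions. -/
def dilate (V : Type) [AddCommGroup V] [Module ℂ V] : Coord V →ₐ[ℂ] Coord V :=
  SymmetricAlgebra.lift ((2 : ℂ) • SymmetricAlgebra.ι ℂ (Module.Dual ℂ V))

@[simp] theorem dilate_lin (ℓ : Module.Dual ℂ V) : dilate V (lin ℓ) = (2 : ℂ) • lin ℓ :=
  SymmetricAlgebra.lift_ι_apply _ _

theorem dilate_smul (w : V ≃ₗ[ℂ] V) (p : Coord V) : dilate V (w • p) = w • dilate V p := by
  have : (dilate V).comp (coordAct w) = (coordAct w).comp (dilate V) :=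
    coord_algHom_ext fun ℓ => by simp
  exact AlgHom.congr_fun this p

theorem evalAt_zero_dilate (p : Coord V) : evalAt 0 (dilate V p) = evalAt 0 p := by
  have : (evalAt 0).comp (dilate V) = evalAt (0 : V) := coord_algHom_ext fun ℓ => by simp
  exact AlgHom.congr_fun this p

variable (W : Subgroup (V ≃ₗ[ℂ] V)) (X : Submodule ℂ V)

/-- The dilation of the coinvariants. -/
def coinvDilate : Coinv W X →ₐ[ℂ] Coinv W X :=
  coinvLift W X ((coinvMk W X).comp (dilate V)) fun p hp => by
    have : coinvariantIdeal (pointwiseStab W X) ≤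
        (coinvariantIdeal (pointwiseStab W X)).comap (dilate V) :=
      coinvariantIdeal_le fun p hp hp0 => mem_coinvariantIdeal
        (fun h hh => by rw [← dilate_smul, hp h hh]) (by rw [evalAt_zero_dilate, hp0])
    exact coinvMk_eq_zero.2 (this hp)

@[simp] theorem coinvDilate_mk (p : Coord V) :
    coinvDilate W X (coinvMk W X p) = coinvMk W X (dilate V p) := rfl

/-- The class of a product of linear forms. -/
def coinvMono (s : Multiset (Module.Dual ℂ V)) : Coinv W X := (s.map fun ℓ => coinvMk W X (lin ℓ)).prod

variable {W X}

theorem coinvDilate_mono (s : Multiset (Module.Dual ℂ V)) :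
    coinvDilate W X (coinvMono W X s) = (2 : ℂ) ^ s.card • coinvMono W X s := by
  induction s using Multiset.induction with
  | empty => simp [coinvMono]
  | cons ℓ s ih =>
    have h : coinvMono W X (ℓ ::ₘ s) = coinvMk W X (lin ℓ) * coinvMono W X s := by simp [coinvMono]
    rw [h, map_mul, ih, coinvDilate_mk, dilate_lin, map_smul, Multiset.card_cons, pow_succ',
      smul_mul_smul_comm]

theorem coinvDilate_coinvAct (n : setStab W X) (c : Coinv W X) :
    coinvDilate W X (coinvAct n c) = coinvAct n (coinvDilate W X c) := by
  obtain ⟨p, rfl⟩ := coinvMk_surjective W X c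
  simp [dilate_smul]

variable (W X) in
/-- A basis of the coinvariants made of monomials, in decreasing order of degrees. -/
structure GradedBasis where
  size : ℕ
  basis : Module.Basis (Fin size) ℂ (Coinv W X)
  deg : Fin size → ℕ
  antitone_deg : Antitone deg
  exists_mono : ∀ i, ∃ s : Multiset (Module.Dual ℂ V), s.card = deg i ∧ basis i = coinvMono W X s

theorem exists_gradedBasis [Module.Finite ℂ (Coinv W X)] : Nonempty (GradedBasis W X) := by
  let P : Set (Coinv W X) := Set.range (coinvMono W X)
  have hP : Submodule.span ℂ P = ⊤ := by
    rw [eq_top_iff]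
    rintro c -
    obtain ⟨p, rfl⟩ := coinvMk_surjective W X c
    have h1 : coinvMk W X p ∈ Algebra.adjoin ℂ (Set.range fun ℓ => coinvMk W X (lin ℓ)) := by
      induction p using SymmetricAlgebra.induction with
      | algebraMap c => rw [AlgHom.commutes]; exact Subalgebra.algebraMap_mem _ c
      | ι ℓ => exact Algebra.subset_adjoin ⟨ℓ, rfl⟩
      | mul a b ha hb => rw [map_mul]; exact mul_mem ha hb
      | add a b ha hb => rw [map_add]; exact add_mem ha hb
    rw [← Subalgebra.mem_toSubmodule, Algebra.adjoin_eq_span] at h1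
    refine Submodule.span_mono ?_ h1
    intro c hc
    obtain ⟨s, hs, rfl⟩ := Submonoid.exists_multiset_of_mem_closure hc
    choose! f hf using hs
    refine ⟨s.map f, ?_⟩
    rw [coinvMono, Multiset.map_map]
    conv_rhs => rw [← Multiset.map_id s]
    exact congrArg Multiset.prod (Multiset.map_congr rfl fun x hx => hf x hx)
  obtain ⟨b, hbP, hb, hli⟩ := exists_linearIndependent ℂ P
  have hfin : Finite b := hli.finite
  let B : Module.Basis b ℂ (Coinv W X) := Module.Basis.mk hli (by
    rw [Subtype.range_coe, hb, hP])
  choose! s hs using fun c (hc : c ∈ b) => hbP hc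
  have := Fintype.ofFinite b
  let e₀ := (Fintype.equivFin b).symm
  -- The order dual makes the sort decreasing, so that endomorphisms raising degrees have upper
  -- triangular matrices.
  let f : Fin (Fintype.card b) → ℕᵒᵈ := fun i => OrderDual.toDual (s (e₀ i)).card
  let e := (Tuple.sort f).trans e₀
  refine ⟨⟨_, B.reindex e.symm, fun i => (s (e i)).card, fun i j hij => ?_, fun i =>
    ⟨_, rfl, ?_⟩⟩⟩
  · exact Tuple.monotone_sort f hij
  · rw [Module.Basis.reindex_apply, Equiv.symm_symm, Module.Basis.mk_apply, hs _ (e i).2]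

namespace GradedBasis

variable (B : GradedBasis W X)

theorem coinvDilate_basis (i : Fin B.size) :
    coinvDilate W X (B.basis i) = (2 : ℂ) ^ B.deg i • B.basis i := by
  obtain ⟨s, hs, h⟩ := B.exists_mono i
  rw [h, coinvDilate_mono, hs]

/-- Basis elements are eigenvectors of the dilation with eigenvalues `2 ^ deg`, and distinct powers
of `2` differ. The single operator `coinvDilate` thus stands in for the grading. -/
theorem deg_eq_of_repr_ne_zero {c : Coinv W X} {d : ℕ}
    (hc : coinvDilate W X c = (2 : ℂ) ^ d • c) {k : Fin B.size} (hk : B.basis.repr c k ≠ 0) :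
    B.deg k = d := by
  have h1 : B.basis.repr (coinvDilate W X c) k = 2 ^ B.deg k * B.basis.repr c k := by
    conv_lhs => rw [← B.basis.sum_repr c]
    simp only [map_sum, map_smul, coinvDilate_basis, Finsupp.coe_finsetSum, Finset.sum_apply,
      Finsupp.smul_apply, Module.Basis.repr_self, smul_eq_mul]
    rw [Finset.sum_eq_single k]
    · rw [Finsupp.single_eq_same]; ring
    · intro i _ hi
      rw [Finsupp.single_eq_of_ne' hi]; ring
    · simp
  rw [hc, map_smul, Finsupp.smul_apply, smul_eq_mul] at h1
  have h2 := mul_right_cancel₀ hk h1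
  have h3 : (2 : ℕ) ^ d = 2 ^ B.deg k := by exact_mod_cast h2
  exact (Nat.pow_right_injective le_rfl h3).symm

theorem basis_eq_one {k : Fin B.size} (hk : B.deg k = 0) : B.basis k = 1 := by
  obtain ⟨s, hs, h⟩ := B.exists_mono k
  rw [hk, Multiset.card_eq_zero] at hs
  rw [h, hs]
  rfl

theorem exists_basis_eq_mul {k : Fin B.size} (hk : B.deg k ≠ 0) :
    ∃ (ℓ : Module.Dual ℂ V) (s : Multiset (Module.Dual ℂ V)), s.card + 1 = B.deg k ∧
      B.basis k = coinvMk W X (lin ℓ) * coinvMono W X s := by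
  obtain ⟨s, hs, h⟩ := B.exists_mono k
  induction s using Multiset.induction with
  | empty => exact absurd hs.symm hk
  | cons ℓ s _ => exact ⟨ℓ, s, by rw [← hs, Multiset.card_cons], by rw [h]; simp [coinvMono]⟩

theorem coinvPoint_basis {k : Fin B.size} (hk : B.deg k ≠ 0) :
    coinvPoint W X (B.basis k) = 0 := by
  obtain ⟨ℓ, s, -, h⟩ := B.exists_basis_eq_mul hk
  rw [h, map_mul, coinvPoint_mk, evalAt_lin, map_zero, zero_mul]

theorem deg_eq_of_mul {i j k : Fin B.size} (h : B.basis.repr (B.basis i * B.basis j) k ≠ 0) :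
    B.deg k = B.deg i + B.deg j :=
  B.deg_eq_of_repr_ne_zero (by
    rw [map_mul, coinvDilate_basis, coinvDilate_basis, smul_mul_smul_comm, pow_add]) h

theorem deg_eq_of_coinvAct {n : setStab W X} {j k : Fin B.size}
    (h : B.basis.repr (coinvAct n (B.basis j)) k ≠ 0) : B.deg k = B.deg j :=
  B.deg_eq_of_repr_ne_zero (by rw [coinvDilate_coinvAct, coinvDilate_basis, map_smul]) h

theorem deg_eq_of_one {k : Fin B.size} (h : B.basis.repr 1 k ≠ 0) : B.deg k = 0 :=
  B.deg_eq_of_repr_ne_zero (by rw [map_one, pow_zero, one_smul]) h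

variable (A : CommAlgCat.{0} ℂ)

/-- The basis of `A ⊗ C`. -/
def basisA : Module.Basis (Fin B.size) A (A ⊗[ℂ] Coinv W X) := B.basis.baseChange A

@[simp] theorem basisA_apply (i : Fin B.size) : B.basisA A i = 1 ⊗ₜ B.basis i := by
  simp [basisA]

theorem basisA_repr_tmul (a : A) (c : Coinv W X) (i : Fin B.size) :
    (B.basisA A).repr (a ⊗ₜ c) i = algebraMap ℂ A (B.basis.repr c i) * a := by
  rw [basisA, Module.Basis.baseChange_repr_tmul, Algebra.smul_def]

/-- The filtration of `A ⊗ C` by order of vanishing at the origin. -/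
def filtA (d : ℕ) : Submodule A (A ⊗[ℂ] Coinv W X) :=
  Submodule.span A {x | ∃ k, d ≤ B.deg k ∧ x = 1 ⊗ₜ B.basis k}

variable {A}

theorem tmul_mem_filtA {c : Coinv W X} {m d : ℕ} (hc : coinvDilate W X c = (2 : ℂ) ^ m • c)
    (h : d ≤ m) (a : A) : a ⊗ₜ c ∈ B.filtA A d := by
  rw [← B.basis.sum_repr c, tmul_sum]
  refine sum_mem fun k _ => ?_
  by_cases hk : B.basis.repr c k = 0
  · rw [hk, zero_smul, tmul_zero]; exact zero_mem _
  · have : a ⊗ₜ[ℂ] (B.basis.repr c k • B.basis k) =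
        (a * algebraMap ℂ A (B.basis.repr c k)) • ((1 : A) ⊗ₜ[ℂ] B.basis k) := by
      rw [← TensorProduct.smul_tmul, TensorProduct.smul_tmul', smul_eq_mul, mul_one,
        Algebra.smul_def, mul_comm]
    rw [this]
    exact Submodule.smul_mem _ _ (Submodule.subset_span
      ⟨k, h.trans (B.deg_eq_of_repr_ne_zero hc hk).ge, rfl⟩)

theorem tmul_mono_mem_filtA (s : Multiset (Module.Dual ℂ V)) {d : ℕ} (h : d ≤ s.card) (a : A) :
    a ⊗ₜ coinvMono W X s ∈ B.filtA A d :=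
  B.tmul_mem_filtA (coinvDilate_mono s) h a

theorem mul_mem_filtA {x y : A ⊗[ℂ] Coinv W X} {d e : ℕ} (hx : x ∈ B.filtA A d)
    (hy : y ∈ B.filtA A e) : x * y ∈ B.filtA A (d + e) := by
  have h := Submodule.mul_mem_mul hx hy
  rw [filtA, filtA, Submodule.span_mul_span] at h
  refine (Submodule.span_le.2 ?_ : _ ≤ B.filtA A (d + e)) h
  rintro _ ⟨_, ⟨i, hi, rfl⟩, _, ⟨j, hj, rfl⟩, rfl⟩
  simp only [Algebra.TensorProduct.tmul_mul_tmul, SetLike.mem_coe]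
  refine B.tmul_mem_filtA (m := B.deg i + B.deg j) ?_ (by omega) _
  rw [map_mul, coinvDilate_basis, coinvDilate_basis, smul_mul_smul_comm, pow_add]

theorem mem_filtA_iff {x : A ⊗[ℂ] Coinv W X} {d : ℕ} :
    x ∈ B.filtA A d ↔ ∀ k, B.deg k < d → (B.basisA A).repr x k = 0 := by
  constructor
  · intro hx k hk
    induction hx using Submodule.span_induction with
    | mem x hx =>
      obtain ⟨i, hi, rfl⟩ := hx
      rw [← basisA_apply, Module.Basis.repr_self, Finsupp.single_eq_of_ne]
      rintro rfl
      omega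
    | zero => simp
    | add x y _ _ hx hy => rw [map_add, Finsupp.add_apply, hx, hy, add_zero]
    | smul a x _ hx => rw [map_smul, Finsupp.smul_apply, hx, smul_zero]
  · intro h
    rw [← (B.basisA A).sum_repr x]
    refine sum_mem fun k _ => ?_
    by_cases hk : B.deg k < d
    · rw [h k hk, zero_smul]; exact zero_mem _
    · exact Submodule.smul_mem _ _ (Submodule.subset_span ⟨k, not_lt.1 hk, B.basisA_apply A k⟩)

theorem filtA_anti {d e : ℕ} (h : d ≤ e) : B.filtA A e ≤ B.filtA A d := fun _ hx =>
  B.mem_filtA_iff.2 fun k hk => B.mem_filtA_iff.1 hx k (hk.trans_le h)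

theorem mem_filtA_one {x : A ⊗[ℂ] Coinv W X} (h : pointA A (coinvPoint W X) x = 0) :
    x ∈ B.filtA A 1 := by
  refine B.mem_filtA_iff.2 fun k hk => ?_
  have hk0 : B.deg k = 0 := by omega
  rw [← (B.basisA A).sum_repr x, map_sum, Finset.sum_eq_single k] at h
  · simpa [B.basis_eq_one hk0] using h
  · intro i _ hi
    have : B.deg i ≠ 0 := fun hi0 => hi (B.basis.injective (by
      rw [B.basis_eq_one hi0, B.basis_eq_one hk0]))
    rw [map_smul, basisA_apply, pointA_tmul, B.coinvPoint_basis this]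
    simp
  · simp

end GradedBasis

end Grading

/-! ### Pointed automorphisms and automorphisms of the component -/

section Component

variable {V : Type} [AddCommGroup V] [Module ℂ V] {W : Subgroup (V ≃ₗ[ℂ] V)} {X : Submodule ℂ V}
variable {R : Type} [CommRing R] [Algebra ℂ R] [MulSemiringAction W R] [SMulCommClass W ℂ R]
variable {σ : R →ₐ[ℂ] ℂ}

variable (W X) in
/-- The `W_X`-equivariant automorphisms of `A ⊗ C` preserving the origin. -/
def coAut (A : CommAlgCat.{0} ℂ) : Subgroup (A ⊗[ℂ] Coinv W X ≃ₐ[A] A ⊗[ℂ] Coinv W X) where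
  carrier := {γ | (∀ (h : pointwiseStab W X) y,
      γ (coinvA A (toStab h) y) = coinvA A (toStab h) (γ y)) ∧
    ∀ y, pointA A (coinvPoint W X) (γ y) = pointA A (coinvPoint W X) y}
  mul_mem' {a b} ha hb := ⟨fun h y => by
    rw [AlgEquiv.mul_apply, hb.1, ha.1, AlgEquiv.mul_apply], fun y => by
    rw [AlgEquiv.mul_apply, ha.2, hb.2]⟩
  one_mem' := ⟨fun _ _ => rfl, fun _ => rfl⟩
  inv_mem' {a} ha := ⟨fun h y => by
    change a.symm _ = coinvA A (toStab h) (a.symm y)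
    rw [AlgEquiv.symm_apply_eq, ha.1, AlgEquiv.apply_symm_apply], fun y => by
    change pointA A _ (a.symm y) = _
    rw [← ha.2, AlgEquiv.apply_symm_apply]⟩

variable (A : CommAlgCat.{0} ℂ)

theorem isNilpotent_coinvA [Finite W] (y : A ⊗[ℂ] Coinv W X) :
    IsNilpotent (y - pointA A (coinvPoint W X) y • (1 : A ⊗[ℂ] Coinv W X)) := by
  induction y with
  | zero => simp
  | add x y hx hy =>
    rw [map_add, add_smul, add_sub_add_comm]
    exact (Commute.all _ _).isNilpotent_add hx hy
  | tmul a c =>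
    have h1 : a ⊗ₜ[ℂ] c - pointA A (coinvPoint W X) (a ⊗ₜ c) • (1 : A ⊗[ℂ] Coinv W X) =
        a ⊗ₜ (c - algebraMap ℂ _ (coinvPoint W X c)) := by
      rw [pointA_tmul, tmul_sub, Algebra.TensorProduct.one_def, TensorProduct.smul_tmul',
        smul_eq_mul, mul_one, Algebra.algebraMap_eq_smul_one (A := Coinv W X),
        ← TensorProduct.smul_tmul,
        Algebra.smul_def, mul_comm a]
    obtain ⟨n, hn⟩ := isNilpotent_coinv c
    rw [h1]
    refine ⟨n, ?_⟩
    rw [Algebra.TensorProduct.tmul_pow, hn, tmul_zero]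

/-- Evaluation at the origin has nil kernel over every `A`, so `1 - y` is both idempotent and
nilpotent. -/
theorem eq_one_of_idempotent [Finite W] {y : A ⊗[ℂ] Coinv W X} (hy : y * y = y)
    (h : pointA A (coinvPoint W X) y = 1) : y = 1 := by
  have h1 := isNilpotent_coinvA A y
  rw [h, one_smul] at h1
  have h3 : IsIdempotentElem (1 - y) := by
    change (1 - y) * (1 - y) = 1 - y
    linear_combination hy
  obtain ⟨n, hn⟩ := h1.neg
  rw [neg_sub] at hn
  rcases Nat.eq_zero_or_pos n with rfl | hpos
  · rw [pow_zero] at hn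
    rw [← mul_one y, hn, mul_zero]
  · rw [h3.pow_eq hpos.ne'] at hn
    exact (sub_eq_zero.1 hn).symm

namespace ComponentModel

variable (M : ComponentModel (W := W) X σ)

theorem resA_surjective : Function.Surjective (M.resA A) := fun y => ⟨_, M.resA_extA A y⟩

variable [Finite W]

variable {A} in
-- The image of the idempotent of the component is an idempotent with value `1` at `σ`. Pointed
-- automorphisms therefore preserve the component, and `descend` is well defined.
theorem resA_autAlgHom_extA_one {g : (autCover W R).pts A} (hg : g ∈ (autPointed W σ).pts A) :
    M.resA A (autAlgHom g (M.extA A 1)) = 1 := by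
  refine eq_one_of_idempotent A ?_ ?_
  · rw [← map_mul, ← map_mul, M.extA_one, M.idemA_mul_self]
  · rw [M.pointA_resA, (mem_autPointed A).1 hg, M.extA_one, M.pointA_idemA_one]

variable {A} in
theorem resA_autAlgHom_extA_resA {g : (autCover W R).pts A} (hg : g ∈ (autPointed W σ).pts A)
    (x : A ⊗[ℂ] R) :
    M.resA A (autAlgHom g (M.extA A (M.resA A x))) = M.resA A (autAlgHom g x) := by
  rw [M.extA_resA, map_mul, map_mul]
  have : (1 : A) ⊗ₜ[ℂ] M.ext 1 = M.extA A 1 := rfl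
  rw [this, M.resA_autAlgHom_extA_one hg, one_mul]

variable {A} in
/-- The action of a pointed automorphism on the functions on the component of `σ`. -/
def descend (g : (autPointed W σ).pts A) : A ⊗[ℂ] Coinv W X →ₐ[A] A ⊗[ℂ] Coinv W X :=
  AlgHom.ofLinearMap
    ((M.resA A).toLinearMap ∘ₗ (autAlgHom (A := A) (R := R) g.1).toLinearMap ∘ₗ M.extA A)
    (M.resA_autAlgHom_extA_one g.2)
    (fun x y => by
      obtain ⟨x, rfl⟩ := M.resA_surjective A x
      obtain ⟨y, rfl⟩ := M.resA_surjective A y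
      rw [← map_mul (M.resA A)]
      change M.resA A (autAlgHom (A := A) (R := R) g.1 (M.extA A (M.resA A (x * y)))) =
        M.resA A (autAlgHom (A := A) (R := R) g.1 (M.extA A (M.resA A x))) *
        M.resA A (autAlgHom (A := A) (R := R) g.1 (M.extA A (M.resA A y)))
      rw [M.resA_autAlgHom_extA_resA g.2, M.resA_autAlgHom_extA_resA g.2,
        M.resA_autAlgHom_extA_resA g.2, map_mul, map_mul])

variable {A} in
theorem descend_resA (g : (autPointed W σ).pts A) (x : A ⊗[ℂ] R) :
    M.descend g (M.resA A x) = M.resA A (autAlgHom (A := A) (R := R) g.1 x) :=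
  M.resA_autAlgHom_extA_resA g.2 x

variable {A} in
theorem descend_mul (g g' : (autPointed W σ).pts A) (y : A ⊗[ℂ] Coinv W X) :
    M.descend (g * g') y = M.descend g (M.descend g' y) := by
  obtain ⟨x, rfl⟩ := M.resA_surjective A y
  rw [descend_resA, descend_resA, descend_resA]
  rfl

variable {A} in
theorem descend_one (y : A ⊗[ℂ] Coinv W X) :
    M.descend (1 : (autPointed W σ).pts A) y = y := by
  obtain ⟨x, rfl⟩ := M.resA_surjective A y
  rw [descend_resA]
  rfl

theorem descend_coinvA (g : (autPointed W σ).pts A) (h : pointwiseStab W X)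
    (y : A ⊗[ℂ] Coinv W X) :
    M.descend g (coinvA A (toStab h) y) = coinvA A (toStab h) (M.descend g y) := by
  obtain ⟨x, rfl⟩ := M.resA_surjective A y
  rw [← M.resA_actA, descend_resA, descend_resA]
  exact (congrArg (M.resA A) (autAlgHom_actA A g.1 (h : W) x)).trans (M.resA_actA A h _)

theorem pointA_descend (g : (autPointed W σ).pts A) (y : A ⊗[ℂ] Coinv W X) :
    pointA A (coinvPoint W X) (M.descend g y) = pointA A (coinvPoint W X) y := by
  obtain ⟨x, rfl⟩ := M.resA_surjective A y
  rw [descend_resA, M.pointA_resA, M.pointA_resA, (mem_autPointed A).1 g.2]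

theorem equivariant_comp_resA (γ : coAut W X A) :
    Equivariant A ((γ.1 : A ⊗[ℂ] Coinv W X →ₐ[A] A ⊗[ℂ] Coinv W X).comp (M.resA A)) := by
  intro h x
  change γ.1 (M.resA A (actA A (h : W) x)) = coinvA A (toStab h) (γ.1 (M.resA A x))
  rw [M.resA_actA, γ.2.1]

/-- The automorphism of `A ⊗ R` induced by an automorphism of the component of `σ`. -/
def ascendHom (γ : coAut W X A) : A ⊗[ℂ] R →ₐ[A] A ⊗[ℂ] R :=
  M.indAlg A _ (M.equivariant_comp_resA A γ)

theorem resA_ascendHom (γ : coAut W X A) (x : A ⊗[ℂ] R) :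
    M.resA A (M.ascendHom A γ x) = γ.1 (M.resA A x) :=
  M.resA_indAlg A _ (M.equivariant_comp_resA A γ) x

theorem ascendHom_actA (γ : coAut W X A) (w : W) (x : A ⊗[ℂ] R) :
    M.ascendHom A γ (actA A w x) = actA A w (M.ascendHom A γ x) :=
  M.indAlg_actA A _ (M.equivariant_comp_resA A γ) w x

theorem ascendHom_comp (γ δ : coAut W X A) (h : γ * δ = 1) (x : A ⊗[ℂ] R) :
    M.ascendHom A γ (M.ascendHom A δ x) = x := by
  refine congrFun (M.eq_of_resA_comp A (G := fun x => M.ascendHom A γ (M.ascendHom A δ x))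
    (G' := id) (fun w x => ?_) (fun _ _ => rfl) fun x => ?_) x
  · simp only [M.ascendHom_actA]
  · rw [resA_ascendHom, resA_ascendHom]
    exact congrArg (fun ε : coAut W X A => ε.1 (M.resA A x)) h

/-- Pointed automorphisms of the cover are the automorphisms of the component of `σ`. -/
def pointedEquiv : (autPointed W σ).pts A ≃* coAut W X A where
  toFun g := ⟨AlgEquiv.ofAlgHom (M.descend g) (M.descend g⁻¹)
    (AlgHom.ext fun y => by
      change M.descend g (M.descend g⁻¹ y) = y
      rw [← descend_mul, mul_inv_cancel, descend_one])
    (AlgHom.ext fun y => by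
      change M.descend g⁻¹ (M.descend g y) = y
      rw [← descend_mul, inv_mul_cancel, descend_one]),
    M.descend_coinvA A g, M.pointA_descend A g⟩
  invFun γ := ⟨autOfAlgHom A (M.ascendHom A γ) (M.ascendHom A γ⁻¹)
    (M.ascendHom_comp A _ _ (mul_inv_cancel γ)) (M.ascendHom_comp A _ _ (inv_mul_cancel γ))
    (M.ascendHom_actA A γ), (mem_autPointed A).2 fun x => by
      rw [← M.pointA_resA, ← M.pointA_resA]
      change pointA A _ (M.resA A (M.ascendHom A γ x)) = _
      rw [resA_ascendHom, γ.2.2]⟩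
  left_inv g := by
    refine Subtype.ext (autCover_ext A fun x => ?_)
    refine congrFun (M.eq_of_resA_comp A (G := fun x => M.ascendHom A _ x)
      (G' := fun x => autAlgHom (A := A) (R := R) g.1 x) (M.ascendHom_actA A _)
      (autAlgHom_actA A g.1) fun x => ?_) x
    rw [resA_ascendHom]
    exact M.descend_resA g x
  right_inv γ := by
    refine Subtype.ext (AlgEquiv.ext fun y => ?_)
    obtain ⟨x, rfl⟩ := M.resA_surjective A y
    change M.descend _ (M.resA A x) = _
    rw [descend_resA]
    exact M.resA_ascendHom A γ x
  map_mul' g g' := Subtype.ext (AlgEquiv.ext fun y => M.descend_mul g g' y)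

theorem pointedEquiv_resA (g : (autPointed W σ).pts A) (x : A ⊗[ℂ] R) :
    (M.pointedEquiv A g).1 (M.resA A x) = M.resA A (autAlgHom (A := A) (R := R) g.1 x) :=
  M.descend_resA g x

variable {A} in
theorem pointedEquiv_map {B : CommAlgCat.{0} ℂ} (f : A ⟶ B) (g : (autPointed W σ).pts A)
    (y : A ⊗[ℂ] Coinv W X) :
    (M.pointedEquiv B ((autPointed W σ).toFunctor.map f g : (autPointed W σ).pts B)).1
      (baseMap _ f y) = baseMap _ f ((M.pointedEquiv A g).1 y) := by
  obtain ⟨x, rfl⟩ := M.resA_surjective A y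
  rw [← bc_baseMap, M.pointedEquiv_resA, ← bc_baseMap]
  exact (M.pointedEquiv_resA B _ _).trans (congrArg (M.resA B) (autAlgHom_map f g.1 x))

end ComponentModel

end Component

/-! ### The tangent space at the base point -/

section Tangent

variable {V : Type} [AddCommGroup V] [Module ℂ V] {W : Subgroup (V ≃ₗ[ℂ] V)} {X : Submodule ℂ V}
variable {R : Type} [CommRing R] [Algebra ℂ R] [MulSemiringAction W R] [SMulCommClass W ℂ R]
variable {σ : R →ₐ[ℂ] ℂ}

@[simp] theorem tangentPairing_tmul (A : CommAlgCat.{0} ℂ) (a b : A) (D : tangentSpace σ) (r : R) :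
    tangentPairing σ A (a ⊗ₜ D) (b ⊗ₜ r) = a * (b * algebraMap ℂ A (D.1 r)) := by
  simp [tangentPairing]

theorem linearMap_ext_coinvA {A : CommAlgCat.{0} ℂ} {N : Type} [AddCommGroup N] [Module A N]
    {F G : A ⊗[ℂ] Coinv W X →ₗ[A] N} (h : ∀ c, F (1 ⊗ₜ c) = G (1 ⊗ₜ c)) : F = G := by
  refine LinearMap.ext fun x => ?_
  induction x with
  | zero => simp
  | add x y hx hy => simp only [map_add, hx, hy]
  | tmul a c =>
    have : a ⊗ₜ[ℂ] c = a • ((1 : A) ⊗ₜ[ℂ] c) := by simp [TensorProduct.smul_tmul']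
    rw [this, map_smul, map_smul, h]

theorem coinvHom_ext {A : CommAlgCat.{0} ℂ} {B : Type} [CommRing B] [Algebra A B]
    {F G : A ⊗[ℂ] Coinv W X →ₐ[A] B}
    (h : ∀ ℓ : Module.Dual ℂ V, F (1 ⊗ₜ coinvMk W X (lin ℓ)) = G (1 ⊗ₜ coinvMk W X (lin ℓ))) :
    F = G := by
  refine algHom_tensor_ext A fun c => ?_
  obtain ⟨p, rfl⟩ := coinvMk_surjective W X c
  induction p using SymmetricAlgebra.induction with
  | algebraMap c =>
    have : (1 : A) ⊗ₜ[ℂ] coinvMk W X (algebraMap ℂ _ c) =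
        algebraMap ℂ A c • (1 : A ⊗[ℂ] Coinv W X) := by
      rw [AlgHom.commutes, Algebra.algebraMap_eq_smul_one, ← TensorProduct.smul_tmul,
        Algebra.TensorProduct.one_def, TensorProduct.smul_tmul', smul_eq_mul, mul_one,
        ← Algebra.algebraMap_eq_smul_one]
    rw [this, map_smul, map_smul, map_one, map_one]
  | ι ℓ => exact h ℓ
  | mul a b ha hb =>
    have : (1 : A) ⊗ₜ[ℂ] coinvMk W X (a * b) = (1 ⊗ₜ coinvMk W X a) * (1 ⊗ₜ coinvMk W X b) := by
      rw [Algebra.TensorProduct.tmul_mul_tmul, one_mul, map_mul]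
    rw [this, map_mul, map_mul, ha, hb]
  | add a b ha hb => rw [map_add, tmul_add, map_add, map_add, ha, hb]

variable (A : CommAlgCat.{0} ℂ)

/-- `A`-linear derivations of `A ⊗ C` at the origin. -/
def IsPointDerivation (E : A ⊗[ℂ] Coinv W X →ₗ[A] A) : Prop :=
  ∀ y z, E (y * z) = pointA A (coinvPoint W X) y * E z + pointA A (coinvPoint W X) z * E y

variable {A} in
theorem IsPointDerivation.apply_one {E : A ⊗[ℂ] Coinv W X →ₗ[A] A} (h : IsPointDerivation A E) :
    E 1 = 0 := by
  have := h 1 1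
  rwa [mul_one, map_one (pointA A _), one_mul, left_eq_add] at this

/-- In degree zero the basis element is `1`; in degree at least two it is a product of two functions
vanishing at the origin. Tangent vectors see degree one only. -/
theorem GradedBasis.pointDerivation_apply (B : GradedBasis W X) {E : A ⊗[ℂ] Coinv W X →ₗ[A] A}
    (h : IsPointDerivation A E) {k : Fin B.size} (hk : B.deg k ≠ 1) : E (1 ⊗ₜ B.basis k) = 0 := by
  by_cases h0 : B.deg k = 0
  · rw [B.basis_eq_one h0, ← Algebra.TensorProduct.one_def, h.apply_one]
  · obtain ⟨ℓ, s, hs, hk'⟩ := B.exists_basis_eq_mul h0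
    have hs0 : coinvPoint W X (coinvMono W X s) = 0 := by
      induction s using Multiset.induction with
      | empty => exact absurd hs.symm (by simpa using hk)
      | cons m s _ => simp [coinvMono]
    have h1 := h (1 ⊗ₜ coinvMk W X (lin ℓ)) (1 ⊗ₜ coinvMono W X s)
    rw [Algebra.TensorProduct.tmul_mul_tmul, one_mul, ← hk', pointA_tmul, pointA_tmul, hs0,
      coinvPoint_mk, evalAt_lin, map_zero, map_zero, mul_zero, zero_mul, zero_mul, add_zero] at h1
    exact h1

namespace ComponentModel

variable [Finite W] (M : ComponentModel (W := W) X σ)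

theorem tangent_ext_one (M : ComponentModel (W := W) X σ) (D : tangentSpace σ) :
    D.1 (M.ext 1) = 0 := by
  have h1 := D.2 (M.ext 1) (M.ext 1)
  have h2 : σ (M.ext 1) = 1 := by rw [← M.point_res, M.res_ext, map_one]
  rw [M.ext_mul_ext_one, h2, one_mul, left_eq_add] at h1
  exact h1

theorem tangent_ext_res (D : tangentSpace σ) (r : R) : D.1 (M.ext (M.res r)) = D.1 r := by
  have h2 : σ (M.ext 1) = 1 := by rw [← M.point_res, M.res_ext, map_one]
  rw [M.ext_res, D.2, h2, one_mul, M.tangent_ext_one, mul_zero, add_zero]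

/-- The pairing of tangent vectors with functions on the component of `σ`. -/
def pairA : A ⊗[ℂ] tangentSpace σ →ₗ[A] A ⊗[ℂ] Coinv W X →ₗ[A] A :=
  (tangentPairing σ A).compl₂ (M.extA A)

@[simp] theorem pairA_tmul (a b : A) (D : tangentSpace σ) (c : Coinv W X) :
    M.pairA A (a ⊗ₜ D) (b ⊗ₜ c) = a * (b * algebraMap ℂ A (D.1 (M.ext c))) :=
  tangentPairing_tmul A a b D (M.ext c)

theorem pairA_resA (τ : A ⊗[ℂ] tangentSpace σ) (x : A ⊗[ℂ] R) :
    M.pairA A τ (M.resA A x) = tangentPairing σ A τ x := by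
  induction τ with
  | zero => simp
  | add τ τ' h h' => simp only [map_add, LinearMap.add_apply, h, h']
  | tmul a D =>
    induction x with
    | zero => simp
    | add x y hx hy => simp only [map_add, hx, hy]
    | tmul b r => rw [bc_tmul, pairA_tmul, M.tangent_ext_res, tangentPairing_tmul]

theorem isPointDerivation_pairA (τ : A ⊗[ℂ] tangentSpace σ) :
    IsPointDerivation A (M.pairA A τ) := by
  intro y z
  induction τ with
  | zero => simp
  | add τ τ' h h' => simp only [map_add, LinearMap.add_apply, h, h']; ring
  | tmul a D =>
    induction y with
    | zero => simp
    | add y y' hy hy' => simp only [map_add, add_mul, hy, hy']; ring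
    | tmul b c =>
      induction z with
      | zero => simp
      | add z z' hz hz' => simp only [map_add, mul_add, hz, hz']; ring
      | tmul b' c' =>
        have h1 : D.1 (M.ext (c * c')) = coinvPoint W X c * D.1 (M.ext c') +
            coinvPoint W X c' * D.1 (M.ext c) := by
          rw [← M.res_ext c, ← M.res_ext c', ← map_mul, M.tangent_ext_res, D.2, M.res_ext,
            M.res_ext, ← M.point_res, ← M.point_res, M.res_ext, M.res_ext]
        rw [Algebra.TensorProduct.tmul_mul_tmul, pairA_tmul, h1, pairA_tmul, pairA_tmul,
          pointA_tmul, pointA_tmul, map_add, map_mul, map_mul]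
        ring

section Dual

variable (B : GradedBasis W X)

/-- The tangent vectors dual to the basis elements of degree one. -/
def tangentDual (k : Fin B.size) : tangentSpace σ :=
  -- A degree-one coordinate is a derivation because a product of basis elements of positive degree
  -- has degree at least two. The default `0` in other degrees lets later sums run over the whole
  -- basis.
  if h : B.deg k = 1 then ⟨B.basis.coord k ∘ₗ M.res.toLinearMap, fun r s => by
    have key : ∀ c c' : Coinv W X, B.basis.repr (c * c') k =
        coinvPoint W X c * B.basis.repr c' k + coinvPoint W X c' * B.basis.repr c k := by
      have hb : ∀ i j, B.basis.repr (B.basis i * B.basis j) k =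
          coinvPoint W X (B.basis i) * B.basis.repr (B.basis j) k +
            coinvPoint W X (B.basis j) * B.basis.repr (B.basis i) k := by
        intro i j
        by_cases hi : B.deg i = 0
        · by_cases hj : B.deg j = 0
          · have h1 : B.basis.repr (1 : Coinv W X) k = 0 := by
              by_contra h1
              have := B.deg_eq_of_one h1
              omega
            rw [B.basis_eq_one hi, B.basis_eq_one hj, one_mul, h1]
            simp
          · rw [B.coinvPoint_basis hj, B.basis_eq_one hi, one_mul, map_one (coinvPoint W X)]
            simp
        · by_cases hj : B.deg j = 0
          · rw [B.coinvPoint_basis hi, B.basis_eq_one hj, mul_one, map_one (coinvPoint W X)]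
            simp
          · rw [B.coinvPoint_basis hi, B.coinvPoint_basis hj, zero_mul, zero_mul, add_zero]
            by_contra h1
            have := B.deg_eq_of_mul h1
            omega
      have hb' : ∀ c j, B.basis.repr (c * B.basis j) k =
          coinvPoint W X c * B.basis.repr (B.basis j) k +
            coinvPoint W X (B.basis j) * B.basis.repr c k := by
        intro c j
        rw [← B.basis.sum_repr c]
        simp only [Finset.sum_mul, map_sum, Finsupp.coe_finsetSum, Finset.sum_apply, smul_mul_assoc,
          map_smul, Finsupp.smul_apply, smul_eq_mul, hb, Finset.mul_sum]
        rw [← Finset.sum_add_distrib]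
        exact Finset.sum_congr rfl fun i _ => by ring
      intro c c'
      rw [← B.basis.sum_repr c']
      simp only [Finset.mul_sum, map_sum, Finsupp.coe_finsetSum, Finset.sum_apply, mul_smul_comm,
        map_smul, Finsupp.smul_apply, smul_eq_mul, hb', Finset.sum_mul]
      rw [← Finset.sum_add_distrib]
      exact Finset.sum_congr rfl fun i _ => by ring
    change B.basis.repr (M.res (r * s)) k = σ r * B.basis.repr (M.res s) k +
      σ s * B.basis.repr (M.res r) k
    rw [map_mul, key, M.point_res, M.point_res]⟩ else 0

theorem tangentDual_ext {k : Fin B.size} (hk : B.deg k = 1) (c : Coinv W X) :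
    (M.tangentDual B k).1 (M.ext c) = B.basis.repr c k := by
  rw [tangentDual, dif_pos hk]
  change B.basis.repr (M.res (M.ext c)) k = _
  rw [M.res_ext]

theorem tangentDual_eq_zero {k : Fin B.size} (hk : B.deg k ≠ 1) : M.tangentDual B k = 0 := by
  rw [tangentDual, dif_neg hk]

theorem pairA_tangentDual {k : Fin B.size} (hk : B.deg k = 1) (y : A ⊗[ℂ] Coinv W X) :
    M.pairA A (1 ⊗ₜ M.tangentDual B k) y = (B.basisA A).repr y k := by
  induction y with
  | zero => simp
  | add x y hx hy => rw [map_add, map_add, Finsupp.add_apply, hx, hy]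
  | tmul a c => rw [pairA_tmul, M.tangentDual_ext B hk, B.basisA_repr_tmul]; ring

/-- Point derivations come from tangent vectors. -/
theorem pairA_sum_tangentDual {E : A ⊗[ℂ] Coinv W X →ₗ[A] A} (hE : IsPointDerivation A E)
    (y : A ⊗[ℂ] Coinv W X) :
    M.pairA A (∑ k, E (1 ⊗ₜ B.basis k) • ((1 : A) ⊗ₜ M.tangentDual B k)) y = E y := by
  simp only [map_sum, map_smul, LinearMap.sum_apply, LinearMap.smul_apply]
  conv_rhs => rw [← (B.basisA A).sum_repr y, map_sum]
  refine Finset.sum_congr rfl fun k _ => ?_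
  rw [map_smul, B.basisA_apply]
  by_cases hk : B.deg k = 1
  · rw [M.pairA_tangentDual A B hk, smul_eq_mul, smul_eq_mul, mul_comm]
  · rw [B.pointDerivation_apply A hE hk, zero_smul, smul_zero]

theorem sum_pairA_tangentDual (τ : A ⊗[ℂ] tangentSpace σ) :
    ∑ k, M.pairA A τ (1 ⊗ₜ B.basis k) • ((1 : A) ⊗ₜ M.tangentDual B k) = τ := by
  induction τ with
  | zero => simp
  | add τ τ' h h' =>
    simp only [map_add, LinearMap.add_apply, add_smul, Finset.sum_add_distrib, h, h']
  | tmul a D =>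
    have h1 : D = ∑ k, D.1 (M.ext (B.basis k)) • M.tangentDual B k := by
      refine Subtype.ext (LinearMap.ext fun r => ?_)
      rw [← M.tangent_ext_res, ← B.basis.sum_repr (M.res r)]
      simp only [map_sum, map_smul, Submodule.coe_sum, Submodule.coe_smul, LinearMap.sum_apply,
        LinearMap.smul_apply]
      refine Finset.sum_congr rfl fun k _ => ?_
      by_cases hk : B.deg k = 1
      · rw [← M.tangent_ext_res (M.tangentDual B k), M.tangentDual_ext B hk, smul_eq_mul, smul_eq_mul, mul_comm]
      -- The vanishing of derivations outside degree one is available after base change, so it is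
      -- applied with `A = ℂ`.
      · have h2 := B.pointDerivation_apply (CommAlgCat.of ℂ ℂ)
          (M.isPointDerivation_pairA (CommAlgCat.of ℂ ℂ) ((1 : ℂ) ⊗ₜ D)) hk
        have h3 : D.1 (M.ext (B.basis k)) = 0 := by
          have h4 := M.pairA_tmul (CommAlgCat.of ℂ ℂ) (1 : ℂ) (1 : ℂ) D (B.basis k)
          rw [one_mul, one_mul] at h4
          exact h4.symm.trans h2
        rw [h3, M.tangentDual_eq_zero B hk]
        simp
    conv_rhs => rw [h1, tmul_sum]
    refine Finset.sum_congr rfl fun k _ => ?_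
    rw [pairA_tmul, one_mul, TensorProduct.smul_tmul', smul_eq_mul, mul_one,
      ← TensorProduct.smul_tmul, Algebra.smul_def, mul_comm]

theorem pairA_injective (B : GradedBasis W X) {τ τ' : A ⊗[ℂ] tangentSpace σ} (h : ∀ y, M.pairA A τ y = M.pairA A τ' y) :
    τ = τ' := by
  rw [← M.sum_pairA_tangentDual A B τ, ← M.sum_pairA_tangentDual A B τ']
  simp only [h]

end Dual

end ComponentModel

end Tangent

/-! ### The tangent action and its splitting -/

section TangentAction

variable {V : Type} [AddCommGroup V] [Module ℂ V] {W : Subgroup (V ≃ₗ[ℂ] V)} {X : Submodule ℂ V}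
variable {R : Type} [CommRing R] [Algebra ℂ R] [MulSemiringAction W R] [SMulCommClass W ℂ R]
variable {σ : R →ₐ[ℂ] ℂ}

theorem tmul_complex_smul {A : CommAlgCat.{0} ℂ} (a : A) (z : ℂ) (c : Coinv W X) :
    a ⊗ₜ[ℂ] (z • c) = algebraMap ℂ A z • (a ⊗ₜ[ℂ] c) := by
  rw [← TensorProduct.smul_tmul, TensorProduct.smul_tmul', Algebra.smul_def, smul_eq_mul]

namespace ComponentModel

variable [Finite W] (M : ComponentModel (W := W) X σ) (B : GradedBasis W X) (A : CommAlgCat.{0} ℂ)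

theorem pairA_tangentAct (w : pointStab (W := W) σ) (h : pointwiseStab W X) (hw : (w : W) = h)
    (τ : A ⊗[ℂ] tangentSpace σ) (y : A ⊗[ℂ] Coinv W X) :
    M.pairA A ((tangentAct σ w).baseChange A τ) y = M.pairA A τ (coinvA A (toStab h⁻¹) y) := by
  induction τ with
  | zero => simp
  | add τ τ' h h' => simp only [map_add, LinearMap.add_apply, h, h']
  | tmul a D =>
    induction y with
    | zero => simp
    | add x y hx hy => simp only [map_add, hx, hy]
    | tmul b c =>
      rw [LinearMap.baseChange_tmul, bc_tmul, pairA_tmul, pairA_tmul, M.ext_coinvAct]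
      change a * (b * algebraMap ℂ A (D.1 (((w⁻¹ : pointStab (W := W) σ) : W) • M.ext c))) = _
      rw [Subgroup.coe_inv, Subgroup.coe_inv, hw]

variable {A} in
theorem pairA_baseMap {A' : CommAlgCat.{0} ℂ} (f : A ⟶ A') (τ : A ⊗[ℂ] tangentSpace σ)
    (y : A ⊗[ℂ] Coinv W X) :
    M.pairA A' (baseMap _ f τ) (baseMap _ f y) = f.hom (M.pairA A τ y) := by
  induction τ with
  | zero => simp
  | add τ τ' h h' => simp only [map_add, LinearMap.add_apply, h, h']
  | tmul a D =>
    induction y with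
    | zero => simp
    | add x y hx hy => simp only [map_add, hx, hy]
    | tmul b c => simp

/-- The differential of an automorphism of the component of `σ`. -/
def tanMap (γ : coAut W X A) : Module.End A (A ⊗[ℂ] tangentSpace σ) :=
  ∑ k, LinearMap.smulRight ((M.pairA A).flip ((γ⁻¹).1 (1 ⊗ₜ B.basis k)))
    ((1 : A) ⊗ₜ[ℂ] M.tangentDual B k)

/-- `y ↦ ⟨τ, γ⁻¹ y⟩` is again a derivation at the origin, because `γ` preserves it, and it is
represented by the tangent vector with coordinates its values on the basis. -/
theorem pairA_tanMap (γ : coAut W X A) (τ : A ⊗[ℂ] tangentSpace σ) (y : A ⊗[ℂ] Coinv W X) :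
    M.pairA A (M.tanMap B A γ τ) y = M.pairA A τ ((γ⁻¹).1 y) := by
  have h1 : IsPointDerivation A ((M.pairA A τ) ∘ₗ ((γ⁻¹).1.toLinearMap)) := by
    intro x z
    have h2 := M.isPointDerivation_pairA A τ ((γ⁻¹).1 x) ((γ⁻¹).1 z)
    rw [(γ⁻¹).2.2, (γ⁻¹).2.2, ← map_mul] at h2
    exact h2
  have h3 := M.pairA_sum_tangentDual A B h1 y
  rw [tanMap, LinearMap.sum_apply]
  exact h3

/-- The action of automorphisms of the component of `σ` on the tangent space. -/
def tanEnd : coAut W X A →* Module.End A (A ⊗[ℂ] tangentSpace σ) where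
  toFun := M.tanMap B A
  map_one' := LinearMap.ext fun τ => M.pairA_injective A B fun y => by
    rw [pairA_tanMap, inv_one]
    rfl
  map_mul' γ δ := LinearMap.ext fun τ => M.pairA_injective A B fun y => by
    rw [pairA_tanMap, Module.End.mul_apply, pairA_tanMap, pairA_tanMap, mul_inv_rev]
    rfl

variable (hσ : pointStab σ = pointwiseStab W X)

/-- The action of automorphisms of the component of `σ` on the tangent space, by automorphisms
of representations. -/
def tanHom : coAut W X A →* (autTangent W σ).pts A :=
  (M.tanEnd B A).toHomUnits.codRestrict _ fun γ w τ => by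
    change M.tanMap B A γ _ = (tangentAct σ w).baseChange A (M.tanMap B A γ τ)
    have hw : (w : W) ∈ pointwiseStab W X := hσ ▸ w.2
    refine M.pairA_injective A B fun y => ?_
    rw [pairA_tanMap, M.pairA_tangentAct A w ⟨w, hw⟩ rfl, M.pairA_tangentAct A w ⟨w, hw⟩ rfl,
      pairA_tanMap, (γ⁻¹).2.1]

theorem tanHom_apply (γ : coAut W X A) (τ : A ⊗[ℂ] tangentSpace σ) :
    (M.tanHom B A hσ γ).1.1 τ = M.tanMap B A γ τ := rfl

/-- The tangent action. -/
def tangentMap : (autPointed W σ).toFunctor ⟶ (autTangent W σ).toFunctor where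
  app A := GrpCat.ofHom ((M.tanHom B A hσ).comp (M.pointedEquiv A).toMonoidHom)
  naturality A A' f := by
    refine GrpCat.hom_ext (MonoidHom.ext fun (g : (autPointed W σ).pts A) => ?_)
    refine Subtype.ext (Units.ext (end_ext fun D => ?_))
    change M.tanMap B A' (M.pointedEquiv A' _) (1 ⊗ₜ D) = endMapFun _ f _ (1 ⊗ₜ D)
    have h1 : (1 : A') ⊗ₜ[ℂ] D = baseMap _ f ((1 : A) ⊗ₜ[ℂ] D) := by
      rw [baseMap_tmul, map_one]
    rw [h1, endMapFun_baseMap]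
    refine M.pairA_injective A' B fun y => ?_
    refine LinearMap.congr_fun (linearMap_ext_coinvA fun c => ?_) y
    have h2 : (1 : A') ⊗ₜ[ℂ] c = baseMap _ f ((1 : A) ⊗ₜ[ℂ] c) := by
      rw [baseMap_tmul, map_one]
    rw [h2, M.pairA_tanMap B A', M.pairA_baseMap]
    change _ = f.hom (M.pairA A (M.tanMap B A (M.pointedEquiv A g) (1 ⊗ₜ D)) _)
    rw [M.pairA_tanMap, ← M.pairA_baseMap, ← map_inv (M.pointedEquiv A), ← M.pointedEquiv_map]
    congr 1

theorem isTangentAction_tangentMap : IsTangentAction W σ (M.tangentMap B hσ) := by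
  rintro A g h hgh τ x
  have h1 : M.tanHom B A hσ (M.pointedEquiv A g) = h := hgh
  subst h1
  rw [tanHom_apply, ← M.pairA_resA, ← M.pairA_resA, M.pairA_tanMap]
  congr 1
  refine (congrArg (M.pointedEquiv A g).1.symm (M.pointedEquiv_resA A g x).symm).trans ?_
  rw [AlgEquiv.symm_apply_apply]

/-- The action on degree one functions adjoint to an endomorphism of the tangent space. -/
def adjMap (g : Module.End A (A ⊗[ℂ] tangentSpace σ)) :
    A ⊗[ℂ] Coinv W X →ₗ[A] A ⊗[ℂ] Coinv W X :=
  ∑ k, LinearMap.smulRight (M.pairA A (g (1 ⊗ₜ M.tangentDual B k))) ((1 : A) ⊗ₜ[ℂ] B.basis k)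

theorem adjMap_apply (g : Module.End A (A ⊗[ℂ] tangentSpace σ)) (y : A ⊗[ℂ] Coinv W X) :
    M.adjMap B A g y =
      ∑ k, M.pairA A (g (1 ⊗ₜ M.tangentDual B k)) y • ((1 : A) ⊗ₜ[ℂ] B.basis k) := by
  rw [adjMap, LinearMap.sum_apply]
  rfl

theorem pairA_adjMap (g : Module.End A (A ⊗[ℂ] tangentSpace σ)) (τ : A ⊗[ℂ] tangentSpace σ)
    (y : A ⊗[ℂ] Coinv W X) : M.pairA A τ (M.adjMap B A g y) = M.pairA A (g τ) y := by
  conv_rhs => rw [← M.sum_pairA_tangentDual A B τ]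
  simp only [adjMap_apply, map_sum, map_smul, LinearMap.sum_apply, LinearMap.smul_apply,
    smul_eq_mul, mul_comm]

variable (W X) in
/-- Functions of degree one on the component of `σ`. -/
def IsDegreeOne (y : A ⊗[ℂ] Coinv W X) : Prop :=
  bc A (coinvDilate W X) y = algebraMap ℂ A 2 • y

theorem isDegreeOne_lin (ℓ : Module.Dual ℂ V) :
    IsDegreeOne W X A (1 ⊗ₜ coinvMk W X (lin ℓ)) := by
  rw [IsDegreeOne, bc_tmul, coinvDilate_mk, dilate_lin, map_smul, tmul_complex_smul]

theorem isDegreeOne_adjMap (g : Module.End A (A ⊗[ℂ] tangentSpace σ)) (y : A ⊗[ℂ] Coinv W X) :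
    IsDegreeOne W X A (M.adjMap B A g y) := by
  rw [IsDegreeOne, adjMap_apply, map_sum, Finset.smul_sum]
  refine Finset.sum_congr rfl fun k _ => ?_
  by_cases hk : B.deg k = 1
  · rw [map_smul, bc_tmul, B.coinvDilate_basis, hk, pow_one, tmul_complex_smul, smul_comm]
  · rw [M.tangentDual_eq_zero B hk, tmul_zero, map_zero, map_zero, LinearMap.zero_apply, zero_smul,
      map_zero, smul_zero]

/-- Degree-one coordinates are pairings with tangent vectors. On a coordinate of degree `d ≠ 1` the
eigenvalue `2` of the dilation conflicts with `2 ^ d`, and `2 - 2 ^ d` is a unit, so that coordinate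
is zero. -/
theorem eq_of_pairA_eq (B : GradedBasis W X) {y z : A ⊗[ℂ] Coinv W X} (hy : IsDegreeOne W X A y)
    (hz : IsDegreeOne W X A z) (h : ∀ τ, M.pairA A τ y = M.pairA A τ z) : y = z := by
  refine (B.basisA A).ext_elem fun k => ?_
  by_cases hk : B.deg k = 1
  · rw [← M.pairA_tangentDual A B hk, ← M.pairA_tangentDual A B hk, h]
  · have key : ∀ y, IsDegreeOne W X A y → (B.basisA A).repr y k = 0 := by
      intro y hy
      have h1 : ∀ y, (B.basisA A).repr (bc A (coinvDilate W X) y) k =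
          algebraMap ℂ A (2 ^ B.deg k) * (B.basisA A).repr y k := by
        intro y
        induction y with
        | zero => simp
        | add x y hx hy => simp only [map_add, Finsupp.add_apply, hx, hy, mul_add]
        | tmul a c =>
          rw [bc_tmul, B.basisA_repr_tmul, B.basisA_repr_tmul, ← mul_assoc, ← map_mul]
          congr 2
          conv_lhs => rw [← B.basis.sum_repr c]
          simp only [map_sum, map_smul, B.coinvDilate_basis, Finsupp.coe_finsetSum,
            Finset.sum_apply, Finsupp.smul_apply, Module.Basis.repr_self, smul_eq_mul]
          rw [Finset.sum_eq_single k]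
          · rw [Finsupp.single_eq_same]; ring
          · intro i _ hi
            rw [Finsupp.single_eq_of_ne' hi]; ring
          · simp
      have h2 := h1 y
      rw [hy, map_smul, Finsupp.smul_apply, smul_eq_mul, ← sub_eq_zero, ← sub_mul, ← map_sub] at h2
      have h3 : IsUnit (algebraMap ℂ A (2 - 2 ^ B.deg k)) := by
        refine (IsUnit.mk0 _ ?_).map _
        rw [sub_ne_zero]
        intro h4
        have h5 : (2 : ℕ) ^ 1 = 2 ^ B.deg k := by rw [pow_one]; exact_mod_cast h4
        exact hk (Nat.pow_right_injective le_rfl h5).symm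
      exact h3.mul_right_eq_zero.1 h2
    rw [key y hy, key z hz]

theorem pairA_coinvA (h : pointwiseStab W X) (τ : A ⊗[ℂ] tangentSpace σ)
    (y : A ⊗[ℂ] Coinv W X) : M.pairA A τ (coinvA A (toStab h) y) =
      M.pairA A ((tangentAct σ ⟨(h : W)⁻¹, by rw [hσ]; exact (h⁻¹).2⟩).baseChange A τ) y := by
  rw [M.pairA_tangentAct A _ h⁻¹ rfl, inv_inv]

/-- The homomorphism `Coord V → A ⊗ C` extending `adjMap` on linear forms. -/
def torCoord (g : Module.End A (A ⊗[ℂ] tangentSpace σ)) : Coord V →ₐ[ℂ] A ⊗[ℂ] Coinv W X :=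
  SymmetricAlgebra.lift ((M.adjMap B A g).restrictScalars ℂ ∘ₗ
    TensorProduct.mk ℂ A (Coinv W X) 1 ∘ₗ (coinvMk W X).toLinearMap ∘ₗ
      SymmetricAlgebra.ι ℂ (Module.Dual ℂ V))

@[simp] theorem torCoord_lin (g : Module.End A (A ⊗[ℂ] tangentSpace σ)) (ℓ : Module.Dual ℂ V) :
    M.torCoord B A g (lin ℓ) = M.adjMap B A g (1 ⊗ₜ coinvMk W X (lin ℓ)) :=
  SymmetricAlgebra.lift_ι_apply _ _

theorem pointA_adjMap (g : Module.End A (A ⊗[ℂ] tangentSpace σ)) (y : A ⊗[ℂ] Coinv W X) :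
    pointA A (coinvPoint W X) (M.adjMap B A g y) = 0 := by
  rw [adjMap_apply, map_sum]
  refine Finset.sum_eq_zero fun k _ => ?_
  by_cases hk : B.deg k = 1
  · rw [map_smul, pointA_tmul, B.coinvPoint_basis (by omega)]
    simp
  · rw [M.tangentDual_eq_zero B hk, tmul_zero, map_zero, map_zero, LinearMap.zero_apply, zero_smul,
      map_zero]

theorem pointA_torCoord (g : Module.End A (A ⊗[ℂ] tangentSpace σ)) (p : Coord V) :
    pointA A (coinvPoint W X) (M.torCoord B A g p) = algebraMap ℂ A (evalAt 0 p) := by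
  have : ((pointA A (coinvPoint W X)).restrictScalars ℂ).comp (M.torCoord B A g) =
      (Algebra.ofId ℂ A).comp (evalAt 0) := coord_algHom_ext fun ℓ => by
    rw [AlgHom.comp_apply, torCoord_lin, AlgHom.comp_apply, evalAt_lin, map_zero, map_zero]
    exact M.pointA_adjMap B A g _
  exact AlgHom.congr_fun this p

theorem adjMap_coinvA (hσ : pointStab σ = pointwiseStab W X) (g : (autTangent W σ).pts A) (h : pointwiseStab W X) (ℓ : Module.Dual ℂ V) :
    coinvA A (toStab h) (M.adjMap B A g.1.1 (1 ⊗ₜ coinvMk W X (lin ℓ))) =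
      M.adjMap B A g.1.1 (coinvA A (toStab h) (1 ⊗ₜ coinvMk W X (lin ℓ))) := by
  refine M.eq_of_pairA_eq A B ?_ (M.isDegreeOne_adjMap B A _ _) fun τ => ?_
  · rw [IsDegreeOne, bc_comp, ← map_smul, ← M.isDegreeOne_adjMap B A, bc_comp]
    exact bc_congr A (fun c => coinvDilate_coinvAct _ c) _
  · rw [M.pairA_adjMap, M.pairA_coinvA A hσ, M.pairA_coinvA A hσ, M.pairA_adjMap, g.2]

theorem torCoord_smul (hσ : pointStab σ = pointwiseStab W X) (g : (autTangent W σ).pts A) (h : pointwiseStab W X) (p : Coord V) :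
    M.torCoord B A g.1.1 (((h : W) : V ≃ₗ[ℂ] V) • p) =
      coinvA A (toStab h) (M.torCoord B A g.1.1 p) := by
  have : (M.torCoord B A g.1.1).comp (coordAct ((h : W) : V ≃ₗ[ℂ] V)) =
      ((coinvA A (toStab h)).restrictScalars ℂ).comp (M.torCoord B A g.1.1) :=
    coord_algHom_ext fun ℓ => by
      rw [AlgHom.comp_apply, AlgHom.comp_apply, torCoord_lin, coordAct_lin, torCoord_lin]
      refine Eq.trans ?_ (M.adjMap_coinvA B A hσ g h ℓ).symm
      rw [← smul_lin]
      rfl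
  exact AlgHom.congr_fun this p

/-- The automorphism of `A ⊗ C` extending `adjMap` on linear forms. -/
def torAlg (g : (autTangent W σ).pts A) : A ⊗[ℂ] Coinv W X →ₐ[A] A ⊗[ℂ] Coinv W X :=
  Algebra.TensorProduct.lift (Algebra.ofId A _) (coinvLift W X (M.torCoord B A g.1.1) fun p hp => by
    -- By equivariance an invariant polynomial has an invariant image, hence a scalar one, and this
    -- scalar is its value at the origin.
    have : coinvariantIdeal (pointwiseStab W X) ≤ RingHom.ker (M.torCoord B A g.1.1) :=
      coinvariantIdeal_le fun p hp hp0 => by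
        rw [RingHom.mem_ker, eq_smul_one_of_invariant A (y := M.torCoord B A g.1.1 p) fun h => by
          rw [← M.torCoord_smul B A hσ, hp _ h.2], pointA_torCoord, hp0, map_zero, zero_smul]
    exact this hp) fun _ _ => Commute.all _ _

theorem torAlg_tmul (g : (autTangent W σ).pts A) (p : Coord V) :
    M.torAlg B A hσ g (1 ⊗ₜ coinvMk W X p) = M.torCoord B A g.1.1 p := by
  rw [torAlg, Algebra.TensorProduct.lift_tmul, map_one, one_mul]
  rfl

theorem torAlg_lin (g : (autTangent W σ).pts A) (ℓ : Module.Dual ℂ V) :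
    M.torAlg B A hσ g (1 ⊗ₜ coinvMk W X (lin ℓ)) =
      M.adjMap B A g.1.1 (1 ⊗ₜ coinvMk W X (lin ℓ)) := by
  rw [torAlg_tmul, torCoord_lin]

theorem pointA_torAlg (g : (autTangent W σ).pts A) (y : A ⊗[ℂ] Coinv W X) :
    pointA A (coinvPoint W X) (M.torAlg B A hσ g y) = pointA A (coinvPoint W X) y := by
  have : (pointA A (coinvPoint W X)).comp (M.torAlg B A hσ g) = pointA A (coinvPoint W X) :=
    coinvHom_ext fun ℓ => by
      rw [AlgHom.comp_apply, torAlg_lin, pointA_adjMap, pointA_tmul, coinvPoint_mk, evalAt_lin,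
        map_zero, map_zero, mul_zero]
  exact AlgHom.congr_fun this y

theorem torAlg_coinvA (g : (autTangent W σ).pts A) (h : pointwiseStab W X)
    (y : A ⊗[ℂ] Coinv W X) :
    M.torAlg B A hσ g (coinvA A (toStab h) y) = coinvA A (toStab h) (M.torAlg B A hσ g y) := by
  have : (M.torAlg B A hσ g).comp (coinvA A (toStab h)) =
      (coinvA A (toStab h)).comp (M.torAlg B A hσ g) := coinvHom_ext fun ℓ => by
    rw [AlgHom.comp_apply, AlgHom.comp_apply, torAlg_lin, M.adjMap_coinvA B A hσ, bc_tmul,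
      coinvAct_mk, smul_lin, torAlg_lin]
  exact AlgHom.congr_fun this y

theorem isDegreeOne_torAlg (g : (autTangent W σ).pts A) {y : A ⊗[ℂ] Coinv W X}
    (hy : IsDegreeOne W X A y) : IsDegreeOne W X A (M.torAlg B A hσ g y) := by
  have : (M.torAlg B A hσ g).comp (bc A (coinvDilate W X)) =
      (bc A (coinvDilate W X)).comp (M.torAlg B A hσ g) := coinvHom_ext fun ℓ => by
    rw [AlgHom.comp_apply, AlgHom.comp_apply, torAlg_lin, M.isDegreeOne_adjMap B A,
      isDegreeOne_lin, map_smul, torAlg_lin]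
  have h1 := AlgHom.congr_fun this y
  rw [AlgHom.comp_apply, AlgHom.comp_apply, hy, map_smul] at h1
  exact h1.symm

/-- Both sides are derivations at the origin, since `torAlg` preserves it, and they agree on linear
forms by adjunction. So the differential of the extension is the automorphism it came from. -/
theorem pairA_torAlg (g : (autTangent W σ).pts A) (τ : A ⊗[ℂ] tangentSpace σ)
    (y : A ⊗[ℂ] Coinv W X) : M.pairA A τ (M.torAlg B A hσ g y) = M.pairA A (g.1.1 τ) y := by
  have key : ∀ p : Coord V, M.pairA A τ (M.torAlg B A hσ g (1 ⊗ₜ coinvMk W X p)) =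
      M.pairA A (g.1.1 τ) (1 ⊗ₜ coinvMk W X p) := by
    intro p
    induction p using SymmetricAlgebra.induction with
    | algebraMap c =>
      have : (1 : A) ⊗ₜ[ℂ] coinvMk W X (algebraMap ℂ _ c) =
          algebraMap ℂ A c • (1 : A ⊗[ℂ] Coinv W X) := by
        rw [AlgHom.commutes, Algebra.algebraMap_eq_smul_one, ← TensorProduct.smul_tmul,
          Algebra.TensorProduct.one_def, TensorProduct.smul_tmul', smul_eq_mul, mul_one,
          ← Algebra.algebraMap_eq_smul_one]
      rw [this, map_smul, map_smul, map_smul, map_one, (M.isPointDerivation_pairA A _).apply_one,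
        (M.isPointDerivation_pairA A _).apply_one]
    | ι ℓ => exact (congrArg _ (M.torAlg_lin B A hσ g ℓ)).trans (M.pairA_adjMap B A _ _ _)
    | mul a b ha hb =>
      have : (1 : A) ⊗ₜ[ℂ] coinvMk W X (a * b) = (1 ⊗ₜ coinvMk W X a) * (1 ⊗ₜ coinvMk W X b) := by
        rw [Algebra.TensorProduct.tmul_mul_tmul, one_mul, map_mul]
      rw [this, map_mul, M.isPointDerivation_pairA, M.isPointDerivation_pairA, ha, hb,
        M.pointA_torAlg, M.pointA_torAlg]
    | add a b ha hb => simp only [map_add, tmul_add, ha, hb]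
  have : M.pairA A τ ∘ₗ (M.torAlg B A hσ g).toLinearMap = M.pairA A (g.1.1 τ) :=
    linearMap_ext_coinvA fun c => by
      obtain ⟨p, rfl⟩ := coinvMk_surjective W X c
      exact key p
  exact LinearMap.congr_fun this y

/-- Adjoints reverse the order of composition, which is why `torHom` uses the inverse of `g`. -/
theorem torAlg_mul (g g' : (autTangent W σ).pts A) (y : A ⊗[ℂ] Coinv W X) :
    M.torAlg B A hσ g (M.torAlg B A hσ g' y) = M.torAlg B A hσ (g' * g) y := by
  have : (M.torAlg B A hσ g).comp (M.torAlg B A hσ g') = M.torAlg B A hσ (g' * g) :=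
    coinvHom_ext fun ℓ => M.eq_of_pairA_eq A B
      (M.isDegreeOne_torAlg B A hσ _ (M.isDegreeOne_torAlg B A hσ _ (isDegreeOne_lin A ℓ)))
      (M.isDegreeOne_torAlg B A hσ _ (isDegreeOne_lin A ℓ)) fun τ => by
        rw [AlgHom.comp_apply, pairA_torAlg, pairA_torAlg, pairA_torAlg]
        rfl
  exact AlgHom.congr_fun this y

theorem torAlg_one (y : A ⊗[ℂ] Coinv W X) : M.torAlg B A hσ 1 y = y := by
  have : M.torAlg B A hσ 1 = AlgHom.id A _ :=
    coinvHom_ext fun ℓ => M.eq_of_pairA_eq A B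
      (M.isDegreeOne_torAlg B A hσ _ (isDegreeOne_lin A ℓ)) (isDegreeOne_lin A ℓ) fun τ => by
        rw [pairA_torAlg]
        rfl
  exact AlgHom.congr_fun this y

/-- Automorphisms of the tangent space act on the component of `σ`. -/
def torHom : (autTangent W σ).pts A →* coAut W X A where
  toFun g := ⟨AlgEquiv.ofAlgHom (M.torAlg B A hσ g⁻¹) (M.torAlg B A hσ g)
    (AlgHom.ext fun y => by
      rw [AlgHom.comp_apply, torAlg_mul, mul_inv_cancel, torAlg_one]; rfl)
    (AlgHom.ext fun y => by
      rw [AlgHom.comp_apply, torAlg_mul, inv_mul_cancel, torAlg_one]; rfl),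
    M.torAlg_coinvA B A hσ _, M.pointA_torAlg B A hσ _⟩
  map_one' := Subtype.ext (AlgEquiv.ext fun y => by
    change M.torAlg B A hσ 1⁻¹ y = y
    rw [inv_one, torAlg_one])
  map_mul' g g' := Subtype.ext (AlgEquiv.ext fun y => by
    change M.torAlg B A hσ (g * g')⁻¹ y = M.torAlg B A hσ g⁻¹ (M.torAlg B A hσ g'⁻¹ y)
    rw [torAlg_mul, mul_inv_rev])

variable {A} in
theorem torAlg_baseMap {A' : CommAlgCat.{0} ℂ} (f : A ⟶ A') (g : (autTangent W σ).pts A)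
    (g' : (autTangent W σ).pts A') (hg : ∀ τ, g'.1.1 (baseMap _ f τ) = baseMap _ f (g.1.1 τ))
    (y : A ⊗[ℂ] Coinv W X) :
    M.torAlg B A' hσ g' (baseMap _ f y) = baseMap _ f (M.torAlg B A hσ g y) := by
  have h0 : ∀ z, M.adjMap B A' g'.1.1 (baseMap _ f z) = baseMap _ f (M.adjMap B A g.1.1 z) := by
    intro z
    rw [adjMap_apply, adjMap_apply, map_sum]
    refine Finset.sum_congr rfl fun k _ => ?_
    have h1 : ∀ D : tangentSpace σ, (1 : A') ⊗ₜ[ℂ] D = baseMap _ f ((1 : A) ⊗ₜ[ℂ] D) := fun D => by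
      rw [baseMap_tmul, map_one]
    rw [h1, hg, M.pairA_baseMap, baseMap_smul, baseMap_tmul, map_one]
  have h2 : ∀ c : Coinv W X, (1 : A') ⊗ₜ[ℂ] c = baseMap _ f ((1 : A) ⊗ₜ[ℂ] c) := fun c => by
    rw [baseMap_tmul, map_one]
  have h3 : M.torCoord B A' g'.1.1 =
      (Algebra.TensorProduct.map f.hom (AlgHom.id ℂ (Coinv W X))).comp (M.torCoord B A g.1.1) :=
    coord_algHom_ext fun ℓ => by
      rw [AlgHom.comp_apply, torCoord_lin, torCoord_lin, h2]
      exact h0 _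
  induction y with
  | zero => simp only [map_zero]
  | add x y hx hy => simp only [map_add, hx, hy]
  | tmul a c =>
    obtain ⟨p, rfl⟩ := coinvMk_surjective W X c
    have h4 : a ⊗ₜ[ℂ] coinvMk W X p = a • ((1 : A) ⊗ₜ[ℂ] coinvMk W X p) := by
      rw [TensorProduct.smul_tmul', smul_eq_mul, mul_one]
    rw [h4, baseMap_smul, ← h2, map_smul, map_smul, torAlg_tmul, torAlg_tmul, baseMap_smul, h3]
    rfl

/-- The splitting of the tangent action. -/
def tangentSection : (autTangent W σ).toFunctor ⟶ (autPointed W σ).toFunctor where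
  app A := GrpCat.ofHom ((M.pointedEquiv A).symm.toMonoidHom.comp (M.torHom B A hσ))
  naturality A A' f := by
    refine GrpCat.hom_ext (MonoidHom.ext fun (g : (autTangent W σ).pts A) => ?_)
    refine (M.pointedEquiv A').injective ?_
    refine Subtype.ext (AlgEquiv.ext fun y => ?_)
    let g' : (autTangent W σ).pts A' := (autTangent W σ).toFunctor.map f g
    let q : (autPointed W σ).pts A := (M.pointedEquiv A).symm (M.torHom B A hσ g)
    change (M.pointedEquiv A' ((M.pointedEquiv A').symm (M.torHom B A' hσ g'))).1 y =
      (M.pointedEquiv A' ((autPointed W σ).toFunctor.map f q : (autPointed W σ).pts A')).1 y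
    have hq : M.pointedEquiv A q = M.torHom B A hσ g := MulEquiv.apply_symm_apply _ _
    rw [MulEquiv.apply_symm_apply]
    have key : ∀ z : A ⊗[ℂ] Coinv W X, (M.torHom B A' hσ g').1 (baseMap _ f z) =
        (M.pointedEquiv A' ((autPointed W σ).toFunctor.map f q : (autPointed W σ).pts A')).1
          (baseMap _ f z) := by
      intro z
      rw [M.pointedEquiv_map, hq]
      refine M.torAlg_baseMap B hσ f g⁻¹ g'⁻¹ (fun τ => ?_) z
      have h1 : g'⁻¹ = ((autTangent W σ).toFunctor.map f g⁻¹ : (autTangent W σ).pts A') :=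
        (map_inv ((autTangent W σ).toFunctor.map f).hom g).symm
      rw [h1]
      exact endMapFun_baseMap _ f _ τ
    induction y with
    | zero => simp only [map_zero]
    | add x y hx hy => simp only [map_add, hx, hy]
    | tmul a c =>
      have h4 : a ⊗ₜ[ℂ] c = a • baseMap _ f ((1 : A) ⊗ₜ[ℂ] c) := by
        rw [baseMap_tmul, map_one, TensorProduct.smul_tmul', smul_eq_mul, mul_one]
      rw [h4, map_smul, map_smul, key]

theorem tangentSection_comp : M.tangentSection B hσ ≫ M.tangentMap B hσ = 𝟙 _ := by
  refine NatTrans.ext (funext fun A => GrpCat.hom_ext (MonoidHom.ext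
    fun (g : (autTangent W σ).pts A) => ?_))
  refine Subtype.ext (Units.ext (LinearMap.ext fun τ => ?_))
  change M.tanMap B A (M.pointedEquiv A ((M.pointedEquiv A).symm (M.torHom B A hσ g))) τ = g.1.1 τ
  rw [MulEquiv.apply_symm_apply]
  refine M.pairA_injective A B fun y => ?_
  rw [pairA_tanMap, ← M.pairA_torAlg B A hσ]
  rfl

end ComponentModel

theorem isSemidirectProduct_kernel {G H : GroupFunctor} (d : G ⟶ H) (s : H ⟶ G)
    (h : s ≫ d = 𝟙 _) : IsSemidirectProduct (kernel d) s := by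
  intro A
  have hds : ∀ x, (d.app A).hom ((s.app A).hom x) = x := fun x =>
    ConcreteCategory.congr_hom (NatTrans.congr_app h A) x
  refine ⟨MonoidHom.normal_ker _, Function.LeftInverse.injective hds, ?_⟩
  refine Subgroup.isComplement'_of_disjoint_and_mul_eq_univ ?_ ?_
  · rw [Subgroup.disjoint_def]
    rintro _ h1 ⟨x, rfl⟩
    have h2 : (d.app A).hom ((s.app A).hom x) = 1 := h1
    rw [hds] at h2
    rw [h2, map_one]
  · rw [Set.eq_univ_iff_forall]
    intro g
    refine Set.mem_mul.2 ⟨g * ((s.app A).hom ((d.app A).hom g))⁻¹, ?_, _, ⟨_, rfl⟩,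
      inv_mul_cancel_right g _⟩
    change (d.app A).hom _ = 1
    rw [map_mul, map_inv, hds, mul_inv_cancel]

end TangentAction

/-! ### The unipotent radical -/

section Unipotent

variable {V : Type} [AddCommGroup V] [Module ℂ V] {W : Subgroup (V ≃ₗ[ℂ] V)} {X : Submodule ℂ V}

namespace GradedBasis

variable (B : GradedBasis W X)

/-- The equations cutting out the unipotent automorphisms of the coinvariants. -/
inductive Eqn : Type
  | upper (i j : Fin B.size) (h : B.deg i ≤ B.deg j)
  | mul (j k i : Fin B.size)
  | one (i : Fin B.size)
  | act (h : pointwiseStab W X) (i j : Fin B.size)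

/-- The failure of a matrix to satisfy an equation. -/
def defect {A : Type} [CommRing A] [Algebra ℂ A] (m : Fin B.size × Fin B.size → A) : B.Eqn → A
  | .upper i j _ => m (i, j) - if i = j then 1 else 0
  | .mul j k i => ∑ l, algebraMap ℂ A (B.basis.repr (B.basis j * B.basis k) l) * m (i, l) -
      ∑ a, ∑ b, m (a, j) * m (b, k) * algebraMap ℂ A (B.basis.repr (B.basis a * B.basis b) i)
  | .one i => ∑ l, algebraMap ℂ A (B.basis.repr 1 l) * m (i, l) - algebraMap ℂ A (B.basis.repr 1 i)
  | .act h i j => ∑ l, algebraMap ℂ A (B.basis.repr (coinvAct (toStab h) (B.basis j)) l) * m (i, l) -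
      ∑ l, algebraMap ℂ A (B.basis.repr (coinvAct (toStab h) (B.basis l)) i) * m (l, j)

theorem map_defect {A A' : Type} [CommRing A] [Algebra ℂ A] [CommRing A'] [Algebra ℂ A']
    (f : A →ₐ[ℂ] A') (m : Fin B.size × Fin B.size → A) (e : B.Eqn) :
    f (B.defect m e) = B.defect (fun ij => f (m ij)) e := by
  cases e with
  | upper i j h => simp only [defect, map_sub]; split_ifs <;> simp
  | mul j k i => simp only [defect, map_sub, map_sum, map_mul, AlgHom.commutes]
  | one i => simp only [defect, map_sub, map_sum, map_mul, AlgHom.commutes]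
  | act h i j => simp only [defect, map_sub, map_sum, map_mul, AlgHom.commutes]

/-- The ideal of the group of unipotent automorphisms of the coinvariants. -/
def uniIdeal : Ideal (MvPolynomial (Fin B.size × Fin B.size) ℂ) :=
  Ideal.span (Set.range (B.defect MvPolynomial.X))

theorem forall_uniIdeal {A : Type} [CommRing A] [Algebra ℂ A] (m : Fin B.size × Fin B.size → A) :
    (∀ p ∈ B.uniIdeal, MvPolynomial.aeval m p = 0) ↔ ∀ e, B.defect m e = 0 := by
  have h1 : ∀ e, MvPolynomial.aeval m (B.defect MvPolynomial.X e) = B.defect m e := fun e => by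
    rw [map_defect]
    simp only [MvPolynomial.aeval_X]
  constructor
  · exact fun h e => by rw [← h1]; exact h _ (Ideal.subset_span ⟨e, rfl⟩)
  · intro h
    have : B.uniIdeal ≤ RingHom.ker (MvPolynomial.aeval m) := by
      refine Ideal.span_le.2 ?_
      rintro _ ⟨e, rfl⟩
      exact (h1 e).trans (h e)
    exact fun p hp => this hp

theorem X_mem_uniIdeal {i j : Fin B.size} (h : j < i) :
    MvPolynomial.X (i, j) ∈ B.uniIdeal := by
  have := Ideal.subset_span (α := MvPolynomial (Fin B.size × Fin B.size) ℂ)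
    (Set.mem_range_self (f := B.defect MvPolynomial.X) (.upper i j (B.antitone_deg h.le)))
  rw [uniIdeal]
  simpa [defect, h.ne'] using this

theorem X_sub_one_mem_uniIdeal (i : Fin B.size) :
    MvPolynomial.X (i, i) - 1 ∈ B.uniIdeal := by
  have := Ideal.subset_span (α := MvPolynomial (Fin B.size × Fin B.size) ℂ)
    (Set.mem_range_self (f := B.defect MvPolynomial.X) (.upper i i le_rfl))
  rw [uniIdeal]
  simpa [defect] using this

/-- The identity matrix. -/
abbrev idMat : Fin B.size × Fin B.size → ℂ := fun ij => if ij.1 = ij.2 then 1 else 0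

theorem defect_idMat (e : B.Eqn) : B.defect B.idMat e = 0 := by
  cases e <;> simp [defect, idMat]

/-- The coordinate ring of the group of unipotent automorphisms. -/
def UniRing : Type := MvPolynomial (Fin B.size × Fin B.size) ℂ ⧸ B.uniIdeal

instance : CommRing B.UniRing :=
  inferInstanceAs (CommRing (MvPolynomial (Fin B.size × Fin B.size) ℂ ⧸ B.uniIdeal))

instance : Algebra ℂ B.UniRing :=
  inferInstanceAs (Algebra ℂ (MvPolynomial (Fin B.size × Fin B.size) ℂ ⧸ B.uniIdeal))

/-- The quotient map to the coordinate ring. -/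
def uniMk : MvPolynomial (Fin B.size × Fin B.size) ℂ →ₐ[ℂ] B.UniRing :=
  Ideal.Quotient.mkₐ ℂ B.uniIdeal

/-- The generic unipotent matrix. -/
def genMat : Fin B.size × Fin B.size → B.UniRing := fun ij => B.uniMk (MvPolynomial.X ij)

theorem defect_genMat (e : B.Eqn) : B.defect B.genMat e = 0 := by
  refine (B.map_defect B.uniMk MvPolynomial.X e).symm.trans ?_
  exact Ideal.Quotient.eq_zero_iff_mem.2 (Ideal.subset_span ⟨e, rfl⟩)

/-- Homomorphisms from the coordinate ring are unipotent matrices. -/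
def uniLift {A : Type} [CommRing A] [Algebra ℂ A] (m : Fin B.size × Fin B.size → A)
    (h : ∀ e, B.defect m e = 0) : B.UniRing →ₐ[ℂ] A :=
  Ideal.Quotient.liftₐ B.uniIdeal (MvPolynomial.aeval m) ((B.forall_uniIdeal m).2 h)

@[simp] theorem uniLift_genMat {A : Type} [CommRing A] [Algebra ℂ A]
    (m : Fin B.size × Fin B.size → A) (h : ∀ e, B.defect m e = 0) (ij) :
    B.uniLift m h (B.genMat ij) = m ij := MvPolynomial.aeval_X m ij

variable {B} in
theorem uniRing_ext {A : Type} [CommRing A] [Algebra ℂ A] {f g : B.UniRing →ₐ[ℂ] A}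
    (h : ∀ ij, f (B.genMat ij) = g (B.genMat ij)) : f = g :=
  Ideal.Quotient.algHom_ext _ (MvPolynomial.algHom_ext fun ij => h ij)

/-- The generic matrix, contracted by the dilations. -/
def contractMat : Fin B.size × Fin B.size → Polynomial B.UniRing := fun ij =>
  Polynomial.X ^ (B.deg ij.1 - B.deg ij.2) * Polynomial.C (B.genMat ij)

/-- Conjugation by the grading, written without negative powers. The truncated exponent is harmless
because the entries with `deg i < deg j` vanish. -/
theorem X_pow_mul_contractMat (i j : Fin B.size) :
    Polynomial.X ^ B.deg j * B.contractMat (i, j) =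
      Polynomial.X ^ B.deg i * Polynomial.C (B.genMat (i, j)) := by
  rw [contractMat, ← mul_assoc, ← pow_add]
  rcases le_or_gt (B.deg j) (B.deg i) with h | h
  · rw [Nat.add_sub_cancel' h]
  · have h1 := B.defect_genMat (.upper i j h.le)
    rw [defect, if_neg (by rintro rfl; exact lt_irrefl _ h), sub_zero] at h1
    rw [h1]
    simp

theorem contractMat_eq {i j : Fin B.size} (h : B.deg i ≤ B.deg j) :
    B.contractMat (i, j) = if i = j then 1 else 0 := by
  have h1 := B.defect_genMat (.upper i j h)
  rw [defect, sub_eq_zero] at h1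
  rw [contractMat, h1, Nat.sub_eq_zero_of_le h, pow_zero, one_mul]
  split_ifs <;> simp

/-- Product, unit and group action respect degrees, so each equation for the contracted matrix
becomes, after multiplication by a power of the variable, a multiple of the same equation for the
generic matrix. Powers of the variable are not zero divisors. -/
theorem defect_contractMat (e : B.Eqn) : B.defect B.contractMat e = 0 := by
  have hreg : ∀ (n : ℕ) (p : Polynomial B.UniRing), Polynomial.X ^ n * p = 0 → p = 0 := by
    intro n p hp
    exact (Polynomial.isRegular_X_pow n).left (hp.trans (mul_zero _).symm)
  have halg : ∀ z : ℂ, algebraMap ℂ (Polynomial B.UniRing) z =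
      Polynomial.C (algebraMap ℂ B.UniRing z) := fun z => rfl
  have hscal : ∀ (z : ℂ) (i l : Fin B.size) (d : ℕ), (z ≠ 0 → B.deg l = d) →
      Polynomial.X ^ d * (algebraMap ℂ (Polynomial B.UniRing) z * B.contractMat (i, l)) =
      Polynomial.X ^ B.deg i * Polynomial.C (algebraMap ℂ B.UniRing z * B.genMat (i, l)) := by
    intro z i l d h
    by_cases hz : z = 0
    · simp [hz]
    · rw [mul_left_comm, ← h hz, X_pow_mul_contractMat, halg, Polynomial.C_mul]
      ring
  cases e with
  | upper i j h => rw [defect, B.contractMat_eq h, sub_self]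
  | mul j k i =>
    have h1 := B.defect_genMat (.mul j k i)
    rw [defect, sub_eq_zero] at h1
    refine hreg (B.deg j + B.deg k) _ ?_
    rw [defect, mul_sub, sub_eq_zero, Finset.mul_sum]
    rw [Finset.sum_congr rfl fun l _ => hscal _ i l _ B.deg_eq_of_mul, ← Finset.mul_sum,
      ← map_sum, h1, map_sum, Finset.mul_sum, Finset.mul_sum]
    refine Finset.sum_congr rfl fun a _ => ?_
    rw [map_sum, Finset.mul_sum, Finset.mul_sum]
    refine Finset.sum_congr rfl fun b _ => ?_
    by_cases hz : B.basis.repr (B.basis a * B.basis b) i = 0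
    · simp [hz]
    · have h2 := B.X_pow_mul_contractMat a j
      have h3 := B.X_pow_mul_contractMat b k
      rw [B.deg_eq_of_mul hz, pow_add, pow_add, halg, Polynomial.C_mul, Polynomial.C_mul]
      linear_combination (-Polynomial.C (algebraMap ℂ B.UniRing
        (B.basis.repr (B.basis a * B.basis b) i))) * (h2 * Polynomial.X ^ B.deg k *
          B.contractMat (b, k) + h3 * Polynomial.X ^ B.deg a * Polynomial.C (B.genMat (a, j)))
  | one i =>
    have h1 := B.defect_genMat (.one i)
    rw [defect, sub_eq_zero] at h1
    refine hreg 0 _ ?_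
    rw [defect, mul_sub, sub_eq_zero, Finset.mul_sum]
    rw [Finset.sum_congr rfl fun l _ => hscal _ i l 0 B.deg_eq_of_one, ← Finset.mul_sum,
      ← map_sum, h1, halg]
    by_cases hz : B.basis.repr 1 i = 0
    · simp [hz]
    · rw [B.deg_eq_of_one hz]
  | act h i j =>
    have h1 := B.defect_genMat (.act h i j)
    rw [defect, sub_eq_zero] at h1
    refine hreg (B.deg j) _ ?_
    rw [defect, mul_sub, sub_eq_zero, Finset.mul_sum]
    rw [Finset.sum_congr rfl fun l _ => hscal _ i l _ B.deg_eq_of_coinvAct, ← Finset.mul_sum,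
      ← map_sum, h1, map_sum, Finset.mul_sum, Finset.mul_sum]
    refine Finset.sum_congr rfl fun l _ => ?_
    by_cases hz : B.basis.repr (coinvAct (toStab h) (B.basis l)) i = 0
    · simp [hz]
    · rw [mul_left_comm, X_pow_mul_contractMat, B.deg_eq_of_coinvAct hz, halg, Polynomial.C_mul]
      ring

/-- Contraction of the group of unipotent automorphisms to the identity. -/
def contraction : B.UniRing →ₐ[ℂ] Polynomial B.UniRing :=
  B.uniLift B.contractMat B.defect_contractMat

theorem eval_one_contraction (x : B.UniRing) : (B.contraction x).eval 1 = x := by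
  have : ((Polynomial.aeval (1 : B.UniRing)).restrictScalars ℂ).comp B.contraction =
      AlgHom.id ℂ B.UniRing := uniRing_ext fun ij => by
    rw [AlgHom.comp_apply, contraction, uniLift_genMat, contractMat]
    simp
  have h := AlgHom.congr_fun this x
  simpa [Polynomial.aeval_def, Polynomial.eval₂_eq_eval_map] using h

theorem eval_zero_contraction (x : B.UniRing) : (B.contraction x).eval 0 =
    algebraMap ℂ B.UniRing (B.uniLift B.idMat B.defect_idMat x) := by
  have : ((Polynomial.aeval (0 : B.UniRing)).restrictScalars ℂ).comp B.contraction =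
      (Algebra.ofId ℂ B.UniRing).comp (B.uniLift B.idMat B.defect_idMat) := uniRing_ext fun ij => by
    rw [AlgHom.comp_apply, contraction, uniLift_genMat, AlgHom.comp_apply, uniLift_genMat]
    obtain ⟨i, j⟩ := ij
    rcases le_or_gt (B.deg i) (B.deg j) with h | h
    · rw [B.contractMat_eq h]
      simp only [idMat]
      split_ifs <;> simp
    · have hne : i ≠ j := by rintro rfl; exact lt_irrefl _ h
      simp only [idMat, if_neg hne, map_zero, contractMat]
      have : B.deg i - B.deg j ≠ 0 := by omega
      simp [this]
  have h := AlgHom.congr_fun this x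
  simpa [Polynomial.aeval_def, Polynomial.eval₂_eq_eval_map, Algebra.ofId_apply] using h

/-- An idempotent divisible by the variable equals all its powers, hence is divisible by all powers
of the variable. -/
theorem _root_.Polynomial.eq_zero_of_isIdempotentElem {Q : Type} [CommRing Q] {p : Polynomial Q}
    (hp : IsIdempotentElem p) (h0 : p.eval 0 = 0) : p = 0 := by
  have h1 : Polynomial.X ∣ p := by
    rw [Polynomial.X_dvd_iff, Polynomial.coeff_zero_eq_eval_zero, h0]
  ext n
  have h2 : Polynomial.X ^ (n + 1) ∣ p := by
    rw [← hp.pow_succ_eq n]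
    exact pow_dvd_pow_of_dvd h1 _
  exact (Polynomial.X_pow_dvd_iff.1 h2) n n.lt_succ_self

instance : Nontrivial B.UniRing :=
  (B.uniLift B.idMat B.defect_idMat).toRingHom.domain_nontrivial

/-- The contraction joins every point to the identity. The value of the idempotent at the identity
is `0` or `1`, and an idempotent polynomial is determined by such a value at `0`; evaluation at `1`
gives `x` back. -/
theorem eq_zero_or_one {x : B.UniRing} (hx : IsIdempotentElem x) : x = 0 ∨ x = 1 := by
  have h1 : IsIdempotentElem (B.contraction x) := hx.map B.contraction
  have h2 : IsIdempotentElem (B.uniLift B.idMat B.defect_idMat x) := hx.map _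
  rcases (IsIdempotentElem.iff_eq_zero_or_one.1 h2) with h3 | h3
  · left
    rw [← B.eval_one_contraction x, Polynomial.eq_zero_of_isIdempotentElem h1 (by
      rw [eval_zero_contraction, h3, map_zero]), Polynomial.eval_zero]
  · right
    have h4 := Polynomial.eq_zero_of_isIdempotentElem h1.one_sub (by
      rw [Polynomial.eval_sub, Polynomial.eval_one, eval_zero_contraction, h3, map_one, sub_self])
    rw [← B.eval_one_contraction x, ← sub_eq_zero.1 h4, Polynomial.eval_one]

instance connectedSpace_uniRing : ConnectedSpace (PrimeSpectrum B.UniRing) := by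
  have : PreconnectedSpace (PrimeSpectrum B.UniRing) := by
    rw [preconnectedSpace_iff_clopen]
    intro s hs
    obtain ⟨e, he, rfl⟩ := PrimeSpectrum.exists_idempotent_basicOpen_eq_of_isClopen hs
    rcases B.eq_zero_or_one he with rfl | rfl
    · left; simp
    · right; simp
  exact ⟨inferInstance⟩

end GradedBasis

end Unipotent

/-! ### The kernel of the tangent action -/

section TangentKernel

variable {V : Type} [AddCommGroup V] [Module ℂ V] {W : Subgroup (V ≃ₗ[ℂ] V)} {X : Submodule ℂ V}
variable {R : Type} [CommRing R] [Algebra ℂ R] [MulSemiringAction W R] [SMulCommClass W ℂ R]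
variable {σ : R →ₐ[ℂ] ℂ}

namespace GradedBasis

variable (B : GradedBasis W X) (A : CommAlgCat.{0} ℂ)

/-- The matrix of an endomorphism of `A ⊗ C`. -/
def entries (φ : Module.End A (A ⊗[ℂ] Coinv W X)) : Fin B.size × Fin B.size → A :=
  fun ij => (B.basisA A).repr (φ (B.basisA A ij.2)) ij.1

theorem toMatrixAlgEquiv_basisA (φ : Module.End A (A ⊗[ℂ] Coinv W X)) (i j : Fin B.size) :
    LinearMap.toMatrixAlgEquiv (B.basisA A) φ i j = B.entries A φ (i, j) :=
  LinearMap.toMatrixAlgEquiv_apply _ _ _ _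

theorem one_tmul_eq_sum (c : Coinv W X) :
    (1 : A) ⊗ₜ[ℂ] c = ∑ l, algebraMap ℂ A (B.basis.repr c l) • B.basisA A l := by
  conv_lhs => rw [← (B.basisA A).sum_repr ((1 : A) ⊗ₜ[ℂ] c)]
  exact Finset.sum_congr rfl fun l _ => by rw [B.basisA_repr_tmul, mul_one]

theorem repr_apply_tmul (φ : Module.End A (A ⊗[ℂ] Coinv W X)) (c : Coinv W X) (i : Fin B.size) :
    (B.basisA A).repr (φ (1 ⊗ₜ c)) i =
      ∑ l, algebraMap ℂ A (B.basis.repr c l) * B.entries A φ (i, l) := by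
  rw [B.one_tmul_eq_sum]
  simp only [map_sum, map_smul, Finsupp.coe_finsetSum, Finset.sum_apply, Finsupp.smul_apply,
    smul_eq_mul]
  rfl

theorem repr_mul (x y : A ⊗[ℂ] Coinv W X) (i : Fin B.size) :
    (B.basisA A).repr (x * y) i = ∑ a, ∑ b, (B.basisA A).repr x a * (B.basisA A).repr y b *
      algebraMap ℂ A (B.basis.repr (B.basis a * B.basis b) i) := by
  conv_lhs => rw [← (B.basisA A).sum_repr x, ← (B.basisA A).sum_repr y]
  simp only [Finset.sum_mul, Finset.mul_sum, map_sum, map_smul, Finsupp.coe_finsetSum,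
    Finset.sum_apply, smul_mul_smul_comm, Finsupp.smul_apply, smul_eq_mul, basisA_apply,
    Algebra.TensorProduct.tmul_mul_tmul, mul_one, B.basisA_repr_tmul]
  rw [Finset.sum_comm]

theorem repr_coinvA (n : setStab W X) (y : A ⊗[ℂ] Coinv W X) (i : Fin B.size) :
    (B.basisA A).repr (coinvA A n y) i =
      ∑ l, algebraMap ℂ A (B.basis.repr (coinvAct n (B.basis l)) i) * (B.basisA A).repr y l := by
  conv_lhs => rw [← (B.basisA A).sum_repr y]
  simp only [map_sum, map_smul, Finsupp.coe_finsetSum, Finset.sum_apply, Finsupp.smul_apply,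
    smul_eq_mul, basisA_apply, bc_tmul, B.basisA_repr_tmul, mul_one]
  exact Finset.sum_congr rfl fun l _ => mul_comm _ _

/-- The unipotent automorphisms of `A ⊗ C`. -/
structure IsUni (φ : Module.End A (A ⊗[ℂ] Coinv W X)) : Prop where
  upper : ∀ i j, B.deg i ≤ B.deg j → B.entries A φ (i, j) = if i = j then 1 else 0
  map_mul : ∀ x y, φ (x * y) = φ x * φ y
  map_one : φ 1 = 1
  map_act : ∀ (h : pointwiseStab W X) y, φ (coinvA A (toStab h) y) = coinvA A (toStab h) (φ y)

/-- Multiplicativity, the unit and equivariance are (bi)linear conditions, so they need only be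
tested on basis vectors, where they are the listed equations. -/
theorem isUni_iff (φ : Module.End A (A ⊗[ℂ] Coinv W X)) :
    B.IsUni A φ ↔ ∀ e, B.defect (B.entries A φ) e = 0 := by
  have hmul : ∀ j k i, B.defect (B.entries A φ) (.mul j k i) =
      (B.basisA A).repr (φ (B.basisA A j * B.basisA A k)) i -
      (B.basisA A).repr (φ (B.basisA A j) * φ (B.basisA A k)) i := by
    intro j k i
    rw [repr_mul, basisA_apply, basisA_apply, Algebra.TensorProduct.tmul_mul_tmul, mul_one,
      repr_apply_tmul, ← basisA_apply, ← basisA_apply]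
    rfl
  have hone : ∀ i, B.defect (B.entries A φ) (.one i) =
      (B.basisA A).repr (φ 1) i - (B.basisA A).repr 1 i := by
    intro i
    rw [Algebra.TensorProduct.one_def, repr_apply_tmul, basisA_repr_tmul, mul_one]
    rfl
  have hact : ∀ h i j, B.defect (B.entries A φ) (.act h i j) =
      (B.basisA A).repr (φ (coinvA A (toStab h) (B.basisA A j))) i -
      (B.basisA A).repr (coinvA A (toStab h) (φ (B.basisA A j))) i := by
    intro h i j
    rw [repr_coinvA, basisA_apply, bc_tmul, repr_apply_tmul, ← basisA_apply]
    rfl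
  constructor
  · rintro h (⟨i, j, hij⟩ | ⟨j, k, i⟩ | i | ⟨g, i, j⟩)
    · exact sub_eq_zero.2 (h.upper i j hij)
    · rw [hmul, h.map_mul, sub_self]
    · rw [hone, h.map_one, sub_self]
    · rw [hact, h.map_act, sub_self]
  · intro h
    refine ⟨fun i j hij => sub_eq_zero.1 (h (.upper i j hij)), fun x y => ?_, ?_, fun g y => ?_⟩
    · have key : (LinearMap.mul A _).compr₂ φ = (LinearMap.mul A _).compl₁₂ φ φ :=
        (B.basisA A).ext fun j => (B.basisA A).ext fun k => (B.basisA A).ext_elem fun i =>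
          sub_eq_zero.1 ((hmul j k i).symm.trans (h _))
      exact LinearMap.congr_fun (LinearMap.congr_fun key x) y
    · exact (B.basisA A).ext_elem fun i => sub_eq_zero.1 ((hone i).symm.trans (h _))
    · have key : φ ∘ₗ (coinvA A (toStab g)).toLinearMap = (coinvA A (toStab g)).toLinearMap ∘ₗ φ :=
        (B.basisA A).ext fun j => (B.basisA A).ext_elem fun i =>
          sub_eq_zero.1 ((hact g i j).symm.trans (h _))
      exact LinearMap.congr_fun key y

variable {A}

theorem sub_mem_filtA {φ : Module.End A (A ⊗[ℂ] Coinv W X)}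
    (h : ∀ i j, B.deg i ≤ B.deg j → B.entries A φ (i, j) = if i = j then 1 else 0)
    (j : Fin B.size) : φ (B.basisA A j) - B.basisA A j ∈ B.filtA A (B.deg j + 1) := by
  refine B.mem_filtA_iff.2 fun k hk => ?_
  have h1 := h k j (by omega)
  rw [entries] at h1
  rw [map_sub, Finsupp.sub_apply, h1, Module.Basis.repr_self, Finsupp.single_apply]
  simp [eq_comm]

theorem entries_of_sub_mem_filtA {φ : Module.End A (A ⊗[ℂ] Coinv W X)}
    (h : ∀ j, φ (B.basisA A j) - B.basisA A j ∈ B.filtA A (B.deg j + 1)) (i j : Fin B.size)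
    (hij : B.deg i ≤ B.deg j) : B.entries A φ (i, j) = if i = j then 1 else 0 := by
  have h1 := B.mem_filtA_iff.1 (h j) i (by omega)
  rw [map_sub, Finsupp.sub_apply, sub_eq_zero, Module.Basis.repr_self, Finsupp.single_apply] at h1
  rw [entries, h1]
  simp [eq_comm]

theorem pointA_eq_zero_of_mem_filtA {y : A ⊗[ℂ] Coinv W X} (hy : y ∈ B.filtA A 1) :
    pointA A (coinvPoint W X) y = 0 := by
  rw [filtA] at hy
  induction hy using Submodule.span_induction with
  | mem x hx =>
    obtain ⟨k, hk, rfl⟩ := hx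
    rw [pointA_tmul, B.coinvPoint_basis (by omega)]
    simp
  | zero => simp
  | add x y _ _ hx hy => rw [map_add, hx, hy, add_zero]
  | smul a x _ hx => rw [map_smul, hx, smul_zero]

/-- Induction by `γ(ℓ m) - ℓ m = (γ ℓ - ℓ) γ m + ℓ (γ m - m)`: being the identity to first order on
linear forms forces every monomial to change only in higher degree. -/
theorem sub_mono_mem_filtA (γ : A ⊗[ℂ] Coinv W X →ₐ[A] A ⊗[ℂ] Coinv W X)
    (h : ∀ ℓ : Module.Dual ℂ V, γ (1 ⊗ₜ coinvMk W X (lin ℓ)) - 1 ⊗ₜ coinvMk W X (lin ℓ) ∈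
      B.filtA A 2) (s : Multiset (Module.Dual ℂ V)) :
    γ (1 ⊗ₜ coinvMono W X s) - 1 ⊗ₜ coinvMono W X s ∈ B.filtA A (s.card + 1) := by
  induction s using Multiset.induction with
  | empty =>
    have h1 : (1 : A) ⊗ₜ[ℂ] coinvMono W X 0 = 1 := by simp [coinvMono, Algebra.TensorProduct.one_def]
    rw [h1, map_one, sub_self]
    exact zero_mem _
  | cons ℓ s ih =>
    have h1 : (1 : A) ⊗ₜ[ℂ] coinvMono W X (ℓ ::ₘ s) =
        (1 ⊗ₜ coinvMk W X (lin ℓ)) * (1 ⊗ₜ coinvMono W X s) := by simp [coinvMono]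
    have h2 : γ (1 ⊗ₜ coinvMono W X s) ∈ B.filtA A s.card := by
      rw [← sub_add_cancel (γ (1 ⊗ₜ coinvMono W X s)) (1 ⊗ₜ coinvMono W X s)]
      exact add_mem (B.filtA_anti (Nat.le_succ _) ih) (B.tmul_mono_mem_filtA s le_rfl 1)
    have h3 : (1 : A) ⊗ₜ[ℂ] coinvMk W X (lin ℓ) ∈ B.filtA A 1 := by
      have := B.tmul_mono_mem_filtA (A := A) {ℓ} (d := 1) (by simp) 1
      simpa [coinvMono] using this
    have h4 := add_mem (B.mul_mem_filtA (h ℓ) h2) ((by omega : 1 + (s.card + 1) = 2 + s.card) ▸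
      B.mul_mem_filtA h3 ih)
    rw [h1, map_mul, Multiset.card_cons, (by omega : s.card + 1 + 1 = 2 + s.card)]
    convert h4 using 1
    ring

end GradedBasis

namespace ComponentModel

variable [Finite W] (M : ComponentModel (W := W) X σ) (B : GradedBasis W X) (A : CommAlgCat.{0} ℂ)

theorem tanMap_eq_one_iff (γ : coAut W X A) :
    M.tanMap B A γ = 1 ↔ ∀ τ y, M.pairA A τ (γ.1 y) = M.pairA A τ y := by
  constructor
  · intro h τ y
    have h1 := M.pairA_tanMap B A γ τ (γ.1 y)
    rw [h] at h1
    refine h1.trans (congrArg _ ?_)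
    exact γ.1.symm_apply_apply y
  · intro h
    refine LinearMap.ext fun τ => M.pairA_injective A B fun y => ?_
    rw [pairA_tanMap, ← h]
    exact congrArg _ (γ.1.apply_symm_apply y)

theorem pairA_eq_zero_of_mem_filtA (τ : A ⊗[ℂ] tangentSpace σ) {y : A ⊗[ℂ] Coinv W X}
    (hy : y ∈ B.filtA A 2) : M.pairA A τ y = 0 := by
  rw [GradedBasis.filtA] at hy
  induction hy using Submodule.span_induction with
  | mem x hx =>
    obtain ⟨k, hk, rfl⟩ := hx
    exact B.pointDerivation_apply A (M.isPointDerivation_pairA A τ) (by omega)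
  | zero => simp
  | add x y _ _ hx hy => rw [map_add, hx, hy, add_zero]
  | smul a x _ hx => rw [map_smul, hx, smul_zero]

/-- A trivial differential together with preservation of the origin says that linear forms change
only in degree at least two, and multiplicativity extends this to all monomials. Conversely, tangent
vectors do not see degree two and higher. -/
theorem tanMap_eq_one_iff_entries (γ : coAut W X A) :
    M.tanMap B A γ = 1 ↔ ∀ i j, B.deg i ≤ B.deg j →
      B.entries A γ.1.toLinearMap (i, j) = if i = j then 1 else 0 := by
  rw [M.tanMap_eq_one_iff]
  constructor
  · intro h
    refine B.entries_of_sub_mem_filtA fun j => ?_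
    obtain ⟨s, hs, hj⟩ := B.exists_mono j
    rw [B.basisA_apply, hj, ← hs]
    refine B.sub_mono_mem_filtA (γ.1 : A ⊗[ℂ] Coinv W X →ₐ[A] A ⊗[ℂ] Coinv W X) (fun ℓ => ?_) s
    refine B.mem_filtA_iff.2 fun k hk => ?_
    by_cases hk1 : B.deg k = 1
    · rw [← M.pairA_tangentDual A B hk1, map_sub, sub_eq_zero]
      exact h _ _
    · refine B.mem_filtA_iff.1 (B.mem_filtA_one ?_) k (by omega)
      rw [map_sub, sub_eq_zero]
      exact γ.2.2 _
  · intro h τ y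
    have key : M.pairA A τ ∘ₗ γ.1.toLinearMap = M.pairA A τ := (B.basisA A).ext fun j => by
      by_cases hj : B.deg j = 1
      · have h1 := M.pairA_eq_zero_of_mem_filtA B A τ
          (B.filtA_anti (by omega) (B.sub_mem_filtA h j))
        rwa [map_sub, sub_eq_zero] at h1
      · have h1 : IsPointDerivation A (M.pairA A τ ∘ₗ γ.1.toLinearMap) := fun x z => by
          have h2 := M.isPointDerivation_pairA A τ (γ.1 x) (γ.1 z)
          rw [γ.2.2, γ.2.2, ← map_mul] at h2
          exact h2
        rw [B.basisA_apply, B.pointDerivation_apply A h1 hj,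
          B.pointDerivation_apply A (M.isPointDerivation_pairA A τ) hj]
    exact LinearMap.congr_fun key y

variable {A} in
theorem isUni_of_tanMap_eq_one {γ : coAut W X A} (h : M.tanMap B A γ = 1) :
    B.IsUni A γ.1.toLinearMap where
  upper := (M.tanMap_eq_one_iff_entries B A γ).1 h
  map_mul := map_mul γ.1
  map_one := map_one γ.1
  map_act := γ.2.1

/-- The matrices of automorphisms of the component of `σ`. -/
def matHom : coAut W X A →* GL (Fin B.size) A :=
  ((LinearMap.toMatrixAlgEquiv (B.basisA A)).toAlgHom.toMonoidHom.comp
    { toFun := fun γ : coAut W X A => (γ.1.toLinearMap : Module.End A (A ⊗[ℂ] Coinv W X))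
      map_one' := rfl
      map_mul' := fun _ _ => rfl }).toHomUnits

theorem matHom_apply (γ : coAut W X A) (i j : Fin B.size) :
    (matHom B A γ).1 i j = B.entries A γ.1.toLinearMap (i, j) :=
  LinearMap.toMatrixAlgEquiv_apply _ _ _ _

theorem matHom_injective : Function.Injective (matHom B A) := by
  intro γ δ h
  refine Subtype.ext (AlgEquiv.ext fun y => ?_)
  have h1 : γ.1.toLinearMap = δ.1.toLinearMap :=
    (LinearMap.toMatrixAlgEquiv (B.basisA A)).injective (congrArg Units.val h)
  exact LinearMap.congr_fun h1 y

theorem exists_coAut (g : GL (Fin B.size) A) (h : ∀ e, B.defect (fun ij => g.1 ij.1 ij.2) e = 0) :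
    ∃ γ : coAut W X A, matHom B A γ = g ∧ ∀ i j, B.deg i ≤ B.deg j →
      B.entries A γ.1.toLinearMap (i, j) = if i = j then 1 else 0 := by
  let T := LinearMap.toMatrixAlgEquiv (B.basisA A)
  let φ : Module.End A (A ⊗[ℂ] Coinv W X) := T.symm g.1
  have hφ : ∀ i j, B.entries A φ (i, j) = g.1 i j := fun i j => by
    rw [← B.toMatrixAlgEquiv_basisA]
    exact congrFun (congrFun (T.apply_symm_apply g.1) i) j
  have huni : B.IsUni A φ := (B.isUni_iff A φ).2 fun e => by
    have : B.entries A φ = fun ij => g.1 ij.1 ij.2 := funext fun ij => hφ ij.1 ij.2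
    exact (congrArg (fun m => B.defect m e) this).trans (h e)
  have h1 : ∀ y, φ (T.symm g⁻¹.1 y) = y := fun y => by
    have : T.symm g.1 * T.symm g⁻¹.1 = 1 := by rw [← map_mul, g.mul_inv, map_one]
    exact LinearMap.congr_fun this y
  have h2 : ∀ y, T.symm g⁻¹.1 (φ y) = y := fun y => by
    have : T.symm g⁻¹.1 * T.symm g.1 = 1 := by rw [← map_mul, g.inv_mul, map_one]
    exact LinearMap.congr_fun this y
  let γ : A ⊗[ℂ] Coinv W X ≃ₐ[A] A ⊗[ℂ] Coinv W X :=
    AlgEquiv.ofBijective (AlgHom.ofLinearMap φ huni.map_one huni.map_mul)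
      ⟨Function.LeftInverse.injective h2, Function.RightInverse.surjective h1⟩
  -- Preservation of the origin is not among the equations; it follows because each basis vector
  -- changes only by terms of positive degree.
  have hpt : ∀ y, pointA A (coinvPoint W X) (φ y) = pointA A (coinvPoint W X) y := by
    intro y
    have key : (pointA A (coinvPoint W X)).toLinearMap ∘ₗ φ =
        (pointA A (coinvPoint W X)).toLinearMap := (B.basisA A).ext fun j => by
      have h3 := B.pointA_eq_zero_of_mem_filtA
        (B.filtA_anti (Nat.le_add_left 1 _) (B.sub_mem_filtA huni.upper j))
      rwa [map_sub, sub_eq_zero] at h3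
    exact LinearMap.congr_fun key y
  refine ⟨⟨γ, huni.map_act, hpt⟩, Units.ext (Matrix.ext fun i j => ?_), huni.upper⟩
  rw [matHom_apply]
  exact hφ i j

variable (hσ : pointStab σ = pointwiseStab W X)

theorem mem_kernel_tangentMap (g : (autPointed W σ).pts A) :
    g ∈ (kernel (M.tangentMap B hσ)).pts A ↔ M.tanMap B A (M.pointedEquiv A g) = 1 := by
  constructor
  · intro h
    have h1 : M.tanHom B A hσ (M.pointedEquiv A g) = 1 := h
    exact congrArg (fun u : (autTangent W σ).pts A => u.1.1) h1
  · intro h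
    have h1 : M.tanHom B A hσ (M.pointedEquiv A g) = 1 := Subtype.ext (Units.ext h)
    exact h1

/-- The matrix representation of the kernel of the tangent action. -/
def kernelMap : (kernel (M.tangentMap B hσ)).toFunctor ⟶ glMatrix B.size where
  app A := GrpCat.ofHom ((matHom B A).comp ((M.pointedEquiv A).toMonoidHom.comp
    ((kernel (M.tangentMap B hσ)).pts A).subtype))
  naturality A A' f := by
    refine GrpCat.hom_ext (MonoidHom.ext fun (u : (kernel (M.tangentMap B hσ)).pts A) =>
      Units.ext (Matrix.ext fun i j => ?_))
    let g : (autPointed W σ).pts A := u.1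
    let g' : (autPointed W σ).pts A' := (autPointed W σ).toFunctor.map f g
    change (matHom B A' (M.pointedEquiv A' g')).1 i j = f.hom ((matHom B A (M.pointedEquiv A g)).1 i j)
    rw [matHom_apply, matHom_apply, GradedBasis.entries, GradedBasis.entries]
    have h0 : ∀ y : A ⊗[ℂ] Coinv W X,
        (B.basisA A').repr (baseMap _ f y) i = f.hom ((B.basisA A).repr y i) := by
      intro y
      induction y with
      | zero => simp
      | add x y hx hy => simp only [map_add, Finsupp.add_apply, hx, hy]
      | tmul a c => rw [baseMap_tmul, B.basisA_repr_tmul, B.basisA_repr_tmul, map_mul,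
          AlgHom.commutes]
    have h1 : B.basisA A' j = baseMap _ f (B.basisA A j) := by
      rw [B.basisA_apply, B.basisA_apply, baseMap_tmul, map_one]
    rw [h1, ← h0]
    exact congrArg (fun y => (B.basisA A').repr y i) (M.pointedEquiv_map f g _)

theorem isConnectedUnipotent_kernel :
    IsConnectedUnipotent (kernel (M.tangentMap B hσ)).toFunctor := by
  refine ⟨B.size, B.uniIdeal, fun i j => B.X_mem_uniIdeal, B.X_sub_one_mem_uniIdeal,
    B.connectedSpace_uniRing, M.kernelMap B hσ, fun A => ⟨?_, fun g => ?_⟩⟩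
  · intro (u : (kernel (M.tangentMap B hσ)).pts A) (u' : (kernel (M.tangentMap B hσ)).pts A) h
    exact Subtype.ext ((M.pointedEquiv A).injective (matHom_injective B A h))
  · rw [B.forall_uniIdeal]
    constructor
    · rintro ⟨u, rfl⟩
      let u' : (kernel (M.tangentMap B hσ)).pts A := u
      have h1 := M.isUni_of_tanMap_eq_one B ((M.mem_kernel_tangentMap B A hσ u'.1).1 u'.2)
      have h2 := (B.isUni_iff A _).1 h1
      intro e
      rw [← h2 e]
      congr 1
      funext ij
      exact matHom_apply B A _ _ _
    · intro h
      obtain ⟨γ, rfl, h1⟩ := exists_coAut B A g h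
      refine ⟨⟨(M.pointedEquiv A).symm γ, (M.mem_kernel_tangentMap B A hσ _).2 ?_⟩, ?_⟩
      · rw [MulEquiv.apply_symm_apply]
        exact (M.tanMap_eq_one_iff_entries B A γ).2 h1
      · change matHom B A (M.pointedEquiv A ((M.pointedEquiv A).symm γ)) = _
        rw [MulEquiv.apply_symm_apply]

end ComponentModel

end TangentKernel

/-! ### The automorphisms of the tangent space -/

section TangentTorus

variable {V : Type} [AddCommGroup V] [Module ℂ V] {W : Subgroup (V ≃ₗ[ℂ] V)} {X : Submodule ℂ V}
variable {R : Type} [CommRing R] [Algebra ℂ R] [MulSemiringAction W R] [SMulCommClass W ℂ R]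
variable {σ : R →ₐ[ℂ] ℂ}

/-- The first order germ at the origin, along `u`, of a polynomial function. -/
def germ (u : V) : Coord V →ₐ[ℂ] TrivSqZeroExt ℂ ℂ :=
  SymmetricAlgebra.lift (TrivSqZeroExt.inrHom ℂ ℂ ∘ₗ Module.Dual.eval ℂ V u)

@[simp] theorem germ_lin (u : V) (ℓ : Module.Dual ℂ V) :
    germ u (lin ℓ) = TrivSqZeroExt.inr (ℓ u) := SymmetricAlgebra.lift_ι_apply _ _

theorem fst_germ (u : V) (p : Coord V) : (germ u p).fst = evalAt 0 p := by
  have : (TrivSqZeroExt.fstHom ℂ ℂ ℂ).comp (germ u) = evalAt 0 := coord_algHom_ext fun ℓ => by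
    rw [AlgHom.comp_apply, germ_lin, evalAt_lin, map_zero]
    rfl
  exact AlgHom.congr_fun this p

theorem germ_smul (w : V ≃ₗ[ℂ] V) (u : V) (p : Coord V) : germ u (w • p) = germ (w⁻¹ • u) p := by
  have : (germ u).comp (coordAct w) = germ (w⁻¹ • u) := coord_algHom_ext fun ℓ => by
    rw [AlgHom.comp_apply, coordAct_lin, germ_lin, germ_lin]
    rfl
  exact AlgHom.congr_fun this p

theorem snd_germ_smul (c : ℂ) (u : V) (p : Coord V) :
    (germ (c • u) p).snd = c * (germ u p).snd := by
  have : germ (c • u) = (TrivSqZeroExt.map (c • LinearMap.id)).comp (germ u) :=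
    coord_algHom_ext fun ℓ => by
      rw [AlgHom.comp_apply, germ_lin, germ_lin, TrivSqZeroExt.map_inr, map_smul]
      rfl
  rw [this, AlgHom.comp_apply, TrivSqZeroExt.snd_map]
  rfl

namespace Refl

/-- A reflection whose mirror contains `X`, as an element of `W_X`. -/
def toPointwiseStab (r : Refl W X) : pointwiseStab W X :=
  ⟨⟨r.1, r.2.1⟩, mem_pointwiseStab.2 fun _ hx => r.2.2.2 hx⟩

/-- The germ along the root of a reflection, on the coinvariants. -/
def coinvGerm (r : Refl W X) : Coinv W X →ₐ[ℂ] TrivSqZeroExt ℂ ℂ :=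
  coinvLift W X (germ r.root) fun p hp => by
    have : coinvariantIdeal (pointwiseStab W X) ≤ RingHom.ker (germ r.root) :=
      coinvariantIdeal_le fun p hp hp0 => by
        refine TrivSqZeroExt.ext ((fst_germ _ _).trans hp0) ?_
        -- An invariant has equal derivatives along `r.root` and along `r.1 • r.root`, which is `1 +
        -- r.form r.root` times the root. As `r.form r.root ≠ 0`, the derivative is zero.
        have h1 := hp _ (inv_mem r.toPointwiseStab.2)
        have h2 : germ r.root p = germ (r.1 • r.root) p := by
          conv_lhs => rw [← h1]
          rw [Subgroup.coe_inv, germ_smul, inv_inv]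
          rfl
        have h3 : r.1 • r.root = (1 + r.form r.root) • r.root := r.apply_root
        have h4 := congrArg TrivSqZeroExt.snd h2
        rw [h3, snd_germ_smul, add_mul, one_mul, left_eq_add] at h4
        exact (mul_eq_zero.1 h4).resolve_left r.form_root_ne_zero
    exact this hp

end Refl

namespace ComponentModel

variable [Finite W] (M : ComponentModel (W := W) X σ)

/-- The tangent vector given by the root of a reflection. -/
def rootVec (r : Refl W X) : tangentSpace σ :=
  ⟨TrivSqZeroExt.sndHom ℂ ℂ ∘ₗ (r.coinvGerm.comp M.res).toLinearMap, fun x y => by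
    have hfst : ∀ x, (r.coinvGerm (M.res x)).fst = σ x := fun x => by
      obtain ⟨p, hp⟩ := coinvMk_surjective W X (M.res x)
      rw [← M.point_res, ← hp]
      exact fst_germ _ p
    change (r.coinvGerm (M.res (x * y))).snd =
      σ x * (r.coinvGerm (M.res y)).snd + σ y * (r.coinvGerm (M.res x)).snd
    rw [map_mul, map_mul, TrivSqZeroExt.snd_mul, hfst, hfst]
    simp [mul_comm]⟩

theorem rootVec_lin (r : Refl W X) (ℓ : Module.Dual ℂ V) :
    (M.rootVec r).1 (M.ext (coinvMk W X (lin ℓ))) = ℓ r.root := by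
  change (r.coinvGerm (M.res (M.ext (coinvMk W X (lin ℓ))))).snd = _
  rw [M.res_ext]
  change (germ r.root (lin ℓ)).snd = _
  rw [germ_lin, TrivSqZeroExt.snd_inr]

theorem tangent_lin_ext {D D' : tangentSpace σ}
    (h : ∀ ℓ : Module.Dual ℂ V, D.1 (M.ext (coinvMk W X (lin ℓ))) =
      D'.1 (M.ext (coinvMk W X (lin ℓ)))) : D = D' := by
  refine Subtype.ext (LinearMap.ext fun x => ?_)
  rw [← M.tangent_ext_res D, ← M.tangent_ext_res D']
  obtain ⟨p, hp⟩ := coinvMk_surjective W X (M.res x)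
  rw [← hp]
  clear hp x
  induction p using SymmetricAlgebra.induction with
  | algebraMap c =>
    rw [AlgHom.commutes, Algebra.algebraMap_eq_smul_one, map_smul, map_smul, map_smul,
      M.tangent_ext_one, M.tangent_ext_one]
  | ι ℓ => exact h ℓ
  | mul a b ha hb =>
    have h1 : ∀ E : tangentSpace σ, E.1 (M.ext (coinvMk W X (a * b))) =
        σ (M.ext (coinvMk W X a)) * E.1 (M.ext (coinvMk W X b)) +
        σ (M.ext (coinvMk W X b)) * E.1 (M.ext (coinvMk W X a)) := fun E => by
      rw [← E.2, ← M.tangent_ext_res E (_ * _), map_mul M.res, M.res_ext, M.res_ext,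
        map_mul (coinvMk W X)]
    rw [h1, h1, ha, hb]
  | add a b ha hb => rw [map_add, map_add, map_add, map_add, ha, hb]

theorem tangentAct_refl (r : Refl W X) (w : pointStab (W := W) σ)
    (hw : (w : W) = r.toPointwiseStab) (D : tangentSpace σ) :
    tangentAct σ w D = D + D.1 (M.ext (coinvMk W X (lin r.form))) • M.rootVec r := by
  refine M.tangent_lin_ext fun ℓ => ?_
  change D.1 (((w⁻¹ : pointStab (W := W) σ) : W) • M.ext (coinvMk W X (lin ℓ))) =
    D.1 (M.ext (coinvMk W X (lin ℓ))) + D.1 (M.ext (coinvMk W X (lin r.form))) *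
      (M.rootVec r).1 (M.ext (coinvMk W X (lin ℓ)))
  rw [M.rootVec_lin, Subgroup.coe_inv, hw, ← Subgroup.coe_inv, ← M.ext_coinvAct, coinvAct_mk]
  have h1 : (((toStab r.toPointwiseStab⁻¹ : setStab W X) : W) : V ≃ₗ[ℂ] V) • lin ℓ =
      lin ℓ + ℓ r.root • lin r.form := by
    rw [smul_lin, ← map_smul, ← map_add]
    congr 1
    ext u
    change ℓ (r.1 u) = ℓ u + ℓ r.root * r.form u
    rw [r.apply_eq, map_add, map_smul, smul_eq_mul, mul_comm]
  rw [h1, map_add, map_add, map_add, map_smul, map_smul, map_smul, smul_eq_mul, mul_comm]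

/-- `W_X` is generated by reflections. -/
def GeneratedByRefl (W : Subgroup (V ≃ₗ[ℂ] V)) (X : Submodule ℂ V) : Prop :=
  ∀ h ∈ pointwiseStab W X, (h : V ≃ₗ[ℂ] V) ∈ Subgroup.closure (Set.range fun r : Refl W X => r.1)

/-- Such a form is fixed by every reflection of `W_X`, hence by the group they generate, so it is an
invariant vanishing at the origin. -/
theorem coinvMk_lin_eq_zero (hgen : GeneratedByRefl W X) {ℓ : Module.Dual ℂ V}
    (h : ∀ r : Refl W X, ℓ r.root = 0) : coinvMk W X (lin ℓ) = 0 := by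
  refine coinvMk_eq_zero.2 (mem_coinvariantIdeal (fun g hg => ?_) (by rw [evalAt_lin, map_zero]))
  have h1 : Subgroup.closure (Set.range fun r : Refl W X => r.1) ≤
      MulAction.stabilizer (V ≃ₗ[ℂ] V) (lin ℓ) := by
    rw [Subgroup.closure_le]
    rintro _ ⟨r, rfl⟩
    change r.1 • lin ℓ = lin ℓ
    have h2 : ∀ u, ℓ (r.1 u) = ℓ u := fun u => by
      rw [r.apply_eq, map_add, map_smul, h r, smul_zero, add_zero]
    rw [smul_lin]
    congr 1
    ext u
    change ℓ (r.1.symm u) = ℓ u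
    rw [← h2, LinearEquiv.apply_symm_apply]
  exact h1 (hgen g hg)

end ComponentModel

end TangentTorus

/-! ### Tangent vectors and linear forms attached to reflections -/

section RootForms

variable {V : Type} [AddCommGroup V] [Module ℂ V] {W : Subgroup (V ≃ₗ[ℂ] V)} {X : Submodule ℂ V}
variable {R : Type} [CommRing R] [Algebra ℂ R] [MulSemiringAction W R] [SMulCommClass W ℂ R]
variable {σ : R →ₐ[ℂ] ℂ}

/-- The projection onto the span of the roots, along the intersection of the mirrors. -/
theorem Refl.exists_projection [Finite W] : ∃ π : V →ₗ[ℂ] V,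
    (∀ u, π u ∈ Submodule.span ℂ (Set.range fun r : Refl W X => r.root)) ∧
    (∀ r : Refl W X, π r.root = r.root) ∧
    ∀ u, (∀ r : Refl W X, r.form u = 0) → π u = 0 := by
  have hc := isCompl_span_root (Set.univ : Set (Refl W X))
  refine ⟨Submodule.projection _ _ hc, fun u => ?_, fun r => ?_, fun u hu => ?_⟩
  · have h : Submodule.span ℂ (root '' (Set.univ : Set (Refl W X))) ≤
        Submodule.span ℂ (Set.range fun r : Refl W X => r.root) := by rw [Set.image_univ]
    exact h (Submodule.projection_apply_mem hc u)
  · exact Submodule.projection_apply_of_mem_left hc (Submodule.subset_span ⟨r, trivial, rfl⟩)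
  · rw [Submodule.projection_apply, Submodule.coe_eq_zero, Submodule.projectionOnto_apply_eq_zero_iff]
    simp only [Submodule.mem_iInf, mem_mirror]
    exact fun r _ => hu r

/-- Composition of `ℓ` with the projection onto the root span vanishes on the intersection of the
mirrors, hence is a combination of the forms defining them. -/
theorem Refl.exists_mem_span_form [Finite W] (ℓ : Module.Dual ℂ V) :
    ∃ m ∈ Submodule.span ℂ (Set.range fun r : Refl W X => r.form),
      ∀ r : Refl W X, (ℓ - m) r.root = 0 := by
  obtain ⟨π, -, h2, h3⟩ := exists_projection (W := W) (X := X)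
  refine ⟨ℓ ∘ₗ π, mem_span_of_iInf_ker_le_ker fun x hx => ?_, fun r => ?_⟩
  · simp only [Submodule.mem_iInf, LinearMap.mem_ker] at hx
    rw [LinearMap.mem_ker, LinearMap.comp_apply, h3 x hx, map_zero]
  · rw [LinearMap.sub_apply, LinearMap.comp_apply, h2, sub_self]

namespace ComponentModel

variable [Finite W] (M : ComponentModel (W := W) X σ)

/-- On linear forms a tangent vector is evaluation at some `u ∈ V`. Forms vanishing on the roots are
zero in the coinvariants, so `u` may be replaced by its projection to the root span. -/
theorem span_rootVec [Module.Finite ℂ V] (M : ComponentModel (W := W) X σ)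
    (hgen : GeneratedByRefl W X) : ⊤ ≤ Submodule.span ℂ (Set.range M.rootVec) := by
  intro D _
  let Λ : Module.Dual ℂ (Module.Dual ℂ V) :=
    D.1 ∘ₗ M.ext ∘ₗ (coinvMk W X).toLinearMap ∘ₗ SymmetricAlgebra.ι ℂ (Module.Dual ℂ V)
  obtain ⟨u, hu⟩ := (Module.evalEquiv ℂ V).surjective Λ
  have hu' : ∀ ℓ : Module.Dual ℂ V, D.1 (M.ext (coinvMk W X (lin ℓ))) = ℓ u := fun ℓ =>
    (LinearMap.congr_fun hu ℓ).symm
  obtain ⟨π, h1, hπ, -⟩ := Refl.exists_projection (W := W) (X := X)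
  have h0 : ∀ ℓ : Module.Dual ℂ V, ℓ (u - π u) = 0 := fun ℓ => by
    have h1 := hu' (ℓ - ℓ ∘ₗ π)
    rw [coinvMk_lin_eq_zero hgen, map_zero, map_zero] at h1
    · rw [map_sub]
      exact h1.symm
    · intro r
      rw [LinearMap.sub_apply, LinearMap.comp_apply, hπ, sub_self]
  have := Fintype.ofFinite (Refl W X)
  obtain ⟨c, hc'⟩ := (Submodule.mem_span_range_iff_exists_fun ℂ).1 (h1 u)
  refine (Submodule.mem_span_range_iff_exists_fun ℂ).2 ⟨c, M.tangent_lin_ext fun ℓ => ?_⟩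
  have h2 := h0 ℓ
  rw [map_sub, sub_eq_zero, ← hc', map_sum] at h2
  rw [hu', h2, Submodule.coe_sum, LinearMap.sum_apply]
  refine Finset.sum_congr rfl fun r _ => ?_
  rw [Submodule.coe_smul, LinearMap.smul_apply, M.rootVec_lin, map_smul]

variable (A : CommAlgCat.{0} ℂ)

/-- The linear form of a reflection, as a function of tangent vectors. -/
def rootForm (r : Refl W X) : A ⊗[ℂ] tangentSpace σ →ₗ[A] A :=
  (M.pairA A).flip (1 ⊗ₜ coinvMk W X (lin r.form))

theorem rootForm_tmul (r : Refl W X) (a : A) (D : tangentSpace σ) :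
    M.rootForm A r (a ⊗ₜ D) = a * algebraMap ℂ A (D.1 (M.ext (coinvMk W X (lin r.form)))) := by
  change M.pairA A (a ⊗ₜ D) _ = _
  rw [pairA_tmul, one_mul]

theorem rootForm_rootVec (r q : Refl W X) :
    M.rootForm A r (1 ⊗ₜ M.rootVec q) = algebraMap ℂ A (r.form q.root) := by
  rw [rootForm_tmul, rootVec_lin, one_mul]

/-- Dual to `span_rootVec`: modulo forms that vanish in the coinvariants, the linear forms are
spanned by those of the reflections. -/
theorem ext_rootForm (B : GradedBasis W X) (hgen : GeneratedByRefl W X) {x y : A ⊗[ℂ] tangentSpace σ}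
    (h : ∀ r, M.rootForm A r x = M.rootForm A r y) : x = y := by
  let G : A ⊗[ℂ] tangentSpace σ → Module.Dual ℂ V →ₗ[ℂ] A := fun x =>
    (M.pairA A x).restrictScalars ℂ ∘ₗ TensorProduct.mk ℂ A _ 1 ∘ₗ (coinvMk W X).toLinearMap ∘ₗ
      SymmetricAlgebra.ι ℂ (Module.Dual ℂ V)
  have hG : ∀ ℓ, G x ℓ = G y ℓ := by
    intro ℓ
    obtain ⟨m, hm, hℓ⟩ := Refl.exists_mem_span_form (W := W) (X := X) ℓ
    have h1 : m ∈ LinearMap.eqLocus (G x) (G y) := by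
      refine Submodule.span_le.2 ?_ hm
      rintro _ ⟨r, rfl⟩
      exact h r
    have h2 : ∀ z, G z (ℓ - m) = 0 := fun z => by
      change M.pairA A z (1 ⊗ₜ coinvMk W X (lin (ℓ - m))) = 0
      rw [coinvMk_lin_eq_zero hgen hℓ, tmul_zero, map_zero]
    have h3 : ∀ z, G z ℓ = G z m := fun z => by
      rw [← sub_eq_zero, ← map_sub, h2]
    rw [h3, h3]
    exact h1
  rw [← M.sum_pairA_tangentDual A B x, ← M.sum_pairA_tangentDual A B y]
  refine Finset.sum_congr rfl fun k _ => ?_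
  congr 1
  by_cases hk : B.deg k = 1
  · obtain ⟨ℓ, s, hs, hb⟩ := B.exists_basis_eq_mul (k := k) (by omega)
    obtain rfl : s = 0 := Multiset.card_eq_zero.1 (by omega)
    have : coinvMono W X (0 : Multiset (Module.Dual ℂ V)) = 1 := rfl
    rw [hb, this, mul_one]
    exact hG ℓ
  · rw [B.pointDerivation_apply A (M.isPointDerivation_pairA A x) hk,
      B.pointDerivation_apply A (M.isPointDerivation_pairA A y) hk]

theorem baseChange_tangentAct (r : Refl W X) (w : pointStab (W := W) σ)
    (hw : (w : W) = r.toPointwiseStab) (x : A ⊗[ℂ] tangentSpace σ) :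
    (tangentAct σ w).baseChange A x = x + M.rootForm A r x • ((1 : A) ⊗ₜ M.rootVec r) := by
  induction x with
  | zero => simp
  | add x y hx hy => simp only [map_add, add_smul, hx, hy]; abel
  | tmul a D =>
    rw [LinearMap.baseChange_tmul, M.tangentAct_refl r w hw, tmul_add, rootForm_tmul,
      ← TensorProduct.smul_tmul, TensorProduct.smul_tmul', smul_eq_mul, mul_one, Algebra.smul_def,
      mul_comm]

end ComponentModel

end RootForms

/-! ### The torus of automorphisms of the tangent representation -/

section TorusIso

variable {V : Type} [AddCommGroup V] [Module ℂ V] {W : Subgroup (V ≃ₗ[ℂ] V)} {X : Submodule ℂ V}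
variable {R : Type} [CommRing R] [Algebra ℂ R] [MulSemiringAction W R] [SMulCommClass W ℂ R]
variable {σ : R →ₐ[ℂ] ℂ}

theorem tangentAct_mul (w w' : pointStab (W := W) σ) (D : tangentSpace σ) :
    tangentAct σ (w * w') D = tangentAct σ w (tangentAct σ w' D) := by
  refine Subtype.ext (LinearMap.ext fun r => ?_)
  change D.1 (((w * w')⁻¹ : pointStab (W := W) σ) • r) =
    D.1 ((w'⁻¹ : pointStab (W := W) σ) • (w⁻¹ : pointStab (W := W) σ) • r)
  rw [mul_inv_rev, mul_smul]

theorem tangentAct_one (D : tangentSpace σ) : tangentAct σ (1 : pointStab (W := W) σ) D = D := by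
  refine Subtype.ext (LinearMap.ext fun r => ?_)
  change D.1 ((1⁻¹ : pointStab (W := W) σ) • r) = D.1 r
  rw [inv_one, one_smul]

theorem baseChange_tangentAct_mul (A : CommAlgCat.{0} ℂ) (w w' : pointStab (W := W) σ)
    (x : A ⊗[ℂ] tangentSpace σ) : (tangentAct σ (w * w')).baseChange A x =
      (tangentAct σ w).baseChange A ((tangentAct σ w').baseChange A x) := by
  induction x with
  | zero => simp only [map_zero]
  | add x y hx hy => simp only [map_add, hx, hy]
  | tmul a D => simp only [LinearMap.baseChange_tmul, tangentAct_mul]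

theorem baseChange_tangentAct_one (A : CommAlgCat.{0} ℂ) (x : A ⊗[ℂ] tangentSpace σ) :
    (tangentAct σ (1 : pointStab (W := W) σ)).baseChange A x = x := by
  induction x with
  | zero => simp only [map_zero]
  | add x y hx hy => simp only [map_add, hx, hy]
  | tmul a D => simp only [LinearMap.baseChange_tmul, tangentAct_one]

namespace ComponentModel

variable [Finite W] (M : ComponentModel (W := W) X σ) (A : CommAlgCat.{0} ℂ)

/-- A reflection acts on tangent vectors as the identity plus the rank-one operator of its form and
root, so the hypothesis is commutation with each reflection, and these generate `W_X`. -/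
theorem commutes_of_commutes_refl (M : ComponentModel (W := W) X σ)
    (hσ : pointStab σ = pointwiseStab W X) (hgen : GeneratedByRefl W X)
    (γ : Module.End A (A ⊗[ℂ] tangentSpace σ))
    (h : ∀ (r : Refl W X) x, γ (M.rootForm A r x • ((1 : A) ⊗ₜ M.rootVec r)) =
      M.rootForm A r (γ x) • ((1 : A) ⊗ₜ M.rootVec r)) (w : pointStab (W := W) σ) (x) :
    γ ((tangentAct σ w).baseChange A x) = (tangentAct σ w).baseChange A (γ x) := by
  have key : ∀ g ∈ Subgroup.closure (Set.range fun r : Refl W X => r.1),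
      ∃ w : pointStab (W := W) σ, ((w : W) : V ≃ₗ[ℂ] V) = g ∧
        ∀ x, γ ((tangentAct σ w).baseChange A x) = (tangentAct σ w).baseChange A (γ x) := by
    intro g hg
    induction hg using Subgroup.closure_induction with
    | mem g hg =>
      obtain ⟨r, rfl⟩ := hg
      refine ⟨⟨r.toPointwiseStab, hσ.ge r.toPointwiseStab.2⟩, rfl, fun x => ?_⟩
      rw [M.baseChange_tangentAct A r _ rfl, M.baseChange_tangentAct A r _ rfl, map_add, h]
    | one => exact ⟨1, rfl, fun x => by simp only [baseChange_tangentAct_one]⟩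
    | mul g g' _ _ ih ih' =>
      obtain ⟨w, hw, hw'⟩ := ih
      obtain ⟨v, hv, hv'⟩ := ih'
      refine ⟨w * v, by rw [Subgroup.coe_mul, Subgroup.coe_mul, hw, hv], fun x => ?_⟩
      simp only [baseChange_tangentAct_mul, hw', hv']
    | inv g _ ih =>
      obtain ⟨w, hw, hw'⟩ := ih
      refine ⟨w⁻¹, by rw [Subgroup.coe_inv, Subgroup.coe_inv, hw], fun x => ?_⟩
      have h1 := hw' ((tangentAct σ w⁻¹).baseChange A x)
      rw [← baseChange_tangentAct_mul, mul_inv_cancel, baseChange_tangentAct_one] at h1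
      rw [h1, ← baseChange_tangentAct_mul, inv_mul_cancel, baseChange_tangentAct_one]
  obtain ⟨w', hw, h1⟩ := key _ (hgen w (hσ.le w.2))
  obtain rfl : w' = w := Subtype.ext (Subtype.ext hw)
  exact h1 x

theorem isUnit_form_root (r q : Refl W X) (h : r.Adj q) :
    IsUnit (algebraMap ℂ A (r.form q.root)) :=
  (IsUnit.mk0 _ h).map (algebraMap ℂ A)

/-- The scalar by which an automorphism of the tangent space acts on a root. -/
def rootChar (r : Refl W X) (γ : Module.End A (A ⊗[ℂ] tangentSpace σ)) : A :=
  algebraMap ℂ A (r.form r.root)⁻¹ * M.rootForm A r (γ (1 ⊗ₜ M.rootVec r))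

section Char

variable (hσ : pointStab σ = pointwiseStab W X)

variable {A} in
theorem commutes_refl (M : ComponentModel (W := W) X σ) (hσ : pointStab σ = pointwiseStab W X)
    (g : (autTangent W σ).pts A) (r : Refl W X) (x) :
    M.rootForm A r x • g.1.1 ((1 : A) ⊗ₜ M.rootVec r) =
      M.rootForm A r (g.1.1 x) • ((1 : A) ⊗ₜ M.rootVec r) := by
  have h := g.2 ⟨r.toPointwiseStab, hσ.ge r.toPointwiseStab.2⟩ x
  rwa [M.baseChange_tangentAct A r _ rfl, M.baseChange_tangentAct A r _ rfl, map_add,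
    add_right_inj, map_smul] at h

variable {A} in
-- Commutation with the rank-one operator, applied to the root itself, gives that the root line is
-- preserved: the form takes an invertible value on the root.
theorem apply_rootVec (hσ : pointStab σ = pointwiseStab W X)
    (g : (autTangent W σ).pts A) (r : Refl W X) :
    g.1.1 ((1 : A) ⊗ₜ M.rootVec r) = M.rootChar A r g.1.1 • ((1 : A) ⊗ₜ M.rootVec r) := by
  rw [rootChar, mul_smul, ← M.commutes_refl hσ, rootForm_rootVec, smul_smul, ← map_mul,
    inv_mul_cancel₀ r.form_root_ne_zero, map_one, one_smul]

variable {A} in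
theorem rootForm_apply (hσ : pointStab σ = pointwiseStab W X)
    (g : (autTangent W σ).pts A) (r : Refl W X) (x) :
    M.rootForm A r (g.1.1 x) = M.rootChar A r g.1.1 * M.rootForm A r x := by
  have h := congrArg (M.rootForm A r) (M.commutes_refl hσ g r x)
  rw [M.apply_rootVec hσ, map_smul, map_smul, map_smul, rootForm_rootVec, smul_eq_mul, smul_eq_mul,
    smul_eq_mul, ← mul_assoc] at h
  rw [← (isUnit_form_root A r r r.form_root_ne_zero).mul_left_inj, ← h]
  ring

variable {A} in
-- The number obtained by applying the form of `r` to the image of the root of `q` is computed with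
-- either scalar, and the form of `r` is invertible on that root.
theorem rootChar_eq_of_adj (hσ : pointStab σ = pointwiseStab W X)
    (g : (autTangent W σ).pts A) {r q : Refl W X} (h : r.Adj q) :
    M.rootChar A r g.1.1 = M.rootChar A q g.1.1 := by
  have h1 := M.rootForm_apply hσ g r (1 ⊗ₜ M.rootVec q)
  rw [M.apply_rootVec hσ, map_smul, rootForm_rootVec, smul_eq_mul] at h1
  exact ((isUnit_form_root A r q h).mul_left_inj.1 h1).symm

variable {A} in
theorem rootChar_eq_of_quot_eq (hσ : pointStab σ = pointwiseStab W X)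
    (g : (autTangent W σ).pts A) {r q : Refl W X}
    (h : Quot.mk Refl.Adj r = Quot.mk Refl.Adj q) :
    M.rootChar A r g.1.1 = M.rootChar A q g.1.1 :=
  congrArg (Quot.lift (fun r => M.rootChar A r g.1.1) fun _ _ h => M.rootChar_eq_of_adj hσ g h) h

/-- `rootChar` as a character. -/
def rootCharHom (r : Refl W X) : (autTangent W σ).pts A →* Aˣ :=
  MonoidHom.toHomUnits
    { toFun := fun g => M.rootChar A r g.1.1
      map_one' := by
        change algebraMap ℂ A (r.form r.root)⁻¹ * M.rootForm A r (1 ⊗ₜ M.rootVec r) = 1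
        rw [rootForm_rootVec, ← map_mul, inv_mul_cancel₀ r.form_root_ne_zero, map_one]
      map_mul' := fun g g' => by
        change algebraMap ℂ A (r.form r.root)⁻¹ *
          M.rootForm A r (g.1.1 (g'.1.1 (1 ⊗ₜ M.rootVec r))) = _
        refine (congrArg _ (M.rootForm_apply hσ g r _)).trans ?_
        exact mul_left_comm _ _ _ }

/-- The isomorphism from the automorphisms of the tangent space to a torus, on points. -/
def torusHom : (autTangent W σ).pts A →* (Quot (Refl.Adj (W := W) (X := X)) → Aˣ) :=
  MonoidHom.pi fun K => M.rootCharHom A hσ K.out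

theorem torusHom_apply (g : (autTangent W σ).pts A) (r : Refl W X) :
    (M.torusHom A hσ g (Quot.mk _ r) : A) = M.rootChar A r g.1.1 :=
  M.rootChar_eq_of_quot_eq hσ g (Quot.out_eq _)

theorem torusHom_injective (B : GradedBasis W X) (hgen : GeneratedByRefl W X) :
    Function.Injective (M.torusHom A hσ) := by
  intro g g' h
  refine Subtype.ext (Units.ext (LinearMap.ext fun x => M.ext_rootForm A B hgen fun r => ?_))
  rw [M.rootForm_apply hσ, M.rootForm_apply hσ, ← M.torusHom_apply A hσ, h, M.torusHom_apply]

/-- The endomorphism of the tangent space scaling the roots in each class. -/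
theorem exists_scaling [Module.Finite ℂ V] (hgen : GeneratedByRefl W X)
    (a : Quot (Refl.Adj (W := W) (X := X)) → A) : ∃ γ : Module.End A (A ⊗[ℂ] tangentSpace σ),
      ∀ (r : Refl W X) x, M.rootForm A r (γ x) = a (Quot.mk _ r) * M.rootForm A r x := by
  -- A basis extracted from the roots lets the scaling be defined without checking linear relations.
  -- The remaining roots are handled by testing against forms.
  obtain ⟨κ, f, -, hspan, hli⟩ := exists_linearIndependent' ℂ M.rootVec
  let b : Module.Basis κ ℂ (tangentSpace σ) :=
    Module.Basis.mk hli (hspan ▸ M.span_rootVec hgen)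
  have hb : ∀ i, b i = M.rootVec (f i) := fun i => Module.Basis.mk_apply _ _ i
  let γ : Module.End A (A ⊗[ℂ] tangentSpace σ) :=
    (b.baseChange A).constr A fun i => a (Quot.mk _ (f i)) • ((1 : A) ⊗ₜ M.rootVec (f i))
  refine ⟨γ, fun r x => ?_⟩
  have : M.rootForm A r ∘ₗ γ = a (Quot.mk _ r) • M.rootForm A r := by
    refine (b.baseChange A).ext fun i => ?_
    rw [LinearMap.comp_apply, Module.Basis.constr_basis, LinearMap.smul_apply, map_smul,
      Module.Basis.baseChange_apply, hb, rootForm_rootVec]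
    -- Either the form of `r` kills this root, or the two reflections are adjacent and their classes
    -- carry the same scalar.
    by_cases h : r.form (f i).root = 0
    · rw [h, map_zero, smul_zero, smul_zero]
    · rw [(Quot.sound h : Quot.mk Refl.Adj r = Quot.mk Refl.Adj (f i))]
  exact LinearMap.congr_fun this x

theorem torusHom_surjective [Module.Finite ℂ V] (B : GradedBasis W X) (hgen : GeneratedByRefl W X) :
    Function.Surjective (M.torusHom A hσ) := by
  intro a
  obtain ⟨γ, hγ⟩ := M.exists_scaling A hgen fun K => (a K : A)
  obtain ⟨δ, hδ⟩ := M.exists_scaling A hgen fun K => (↑(a K)⁻¹ : A)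
  let u : (Module.End A (A ⊗[ℂ] tangentSpace σ))ˣ :=
    ⟨γ, δ, LinearMap.ext fun x => M.ext_rootForm A B hgen fun r => by
      rw [Module.End.mul_apply, hγ, hδ, Units.mul_inv_cancel_left]
      rfl,
    LinearMap.ext fun x => M.ext_rootForm A B hgen fun r => by
      rw [Module.End.mul_apply, hδ, hγ, Units.inv_mul_cancel_left]
      rfl⟩
  have hu : u ∈ (autTangent W σ).pts A := by
    intro w x
    refine M.commutes_of_commutes_refl A hσ hgen γ (fun r x => ?_) w x
    refine M.ext_rootForm A B hgen fun q => ?_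
    rw [hγ, hγ, map_smul, map_smul, rootForm_rootVec, smul_eq_mul, smul_eq_mul]
    by_cases h : q.form r.root = 0
    · rw [h, map_zero, mul_zero, mul_zero, mul_zero]
    · rw [(Quot.sound h : Quot.mk Refl.Adj q = Quot.mk Refl.Adj r), mul_assoc]
  refine ⟨⟨u, hu⟩, funext fun K => Units.ext ?_⟩
  induction K using Quot.inductionOn with | h r
  rw [M.torusHom_apply]
  change algebraMap ℂ A (r.form r.root)⁻¹ * M.rootForm A r (γ (1 ⊗ₜ M.rootVec r)) = _
  rw [hγ, rootForm_rootVec, mul_left_comm, ← map_mul, inv_mul_cancel₀ r.form_root_ne_zero, map_one,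
    mul_one]

variable {A} in
theorem rootChar_endMapFun {A' : CommAlgCat.{0} ℂ} (f : A ⟶ A') (r : Refl W X)
    (γ : Module.End A (A ⊗[ℂ] tangentSpace σ)) :
    M.rootChar A' r (endMapFun _ f γ) = f.hom (M.rootChar A r γ) := by
  have h1 : ∀ x, M.rootForm A' r (baseMap _ f x) = f.hom (M.rootForm A r x) := fun x => by
    have h := M.pairA_baseMap f x (1 ⊗ₜ coinvMk W X (lin r.form))
    rw [baseMap_tmul, map_one] at h
    exact h
  rw [rootChar, rootChar, endMapFun_tmul, one_smul, h1, map_mul, AlgHom.commutes]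

/-- The automorphisms of the tangent space form a torus. -/
def torusIso [Module.Finite ℂ V] (B : GradedBasis W X) (hgen : GeneratedByRefl W X) {n : ℕ}
    (e : Quot (Refl.Adj (W := W) (X := X)) ≃ Fin n) :
    (autTangent W σ).toFunctor ≅ torus n :=
  NatIso.ofComponents (fun A => MulEquiv.toGrpIso (X := GrpCat.of ((autTangent W σ).pts A)) (Y := GrpCat.of (Fin n → Aˣ))
      ((MulEquiv.ofBijective (M.torusHom A hσ)
        ⟨M.torusHom_injective A hσ B hgen, M.torusHom_surjective A hσ B hgen⟩).trans
          (MulEquiv.arrowCongr e (MulEquiv.refl Aˣ)))) fun {A A'} f => by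
    refine GrpCat.hom_ext (MonoidHom.ext fun (g : (autTangent W σ).pts A) => funext fun i => ?_)
    exact Units.ext (M.rootChar_endMapFun f _ g.1.1)

end Char

end ComponentModel

end TorusIso

/-- `W_X` is the stabilizer of the single vector `v`, so Steinberg's theorem applies. A reflection
fixing `v` lies in `W_X`, hence its mirror contains `X`. -/
theorem generatedByRefl {V : Type} [AddCommGroup V] [Module ℂ V] [Module.Finite ℂ V]
    {W : Subgroup (V ≃ₗ[ℂ] V)} (hW : IsReflectionGroup W) {X : Submodule ℂ V} (v : V)
    (hv : ∀ w : W, w ∈ pointwiseStab W X ↔ (w : V ≃ₗ[ℂ] V) v = v) :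
    ComponentModel.GeneratedByRefl W X := by
  intro h hh
  refine Subgroup.closure_mono ?_ (mem_reflectionStab hW v h.2 ((hv h).1 hh))
  rintro r ⟨hr, hr', hrv⟩
  exact ⟨⟨r, hr, hr', fun x hx => mem_pointwiseStab.1 ((hv ⟨r, hr⟩).2 hrv) x hx⟩, rfl⟩

end Cameral

end

theorem mainTheorem8
    (V : Type) [AddCommGroup V] [Module ℂ V] [Module.Finite ℂ V]
    (W : Subgroup (V ≃ₗ[ℂ] V)) (hW : Cameral.IsReflectionGroup W)
    (X : Submodule ℂ V) (hX : X ∈ Cameral.intersections (Cameral.mirrors W))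
    (R : Type) [CommRing R] [Algebra ℂ R] [MulSemiringAction W R] [SMulCommClass W ℂ R]
    (hR : Cameral.IsCameralCover W R)
    (σ : R →ₐ[ℂ] ℂ) (hσ : Cameral.pointStab σ = Cameral.pointwiseStab W X) :
    Nonempty ((Cameral.autTangent W σ).toFunctor ≅
      Cameral.torus
        (Cameral.irrComponents (Cameral.containing (Cameral.mirrors W) X)).ncard) ∧
    (∃ (d : (Cameral.autPointed W σ).toFunctor ⟶ (Cameral.autTangent W σ).toFunctor)
        (s : (Cameral.autTangent W σ).toFunctor ⟶ (Cameral.autPointed W σ).toFunctor),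
      Cameral.IsTangentAction W σ d ∧ s ≫ d = 𝟙 _ ∧
      Cameral.IsSemidirectProduct (Cameral.kernel d) s ∧
      Cameral.IsConnectedUnipotent (Cameral.kernel d).toFunctor) ∧
    (∃ ρ : Cameral.constantGroup (Cameral.StabQuotient W X) ⟶
        (Cameral.autCover W R).toFunctor,
      Cameral.IsSemidirectProduct (Cameral.autPointed W σ) ρ ∧
      Cameral.InducesNaturalAction W σ X ρ) := by
  have := hW.finite
  obtain ⟨φ, hφ⟩ := hR.exists_isFibre
  obtain ⟨v, hv⟩ := Cameral.algHom_eq_evalAt (σ.comp φ)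
  obtain ⟨M⟩ := hφ.exists_componentModel hσ hv
  obtain ⟨B⟩ := Cameral.exists_gradedBasis (W := W) (X := X)
  -- The hypothesis on the stabilizer of `σ` makes `W_X` a point stabilizer in `V`. Generation by
  -- reflections is needed only for the torus.
  have hgen : Cameral.ComponentModel.GeneratedByRefl W X :=
    Cameral.generatedByRefl hW v fun w => by rw [← hσ, hφ.mem_pointStab_iff hv]
  refine ⟨?_, ⟨M.tangentMap B hσ, M.tangentSection B hσ, M.isTangentAction_tangentMap B hσ,
    M.tangentSection_comp B hσ,
    Cameral.isSemidirectProduct_kernel _ _ (M.tangentSection_comp B hσ),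
    M.isConnectedUnipotent_kernel B hσ⟩,
    M.stabMap, M.isSemidirectProduct_stabMap hX, M.inducesNaturalAction_stabMap⟩
  rw [Cameral.Refl.ncard_irrComponents]
  exact ⟨M.torusIso hσ B hgen (Finite.equivFin _)⟩
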